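/- **Short-term coupling.** Let $p\in(0,1)$ and let $(\beta,h)$ be in the metastable regime: $\beta>1/p$ and $0<h<p\,\chi(\beta p)$, where $$\chi(\lambda)=\sqrt{1-\tfrac1\lambda}-\tfrac1{2\lambda}\log\Big[\lambda\Big(1+\sqrt{1-\tfrac1\lambda}\Big)^2\Big].$$ Let $G=(V,E)$ be the Erdős–Rényi random graph $\mathrm{ER}_n(p)$ on $n$ vertices, with law $\mathbb P_{\mathrm{ER}_n(p)}$. On $S_n=\{-1,+1\}^V$ put $H_n(\sigma)=-\frac1n\sum_{\{v,w\}\in E}\sigma(v)\sigma(w)-h\sum_{v\in V}\sigma(v)$. Given $G$, let $(\xi_t)_{t\ge0}$ be the continuous-time Markov process on $S_n$ that jumps from $\sigma$ to $\sigma'$ at rate $e^{-\beta[H_n(\sigma')-H_n(\sigma)]_+}$ if $\sigma,\sigma'$ differ at exactly one vertex and at rate $0$ otherwise. Put $\Gamma_n=\{-1,-1+\frac2n,\dots,1\}$, $I_n(a)=-\frac1n\log\binom{n}{(1+a)n/2}$ (extended to real $a$ by Gamma functions), $J_n(a)=2\beta(pa+h)-2I_n'(a)$, $\mathbf m_n=\min\{a\in\Gamma_n: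 J_n(a)\le0\}$, $\mathbf M_n=\frac n2(\mathbf m_n+1)$, and let $A_{\mathbf M_n}$ be the set of configurations with exactly $\mathbf M_n$ plus spins. Let $J(a)=2\beta(pa+h)+\log\frac{1-a}{1+a}$. Then $J$ has a smallest zero $\mathbf m$ in $(-1,1)$; it lies in $(-1,0)$, $J>0$ on $(-1,\mathbf m)$, $\mathbf m_n\to\mathbf m$, and $$\beta p<\frac1{1-\mathbf m^2}.$$ Moreover there are constants $\kappa,C>0$ depending only on $p,\beta,h$ such that, with $\mathbb P_{\mathrm{ER}_n(p)}$-probability tending to $1$ as $n\to\infty$, the following holds: for all initial states $\xi_0,\tilde\xi_0\in A_{\mathbf M_n}$ there is a coupling $(\xi_t,\tilde\xi_t)_{t\ge0}$ of the dynamics started from $\xi_0$ and the dynamics started from $\tilde\xi_0$ such that $$\mathbb P\big[\xi_{2n}\ne\tilde\xi_{2n}\big]\le e^{-n^{2/3}},$$ and such that the disagreement set $W_t=\{v\in V:\xi_t(v)\neq\tilde\xi_t(v)\}$ contracts: $$\mathbb E\,|W_t|\le C e^{-\kappa t}\,|W_0|+e^{-n^{2/3}}\qquad\text{for all }0\le t\le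 2n .$$ -/

import Mathlib

open scoped NNReal Topology

noncomputable section

namespace ERGlauber

/-- Spin configurations: each of the `n` vertices carries a spin `+1` or `-1`. -/
abbrev Config (n : ℕ) : Type := Fin n → ℤˣ

/-- The spin at `v` as a real number. -/
def spin {n : ℕ} (σ : Config n) (v : Fin n) : ℝ := ((σ v : ℤ) : ℝ)

/-- The vertex-volume: the number of `+1` spins. -/
def volume {n : ℕ} (σ : Config n) : ℕ := (Finset.univ.filter fun v => σ v = 1).card

/-- The set of vertices at which two configurations disagree. -/
def disagreement {n : ℕ} (σ σ' : Config n) : Finset (Fin n) :=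
  Finset.univ.filter fun v => σ v ≠ σ' v

open Classical in
/-- The Hamiltonian: interaction `1/n` along every (unordered) edge, external field `h`. -/
def hamiltonian {n : ℕ} (G : SimpleGraph (Fin n)) (h : ℝ) (σ : Config n) : ℝ :=
  -(1 / (n : ℝ)) * ∑ e ∈ G.edgeFinset, (e.map (spin σ)).mul - h * ∑ v, spin σ v

/-- The `ℓ¹`-distance between configurations. -/
def l1dist {n : ℕ} (σ σ' : Config n) : ℝ := ∑ v, |spin σ v - spin σ' v|

open Classical in
/-- The Metropolis jump rates: only single spin flips have positive rate. -/
def rate {n : ℕ} (G : SimpleGraph (Fin n)) (β h : ℝ) (σ σ' : Config n) : ℝ :=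
  if l1dist σ σ' = 2 then
    Real.exp (-β * max (hamiltonian G h σ' - hamiltonian G h σ) 0)
  else 0

/-- The generator (`Q`-matrix) of the dynamics. -/
def generator {n : ℕ} (G : SimpleGraph (Fin n)) (β h : ℝ) :
    Matrix (Config n) (Config n) ℝ :=
  Matrix.of fun σ σ' => if σ = σ' then -∑ η, rate G β h σ η else rate G β h σ σ'

/-- The transition probabilities `e^{tL}`, with `L` the generator. -/
def transition {n : ℕ} (G : SimpleGraph (Fin n)) (β h : ℝ) (t : ℝ) :
    Matrix (Config n) (Config n) ℝ :=
  NormedSpace.exp (t • generator G β h)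

/-- `X` is a version, on the probability space `(Ω, μ)`, of the continuous-time Markov process
with the above rates started from `σ₀`: its finite-dimensional distributions are those given by
the transition probabilities, and its paths are almost surely right-continuous with left limits
(the configuration space being finite and discrete). -/
structure IsDynamics {n : ℕ} (G : SimpleGraph (Fin n)) (β h : ℝ) (σ₀ : Config n)
    {Ω : Type} [MeasurableSpace Ω] (μ : MeasureTheory.Measure Ω)
    (X : ℝ≥0 → Ω → Config n) : Prop where
  measurable : ∀ t σ, MeasurableSet {ω | X t ω = σ}
  fdd : ∀ (k : ℕ) (t : Fin (k + 1) → ℝ≥0) (η : Fin (k + 1) → Config n),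
    Monotone t → t 0 = 0 → η 0 = σ₀ →
      μ.real {ω | ∀ i, X (t i) ω = η i} =
        ∏ i : Fin k, transition G β h ((t i.succ : ℝ) - (t i.castSucc : ℝ))
          (η i.castSucc) (η i.succ)
  right_continuous : ∀ᵐ ω ∂μ, ∀ t : ℝ≥0, ∀ᶠ s in 𝓝[>] t, X s ω = X t ω
  left_limits : ∀ᵐ ω ∂μ, ∀ t : ℝ≥0, ∃ σ : Config n, ∀ᶠ s in 𝓝[<] t, X s ω = σ

/-- A coupling of the dynamics started from `σ` with the dynamics started from `σ'`:
both processes are defined on one probability space. -/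
structure Coupling {n : ℕ} (G : SimpleGraph (Fin n)) (β h : ℝ) (σ σ' : Config n) where
  Ω : Type
  mΩ : MeasurableSpace Ω
  P : MeasureTheory.Measure Ω
  prob : MeasureTheory.IsProbabilityMeasure P
  X : ℝ≥0 → Ω → Config n
  Y : ℝ≥0 → Ω → Config n
  dynamics_X : IsDynamics G β h σ P X
  dynamics_Y : IsDynamics G β h σ' P Y

/-- The probability that the two coupled copies differ at time `t`. -/
def Coupling.probNe {n : ℕ} {G : SimpleGraph (Fin n)} {β h : ℝ} {σ σ' : Config n}
    (c : Coupling G β h σ σ') (t : ℝ≥0) : ℝ :=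
  letI := c.mΩ
  c.P.real {ω | c.X t ω ≠ c.Y t ω}

/-- The expected number of vertices at which the two coupled copies disagree at time `t`. -/
def Coupling.meanDisagreement {n : ℕ} {G : SimpleGraph (Fin n)} {β h : ℝ} {σ σ' : Config n}
    (c : Coupling G β h σ σ') (t : ℝ≥0) : ℝ :=
  letI := c.mΩ
  ∫ ω, ((disagreement (c.X t ω) (c.Y t ω)).card : ℝ) ∂c.P

/-- The threshold function of the metastable regime. -/
def chi (l : ℝ) : ℝ :=
  √(1 - 1 / l) - 1 / (2 * l) * Real.log (l * (1 + √(1 - 1 / l)) ^ 2)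

/-- The parameters `β, h` are in the metastable regime for edge probability `p`. -/
def Metastable (p β h : ℝ) : Prop := 1 / p < β ∧ 0 < h ∧ h < p * chi (β * p)

/-- The magnetizations `-1, -1 + 2/n, …, 1`. -/
def magGrid (n : ℕ) : Set ℝ := {a | ∃ k : ℕ, k ≤ n ∧ a = -1 + 2 * (k : ℝ) / n}

/-- `I_n(a) = -(1/n) log (n choose (1+a)n/2)`, the binomial coefficient being written with Gamma
functions so that `a` is a real variable in which `I_n` can be differentiated. -/
def In (n : ℕ) (a : ℝ) : ℝ :=
  -(1 / (n : ℝ)) * Real.log (Real.Gamma (n + 1) /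
    (Real.Gamma ((1 + a) / 2 * n + 1) * Real.Gamma ((1 - a) / 2 * n + 1)))

/-- `J_n(a) = 2β(pa + h) - 2 I_n'(a)`. -/
def Jn (p β h : ℝ) (n : ℕ) (a : ℝ) : ℝ := 2 * β * (p * a + h) - 2 * deriv (In n) a

/-- The limit `J(a) = 2β(pa + h) + log ((1-a)/(1+a))` of `J_n`, for `-1 < a < 1`. -/
def J (p β h a : ℝ) : ℝ := 2 * β * (p * a + h) + Real.log ((1 - a) / (1 + a))

/-- The metastable magnetization `m_n = min {a ∈ Γ_n : J_n(a) ≤ 0}` (a minimum over a finite set,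
nonempty for all large `n`). -/
def mn (p β h : ℝ) (n : ℕ) : ℝ := sInf {a | a ∈ magGrid n ∧ Jn p β h n a ≤ 0}

/-- The metastable volume `M_n = (n/2)(m_n + 1)`. -/
def Mn (p β h : ℝ) (n : ℕ) : ℝ := n / 2 * (mn p β h n + 1)

/-- The metastable set: the configurations of volume `M_n`. -/
def metastableSet (p β h : ℝ) (n : ℕ) : Set (Config n) := {σ | (volume σ : ℝ) = Mn p β h n}

end ERGlauber

end

/-! The two copies run under this coupling: a vertex where they agree flips in both at the smaller
of its two rates and in one copy alone at the excess; a vertex where they disagree flips in each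
copy separately. Since the copies differ only if the disagreement set W is nonempty, the probability
of differing is at most E|W|, so everything rests on the drift of |W|, computed in
`coupledGen_discrepancy`.

Near the metastable state a vertex feels a field close to s = pm + h < 0. There a plus spin flips at
rate 1, whatever the exact field, and a minus spin at rate r = e^{2βs}. A disagreement (one plus,
one minus) therefore heals at rate about 1 + r. It shifts the fields at its neighbours by 2/n, which
matters only at minus spins, with Lipschitz constant 2βr; about pn(1-m)/2 neighbours are minus, so
it spawns new disagreements at rate at most about 2βp(1-m)r. The equation J(m) = 0 says (1-m)r =
1+m, whence 1 + r = 2/(1-m), and healing wins exactly when βp < 1/(1-m²), that is, J'(m) < 0. This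
is `coupledGen_discrepancy_le_of_good`.

The computation needs every neighbourhood to have magnetization near m. The initial states have the
right total magnetization but may be arranged arbitrarily, so there is a burn-in of constant length
T. Two estimates give the regularity from T up to time 2n, with exponentially small error. The total
magnetization is trapped near m by an exponential Lyapunov function (`magnetization_tail`). Given
that, the drift of each spin is nearly -(1+r)(spin - m), so the magnetization around each vertex
relaxes exponentially; `exp_localDev_le` follows its exponential moment. During the burn-in |W|
grows at most by a constant factor, which goes into C. `WellConstants.discrepancy_decay` combines
these by a Grönwall argument.

The graph enters only through `Quasirandom`: almost equal degrees, and cut-norm closeness to the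
constant p. Both hold with probability tending to 1 by Chernoff bounds, 4^n sign patterns being
harmless against e^{-cn²}.

The coupled process itself is built by uniformization: exponential clocks and i.i.d. random maps of
the state space. Path probabilities and the matrix semigroup solve the same renewal equation, hence
agree (`pathLaw_markov`). Each copy has the right law because the coupled generator is intertwined
with the single-copy one.

Finally, J is strictly decreasing on (-1,-s₀] with s₀ = √(1-1/(βp)), and the upper bound on h is the
statement J(-s₀) < 0; so the first zero lies left of -s₀ and is non-degenerate. At grid points J_n
is J with the logarithm replaced by a difference of harmonic numbers, which gives m_n → m. -/

open scoped NNReal Topology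

/-! ### Semigroups of finite Q-matrices. -/

noncomputable section

namespace FiniteMarkov

open NormedSpace Matrix

variable {S R : Type*} [Fintype S] [DecidableEq S] [Fintype R] [DecidableEq R]

/-- A `Q`-matrix: nonnegative off the diagonal, with rows summing to zero. -/
structure IsQMatrix (Q : Matrix S S ℝ) : Prop where
  offDiag_nonneg : ∀ i j, i ≠ j → 0 ≤ Q i j
  row_sum : ∀ i, ∑ j, Q i j = 0

lemma hasDerivAt_exp_apply (Q : Matrix S S ℝ) (t : ℝ) (i j : S) :
    HasDerivAt (fun u : ℝ => exp (u • Q) i j) ((exp (t • Q) * Q) i j) t := by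
  -- The exponential calculus needs a Banach algebra; the choice of norm is immaterial, its topology
  -- being the entrywise one.
  let _ : NormedRing (Matrix S S ℝ) := Matrix.linftyOpNormedRing
  let _ : NormedAlgebra ℝ (Matrix S S ℝ) := Matrix.linftyOpNormedAlgebra
  have h := hasDerivAt_exp_smul_const (𝕂 := ℝ) Q t
  exact hasDerivAt_pi.1 (hasDerivAt_pi.1 h i) j

lemma exp_commute (Q : Matrix S S ℝ) (t : ℝ) : exp (t • Q) * Q = Q * exp (t • Q) := by
  let _ : NormedRing (Matrix S S ℝ) := Matrix.linftyOpNormedRing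
  let _ : NormedAlgebra ℝ (Matrix S S ℝ) := Matrix.linftyOpNormedAlgebra
  exact (((Commute.refl Q).smul_left t).exp_left).eq

lemma hasDerivAt_exp_mulVec (Q : Matrix S S ℝ) {f f' : ℝ → S → ℝ} {t : ℝ}
    (hf : ∀ y, HasDerivAt (fun u => f u y) (f' t y) t) (z : S) :
    HasDerivAt (fun u => (exp (u • Q) *ᵥ f u) z) ((exp (t • Q) *ᵥ (Q *ᵥ f t + f' t)) z) t := by
  have h : HasDerivAt (fun u => ∑ y, exp (u • Q) z y * f u y)
      (∑ y, ((exp (t • Q) * Q) z y * f t y + exp (t • Q) z y * f' t y)) t :=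
    HasDerivAt.fun_sum fun y _ => (hasDerivAt_exp_apply Q t z y).mul (hf y)
  have e : (exp (t • Q) *ᵥ (Q *ᵥ f t + f' t)) z
      = ∑ y, ((exp (t • Q) * Q) z y * f t y + exp (t • Q) z y * f' t y) := by
    rw [Finset.sum_add_distrib, mulVec_add, mulVec_mulVec]
    rfl
  rw [e]
  exact h

lemma exp_nonneg_of_nonneg {A : Matrix S S ℝ} (hA : ∀ i j, 0 ≤ A i j) (i j : S) :
    0 ≤ exp A i j := by
  let _ : NormedRing (Matrix S S ℝ) := Matrix.linftyOpNormedRing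
  let _ : NormedAlgebra ℝ (Matrix S S ℝ) := Matrix.linftyOpNormedAlgebra
  have h := NormedSpace.exp_series_hasSum_exp' (𝕂 := ℝ) A
  have hp : ∀ k : ℕ, ∀ i j, 0 ≤ (A ^ k) i j := by
    intro k
    induction k with
    | zero => intro i j; rw [pow_zero, Matrix.one_apply]; split_ifs <;> norm_num
    | succ k ih =>
      intro i j
      rw [pow_succ, Matrix.mul_apply]
      exact Finset.sum_nonneg fun l _ => mul_nonneg (ih i l) (hA l j)
  have h2 : HasSum (fun k : ℕ => ((k.factorial : ℝ)⁻¹ • A ^ k) i j) (exp A i j) :=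
    (Pi.hasSum.1 (Pi.hasSum.1 h i)) j
  exact h2.nonneg fun k => by
    rw [Matrix.smul_apply, smul_eq_mul]
    exact mul_nonneg (by positivity) (hp k i j)

/-- Scalar matrices commute with `P`. The right side is a positive multiple of the exponential of a
nonnegative matrix when `P` is nonnegative, which is how positivity of the semigroup is obtained. -/
lemma exp_smul_sub_one (P : Matrix S S ℝ) (c t : ℝ) :
    exp (t • (c • (P - 1))) = Real.exp (-(c * t)) • exp ((c * t) • P) := by
  let _ : NormedRing (Matrix S S ℝ) := Matrix.linftyOpNormedRing
  let _ : NormedAlgebra ℝ (Matrix S S ℝ) := Matrix.linftyOpNormedAlgebra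
  have e : t • (c • (P - 1)) = (c * t) • P + algebraMap ℝ (Matrix S S ℝ) (-(c * t)) := by
    rw [Algebra.algebraMap_eq_smul_one, smul_smul, smul_sub, mul_comm t c, neg_smul, sub_eq_add_neg]
  have h1 : exp (algebraMap ℝ (Matrix S S ℝ) (-(c * t))) = Real.exp (-(c * t)) • 1 := by
    have := algebraMap_exp_comm (𝕂 := ℝ) (𝔸 := Matrix S S ℝ) (-(c * t))
    rw [← Real.exp_eq_exp_ℝ, Algebra.algebraMap_eq_smul_one] at this
    exact this.symm
  rw [e, Matrix.exp_add_of_commute _ _ (Algebra.commute_algebraMap_right _ _), h1, mul_smul_comm, mul_one]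

lemma exp_zero_smul (Q : Matrix S S ℝ) : exp ((0 : ℝ) • Q) = 1 := by
  rw [zero_smul, NormedSpace.exp_zero]

namespace IsQMatrix

variable {Q : Matrix S S ℝ}

/-- Uniformization: once `c` exceeds every diagonal entry in absolute value, `1 + Q/c` is a
stochastic matrix. -/
lemma exists_rate (hQ : IsQMatrix Q) :
    ∃ (c : ℝ) (P : Matrix S S ℝ), 0 < c ∧ (∀ i j, 0 ≤ P i j) ∧ (∀ i, ∑ j, P i j = 1) ∧
      Q = c • (P - 1) := by
  have hc : ∀ i, |Q i i| ≤ ∑ k, |Q k k| := fun i =>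
    Finset.single_le_sum (f := fun k => |Q k k|) (fun _ _ => abs_nonneg _) (Finset.mem_univ i)
  set c : ℝ := 1 + ∑ k, |Q k k| with hcdef
  have hc0 : 0 < c := by positivity
  refine ⟨c, 1 + c⁻¹ • Q, hc0, fun i j => ?_, fun i => ?_, ?_⟩
  · rw [Matrix.add_apply, Matrix.smul_apply, smul_eq_mul, Matrix.one_apply]
    split_ifs with hij
    · subst hij
      have h1 := neg_abs_le (Q i i)
      have h2 : -c ≤ Q i i := by linarith [hc i]
      have : c⁻¹ * -c ≤ c⁻¹ * Q i i := mul_le_mul_of_nonneg_left h2 (by positivity)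
      rw [mul_neg, inv_mul_cancel₀ hc0.ne'] at this
      linarith
    · rw [zero_add]
      exact mul_nonneg (by positivity) (hQ.offDiag_nonneg i j hij)
  · simp only [Matrix.add_apply, Matrix.smul_apply, smul_eq_mul, Finset.sum_add_distrib,
      ← Finset.mul_sum, hQ.row_sum i, Matrix.one_apply]
    simp
  · rw [add_sub_cancel_left, smul_smul, mul_inv_cancel₀ hc0.ne', one_smul]

lemma exp_nonneg (hQ : IsQMatrix Q) {t : ℝ} (ht : 0 ≤ t) (i j : S) : 0 ≤ exp (t • Q) i j := by
  obtain ⟨c, P, hc, hP, -, rfl⟩ := hQ.exists_rate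
  rw [exp_smul_sub_one, Matrix.smul_apply, smul_eq_mul]
  refine mul_nonneg (Real.exp_pos _).le (exp_nonneg_of_nonneg (fun i j => ?_) i j)
  rw [Matrix.smul_apply, smul_eq_mul]
  exact mul_nonneg (by positivity) (hP i j)

lemma exp_mulVec_mono (hQ : IsQMatrix Q) {t : ℝ} (ht : 0 ≤ t) {f g : S → ℝ} (hfg : ∀ y, f y ≤ g y)
    (z : S) : (exp (t • Q) *ᵥ f) z ≤ (exp (t • Q) *ᵥ g) z :=
  Finset.sum_le_sum fun y _ => mul_le_mul_of_nonneg_left (hfg y) (hQ.exp_nonneg ht z y)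

end IsQMatrix

/-- Dynkin's formula for a time-dependent observable, followed by the mean value inequality. Every
later moment or Grönwall estimate is this lemma with a suitable `f`. -/
lemma exp_mulVec_le_add {Q : Matrix S S ℝ} {f f' : ℝ → S → ℝ} {t₀ t₁ B : ℝ} (h01 : t₀ ≤ t₁)
    (hf : ∀ t ∈ Set.Icc t₀ t₁, ∀ y, HasDerivAt (fun u => f u y) (f' t y) t) (z : S)
    (hB : ∀ t ∈ Set.Icc t₀ t₁, (exp (t • Q) *ᵥ (Q *ᵥ f t + f' t)) z ≤ B) :
    (exp (t₁ • Q) *ᵥ f t₁) z ≤ (exp (t₀ • Q) *ᵥ f t₀) z + B * (t₁ - t₀) := by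
  have hd : ∀ t ∈ Set.Icc t₀ t₁, HasDerivAt (fun u => (exp (u • Q) *ᵥ f u) z)
      ((exp (t • Q) *ᵥ (Q *ᵥ f t + f' t)) z) t :=
    fun t ht => hasDerivAt_exp_mulVec Q (hf t ht) z
  have := (convex_Icc t₀ t₁).image_sub_le_mul_sub_of_deriv_le
    (fun t ht => (hd t ht).continuousAt.continuousWithinAt)
    (fun t ht => (hd t (interior_subset ht)).differentiableAt.differentiableWithinAt)
    (C := B) (fun t ht => by
      rw [(hd t (interior_subset ht)).deriv]; exact hB t (interior_subset ht))
    t₀ (Set.left_mem_Icc.2 h01) t₁ (Set.right_mem_Icc.2 h01) h01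
  linarith

/-- If the generators are intertwined by `π`, so are the semigroups. -/
lemma exp_mulVec_comp {Q : Matrix S S ℝ} {Q' : Matrix R R ℝ} {π : S → R}
    (h : ∀ (f : R → ℝ) z, (Q *ᵥ (f ∘ π)) z = (Q' *ᵥ f) (π z)) {t : ℝ} (ht : 0 ≤ t)
    (f : R → ℝ) (z : S) :
    (exp (t • Q) *ᵥ (f ∘ π)) z = (exp (t • Q') *ᵥ f) (π z) := by
  have key : ∀ g : R → ℝ, (exp (t • Q) *ᵥ (g ∘ π)) z ≤ (exp (t • Q') *ᵥ g) (π z) := by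
    intro g
    have hder : ∀ s : ℝ, ∀ y : R, HasDerivAt (fun u : ℝ => (exp ((t - u) • Q') *ᵥ g) y)
        (-(Q' *ᵥ (exp ((t - s) • Q') *ᵥ g)) y) s := by
      intro s y
      have h1 := hasDerivAt_exp_mulVec Q' (f := fun _ => g) (f' := fun _ => 0) (t := t - s)
        (fun y => hasDerivAt_const _ _) y
      have h2 := HasDerivAt.scomp s h1 ((hasDerivAt_id s).const_sub t)
      have e : (-(Q' *ᵥ (exp ((t - s) • Q') *ᵥ g)) y)
          = (-1 : ℝ) • (exp ((t - s) • Q') *ᵥ (Q' *ᵥ g + 0)) y := by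
        rw [add_zero, mulVec_mulVec, mulVec_mulVec, exp_commute]; simp
      rw [e]
      exact h2
    -- Interpolation between the two semigroups: by intertwining, the derivative in `u` of
    -- `e^{uQ}((e^{(t-u)Q'} g) ∘ π)` vanishes. The opposite inequality comes from `-g`.
    have := exp_mulVec_le_add (Q := Q) (B := 0) (f := fun u => (exp ((t - u) • Q') *ᵥ g) ∘ π)
      (f' := fun u y => -(Q' *ᵥ (exp ((t - u) • Q') *ᵥ g)) (π y)) ht
      (fun s _ y => hder s (π y)) z (fun s _ => by
        have e : Q *ᵥ ((exp ((t - s) • Q') *ᵥ g) ∘ π)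
            + (fun y => -(Q' *ᵥ (exp ((t - s) • Q') *ᵥ g)) (π y)) = 0 := by
          funext y
          rw [Pi.add_apply, h]
          simp
        rw [e, mulVec_zero]; rfl)
    simpa [exp_zero_smul] using this
  refine le_antisymm (key f) ?_
  have := key (-f)
  rw [show (-f) ∘ π = -(f ∘ π) from rfl, mulVec_neg, mulVec_neg] at this
  simpa using this

/-- Collapsing the state space to a point intertwines `Q` with the zero generator. -/
lemma IsQMatrix.exp_mulVec_const {Q : Matrix S S ℝ} (hQ : IsQMatrix Q) {t : ℝ} (ht : 0 ≤ t) (a : ℝ)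
    (z : S) : (exp (t • Q) *ᵥ fun _ => a) z = a := by
  have := exp_mulVec_comp (Q := Q) (Q' := (0 : Matrix Unit Unit ℝ)) (π := fun _ => ())
    (fun f z => by
      have : ∑ j, Q z j * f () = 0 := by rw [← Finset.sum_mul, hQ.row_sum, zero_mul]
      rw [zero_mulVec]; exact this) ht (fun _ => a) z
  rw [smul_zero, NormedSpace.exp_zero, one_mulVec] at this
  exact this

end FiniteMarkov

end

open scoped NNReal Topology

noncomputable section

namespace FiniteMarkov

open MeasureTheory

/-! ### Exponential waiting times -/

/-- The exponential law of rate `c`. -/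
def waiting (c : ℝ) : Measure ℝ :=
  (volume.restrict (Set.Ioi 0)).withDensity fun a => ENNReal.ofReal (c * Real.exp (-(c * a)))

lemma measurable_density (c : ℝ) :
    Measurable fun a : ℝ => ENNReal.ofReal (c * Real.exp (-(c * a))) := by fun_prop

lemma lintegral_waiting (c : ℝ) {g : ℝ → ENNReal} (hg : Measurable g) :
    ∫⁻ a, g a ∂waiting c =
      ∫⁻ a in Set.Ioi 0, ENNReal.ofReal (c * Real.exp (-(c * a))) * g a := by
  rw [waiting, lintegral_withDensity_eq_lintegral_mul _ (measurable_density c) hg]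
  rfl

lemma lintegral_Ioi_density {c : ℝ} (hc : 0 < c) :
    ∫⁻ a in Set.Ioi 0, ENNReal.ofReal (c * Real.exp (-(c * a))) = 1 := by
  have h1 : ∀ a : ℝ, c * Real.exp (-(c * a)) = c * Real.exp ((-c) * a) := fun a => by
    rw [neg_mul]
  simp only [h1]
  rw [← ofReal_integral_eq_lintegral_ofReal
    ((integrableOn_exp_mul_Ioi (neg_lt_zero.2 hc) 0).const_mul c)
    (ae_of_all _ fun a => by positivity), integral_const_mul,
    integral_exp_mul_Ioi (neg_lt_zero.2 hc)]
  simp [hc.ne']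

lemma isProbabilityMeasure_waiting {c : ℝ} (hc : 0 < c) : IsProbabilityMeasure (waiting c) :=
  ⟨by
    have := lintegral_waiting c (g := fun _ => 1) measurable_const
    simpa [lintegral_Ioi_density hc] using this⟩

lemma waiting_ae_pos (c : ℝ) : ∀ᵐ a ∂waiting c, 0 < a := by
  have h : ∀ᵐ a ∂(volume.restrict (Set.Ioi (0 : ℝ))), 0 < a :=
    ae_restrict_mem measurableSet_Ioi
  exact (withDensity_absolutelyContinuous _ _).ae_le h

lemma lintegral_density_memoryless {c t : ℝ} (g : ℝ → ENNReal) :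
    ∫⁻ a in Set.Ioi t, ENNReal.ofReal (c * Real.exp (-(c * a))) * g (a - t) =
      ENNReal.ofReal (Real.exp (-(c * t))) *
        ∫⁻ a in Set.Ioi 0, ENNReal.ofReal (c * Real.exp (-(c * a))) * g a := by
  rw [← lintegral_const_mul' _ _ ENNReal.ofReal_ne_top, ← lintegral_indicator measurableSet_Ioi,
    ← lintegral_indicator measurableSet_Ioi,
    ← lintegral_sub_right_eq_self (μ := volume) (Set.indicator (Set.Ioi 0) _) t]
  congr 1
  funext a
  by_cases h : t < a
  · rw [Set.indicator_of_mem (Set.mem_Ioi.2 h), Set.indicator_of_mem (by simpa using h),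
      ← mul_assoc, ← ENNReal.ofReal_mul (Real.exp_pos _).le]
    congr 2
    rw [mul_left_comm, ← Real.exp_add]
    ring_nf
  · rw [Set.indicator_of_notMem (by simpa using h), Set.indicator_of_notMem (by simpa using h)]

lemma lintegral_waiting_split {c t : ℝ} (ht : 0 ≤ t) {g : ℝ → ENNReal} (hg : Measurable g) :
    ∫⁻ a, g a ∂waiting c =
      (∫⁻ a in Set.Ioc 0 t, ENNReal.ofReal (c * Real.exp (-(c * a))) * g a) +
        ∫⁻ a in Set.Ioi t, ENNReal.ofReal (c * Real.exp (-(c * a))) * g a := by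
  rw [lintegral_waiting c hg, ← Set.Ioc_union_Ioi_eq_Ioi ht,
    lintegral_union measurableSet_Ioi (Set.Ioc_disjoint_Ioi le_rfl)]

/-- The strict inequality is what rules out explosion in `ae_nonExplosive`. -/
lemma waiting_Iic_lt_one {c : ℝ} (hc : 0 < c) (t : ℝ) : waiting c (Set.Iic t) < 1 := by
  have := isProbabilityMeasure_waiting hc
  rcases lt_or_ge t 0 with ht | ht
  · have h0 : waiting c (Set.Iic t) = 0 := by
      refine measure_mono_null ?_ (waiting_ae_pos c)
      intro a ha
      have : a ≤ t := ha
      simp only [Set.mem_compl_iff, Set.mem_ofPred_eq, not_lt]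
      linarith
    rw [h0]; exact one_pos
  have h1 : waiting c (Set.Ioi t) = ENNReal.ofReal (Real.exp (-(c * t))) := by
    rw [← lintegral_indicator_one measurableSet_Ioi,
      lintegral_waiting_split ht (measurable_one.indicator measurableSet_Ioi)]
    have e1 : ∫⁻ a in Set.Ioc 0 t, ENNReal.ofReal (c * Real.exp (-(c * a))) *
        (Set.Ioi t).indicator 1 a = 0 := by
      rw [← lintegral_zero (μ := volume.restrict (Set.Ioc 0 t))]
      refine setLIntegral_congr_fun measurableSet_Ioc fun a ha => ?_
      rw [Set.indicator_of_notMem (by simpa using ha.2), mul_zero]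
    have e2 : ∫⁻ a in Set.Ioi t, ENNReal.ofReal (c * Real.exp (-(c * a))) *
        (Set.Ioi t).indicator 1 a
        = ∫⁻ a in Set.Ioi t, ENNReal.ofReal (c * Real.exp (-(c * a))) * (fun _ => 1) (a - t) := by
      refine setLIntegral_congr_fun measurableSet_Ioi fun a ha => ?_
      rw [Set.indicator_of_mem ha]; rfl
    rw [e1, e2, zero_add, lintegral_density_memoryless (fun _ => 1)]
    simp [lintegral_Ioi_density hc]
  have h2 : waiting c (Set.Iic t) + waiting c (Set.Ioi t) = 1 := by
    rw [← measure_union (Set.Iic_disjoint_Ioi le_rfl) measurableSet_Ioi, Set.Iic_union_Ioi,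
      measure_univ]
  refine lt_of_le_of_ne prob_le_one fun h => ?_
  rw [h, h1] at h2
  have h3 : ENNReal.ofReal (Real.exp (-(c * t))) = 0 := by
    have := (ENNReal.add_right_inj (a := 1) (by simp)).1 (h2.trans (add_zero 1).symm)
    exact this
  rw [ENNReal.ofReal_eq_zero] at h3
  exact absurd (Real.exp_pos _) (not_lt.2 h3)

/-! ### Splitting off the first coordinate of a sequence -/

/-- Prepend an entry to a sequence. -/
def cons {E : Type*} (a : E) (ω : ℕ → E) : ℕ → E
  | 0 => a
  | i + 1 => ω i

@[simp] lemma cons_zero {E : Type*} (a : E) (ω : ℕ → E) : cons a ω 0 = a := rfl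

@[simp] lemma cons_succ {E : Type*} (a : E) (ω : ℕ → E) (i : ℕ) : cons a ω (i + 1) = ω i := rfl

lemma measurable_cons {E : Type*} [MeasurableSpace E] :
    Measurable fun q : E × (ℕ → E) => cons q.1 q.2 := by
  refine measurable_pi_lambda _ fun i => ?_
  cases i with
  | zero => exact measurable_fst
  | succ i => exact (measurable_pi_apply i).comp measurable_snd

lemma map_cons_infinitePi {E : Type*} [MeasurableSpace E] (ν : Measure E)
    [IsProbabilityMeasure ν] :
    (ν.prod (Measure.infinitePi fun _ : ℕ => ν)).map (fun q => cons q.1 q.2) =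
      Measure.infinitePi fun _ : ℕ => ν := by
  classical
  refine Measure.eq_infinitePi _ fun s t ht => ?_
  obtain ⟨N, hN⟩ : ∃ N, s ⊆ Finset.range (N + 1) :=
    ⟨s.sup id, fun i hi => Finset.mem_range_succ_iff.2 (Finset.le_sup (f := id) hi)⟩
  -- Unconstrained coordinates are filled in with the whole space, so that the cylinder is indexed
  -- by an initial segment and index 0 can be split off.
  set t' : ℕ → Set E := fun i => if i ∈ s then t i else Set.univ with ht'
  have hm : ∀ i, MeasurableSet (t' i) := fun i => by
    simp only [ht']; split_ifs
    · exact ht i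
    · exact .univ
  have hpre : (fun q : E × (ℕ → E) => cons q.1 q.2) ⁻¹' (Set.pi s t) =
      t' 0 ×ˢ Set.pi (Finset.range N) (fun i => t' (i + 1)) := by
    ext ⟨a, ω⟩
    simp only [Set.mem_preimage, Set.mem_pi, Set.mem_prod, Finset.mem_coe, Finset.mem_range]
    constructor
    · intro h
      refine ⟨?_, fun i _ => ?_⟩
      · simp only [ht']; split_ifs with h0
        · exact h 0 h0
        · trivial
      · simp only [ht']; split_ifs with h0
        · exact h (i + 1) h0
        · trivial
    · rintro ⟨h0, h1⟩ i hi
      cases i with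
      | zero => simpa [ht', hi] using h0
      | succ i =>
        have := h1 i (by have := Finset.mem_range.1 (hN hi); omega)
        simpa [ht', hi] using this
  have hms : MeasurableSet (Set.pi (s : Set ℕ) t) :=
    MeasurableSet.pi s.countable_toSet fun i _ => ht i
  rw [Measure.map_apply measurable_cons hms, hpre, Measure.prod_prod,
    Measure.infinitePi_pi _ fun i _ => hm (i + 1), mul_comm,
    ← Finset.prod_range_succ' (fun i => ν (t' i)) N, ← Finset.prod_subset hN]
  · exact Finset.prod_congr rfl fun i hi => by simp [ht', hi]
  · intro i _ hi
    simp [ht', hi]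

/-- The law of an i.i.d. sequence, disintegrated along its first entry. -/
lemma infinitePi_apply_cons {E : Type*} [MeasurableSpace E] (ν : Measure E)
    [IsProbabilityMeasure ν] {B : Set (ℕ → E)} (hB : MeasurableSet B) :
    (Measure.infinitePi fun _ : ℕ => ν) B =
      ∫⁻ a, (Measure.infinitePi fun _ : ℕ => ν) {ω | cons a ω ∈ B} ∂ν := by
  conv_lhs => rw [← map_cons_infinitePi ν]
  rw [Measure.map_apply measurable_cons hB, Measure.prod_apply (measurable_cons hB)]
  rfl

end FiniteMarkov

end

open scoped NNReal Topology

noncomputable section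

namespace FiniteMarkov

open MeasureTheory

/-! ### Paths -/

variable {S : Type*}

/-- The time of the `k`-th jump. -/
def arrival {M : Type*} (ω : ℕ → ℝ × M) (k : ℕ) : ℝ := ∑ i ∈ Finset.range k, (ω i).1

/-- The number of jumps up to time `t`. -/
def jumpCount {M : Type*} (t : ℝ) (ω : ℕ → ℝ × M) : ℕ := sInf {k | t < arrival ω (k + 1)}

/-- The embedded chain: iterate the random maps. -/
def chain (z : S) (ω : ℕ → ℝ × (S → S)) : ℕ → S
  | 0 => z
  | k + 1 => (ω k).2 (chain z ω k)

/-- The continuous-time path. -/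
def path (z : S) (ω : ℕ → ℝ × (S → S)) (t : ℝ) : S := chain z ω (jumpCount t ω)

/-- Infinitely many jumps do not occur in finite time. -/
def NonExplosive {M : Type*} (ω : ℕ → ℝ × M) : Prop := ∀ t : ℝ, ∃ k, t < arrival ω (k + 1)

lemma arrival_cons {M : Type*} (a : ℝ × M) (ω : ℕ → ℝ × M) (k : ℕ) :
    arrival (cons a ω) (k + 1) = a.1 + arrival ω k := by
  rw [arrival, Finset.sum_range_succ', add_comm]
  rfl

lemma chain_cons (z : S) (a : ℝ × (S → S)) (ω : ℕ → ℝ × (S → S)) (k : ℕ) :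
    chain z (cons a ω) (k + 1) = chain (a.2 z) ω k := by
  induction k with
  | zero => rfl
  | succ k ih => rw [chain, ih]; rfl

lemma jumpCount_eq_iff {M : Type*} {t : ℝ} {ω : ℕ → ℝ × M} (h : ∃ k, t < arrival ω (k + 1))
    (k : ℕ) : jumpCount t ω = k ↔ t < arrival ω (k + 1) ∧ ∀ j < k, arrival ω (j + 1) ≤ t := by
  constructor
  · rintro rfl
    exact ⟨Nat.sInf_mem (s := {k | t < arrival ω (k + 1)}) h,
      fun j hj => not_lt.1 (Nat.notMem_of_lt_sInf (s := {k | t < arrival ω (k + 1)}) hj)⟩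
  · rintro ⟨h1, h2⟩
    refine le_antisymm (Nat.sInf_le (s := {k | t < arrival ω (k + 1)}) h1) ?_
    by_contra! hlt
    have hm := Nat.sInf_mem (s := {k | t < arrival ω (k + 1)}) h
    exact absurd (h2 _ hlt) (not_le.2 hm)

lemma path_cons_of_le {z : S} {a : ℝ × (S → S)} {ω : ℕ → ℝ × (S → S)} (hω : NonExplosive ω)
    {t : ℝ} (hat : a.1 ≤ t) :
    path z (cons a ω) t = path (a.2 z) ω (t - a.1) := by
  have h1 : jumpCount t (cons a ω) = jumpCount (t - a.1) ω + 1 := by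
    obtain ⟨h1, h2⟩ := (jumpCount_eq_iff (hω (t - a.1)) _).1 rfl
    refine (jumpCount_eq_iff ⟨jumpCount (t - a.1) ω + 1, ?_⟩ _).2 ⟨?_, fun j hj => ?_⟩
    · rw [arrival_cons]; linarith
    · rw [arrival_cons]; linarith
    · rw [arrival_cons]
      cases j with
      | zero => simpa [arrival] using hat
      | succ j => have := h2 j (by omega); linarith
  rw [path, h1, chain_cons, path]

/-- Looking from time `t` on amounts to shortening the first waiting time by `t`. The identity is
algebraic, valid for any sign of `a - t`; it is used when the first clock rings after `t`. -/
lemma path_cons_shift (z : S) (a : ℝ) (φ : S → S) (ω : ℕ → ℝ × (S → S)) (t s : ℝ) :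
    path z (cons (a, φ) ω) (t + s) = path z (cons (a - t, φ) ω) s := by
  have h1 : jumpCount (t + s) (cons (a, φ) ω) = jumpCount s (cons (a - t, φ) ω) := by
    unfold jumpCount
    congr 1
    ext k
    simp only [Set.mem_ofPred_eq, arrival_cons]
    constructor <;> intro h <;> linarith
  have h2 : ∀ k, chain z (cons (a, φ) ω) k = chain z (cons (a - t, φ) ω) k := by
    intro k
    cases k with
    | zero => rfl
    | succ k => rw [chain_cons, chain_cons]
  rw [path, path, h1, h2]

lemma path_zero_of_pos {z : S} {ω : ℕ → ℝ × (S → S)} (h : 0 < (ω 0).1) : path z ω 0 = z := by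
  have : jumpCount 0 ω = 0 := by
    refine Nat.sInf_eq_zero.2 (Or.inl ?_)
    simpa [arrival] using h
  rw [path, this]; rfl

lemma jumpCount_mono {M : Type*} {ω : ℕ → ℝ × M} (hω : NonExplosive ω) :
    Monotone fun t => jumpCount t ω := by
  intro s t hst
  have hm := Nat.sInf_mem (s := {k | t < arrival ω (k + 1)}) (hω t)
  exact Nat.sInf_le (s := {k | s < arrival ω (k + 1)}) (lt_of_le_of_lt hst hm)

lemma path_right_continuous (z : S) {ω : ℕ → ℝ × (S → S)} (hω : NonExplosive ω) (t : ℝ≥0) :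
    ∀ᶠ s : ℝ≥0 in 𝓝[>] t, path z ω s = path z ω t := by
  obtain ⟨h1, h2⟩ := (jumpCount_eq_iff (hω t) _).1 rfl
  have hc : ContinuousAt (fun s : ℝ≥0 => (s : ℝ)) t := NNReal.continuous_coe.continuousAt
  have he : ∀ᶠ s : ℝ≥0 in 𝓝[>] t, (s : ℝ) < arrival ω (jumpCount (t : ℝ) ω + 1) :=
    nhdsWithin_le_nhds (hc.eventually (eventually_lt_nhds h1))
  filter_upwards [he, self_mem_nhdsWithin] with s hs hts
  have : jumpCount (s : ℝ) ω = jumpCount (t : ℝ) ω :=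
    (jumpCount_eq_iff (hω s) _).2 ⟨hs, fun j hj =>
      (h2 j hj).trans (NNReal.coe_le_coe.2 (le_of_lt hts))⟩
  rw [path, path, this]

lemma path_left_limits [Nonempty S] (z : S) {ω : ℕ → ℝ × (S → S)} (hω : NonExplosive ω) (t : ℝ≥0) :
    ∃ y : S, ∀ᶠ s : ℝ≥0 in 𝓝[<] t, path z ω s = y := by
  rcases eq_or_ne t 0 with rfl | ht
  · refine ⟨z, ?_⟩
    have : Set.Iio (0 : ℝ≥0) = ∅ := by ext x; simp
    rw [this, nhdsWithin_empty]
    exact Filter.eventually_bot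
  have ht0 : 0 < t := pos_iff_ne_zero.2 ht
  -- The jump counts before `t` are bounded by the one at `t`, so their supremum is attained, and by
  -- monotonicity it persists up to `t`.
  set N : Set ℕ := {k | ∃ s : ℝ≥0, s < t ∧ jumpCount (s : ℝ) ω = k} with hN
  have hne : N.Nonempty := ⟨_, 0, ht0, rfl⟩
  have hb : BddAbove N := ⟨jumpCount (t : ℝ) ω, by
    rintro k ⟨s, hs, rfl⟩
    exact jumpCount_mono hω (NNReal.coe_le_coe.2 hs.le)⟩
  obtain ⟨s₀, hs₀, hk⟩ := Nat.sSup_mem hne hb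
  refine ⟨chain z ω (sSup N), ?_⟩
  filter_upwards [Ioo_mem_nhdsLT hs₀] with s hs
  have h1 : jumpCount (s : ℝ) ω ≤ sSup N := le_csSup hb ⟨s, hs.2, rfl⟩
  have h2 : sSup N ≤ jumpCount (s : ℝ) ω :=
    hk ▸ jumpCount_mono hω (NNReal.coe_le_coe.2 hs.1.le)
  rw [path, le_antisymm h1 h2]

/-! ### Measurability -/

section Measurability

variable {M : Type*} [MeasurableSpace M]

lemma measurable_arrival (k : ℕ) : Measurable fun ω : ℕ → ℝ × M => arrival ω k :=
  Finset.measurable_sum _ fun i _ => measurable_fst.comp (measurable_pi_apply i)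

lemma measurable_jumpCount :
    Measurable fun q : ℝ × (ℕ → ℝ × M) => jumpCount q.1 q.2 := by
  have hA : ∀ k, MeasurableSet {q : ℝ × (ℕ → ℝ × M) | q.1 < arrival q.2 (k + 1)} := fun k =>
    measurableSet_lt measurable_fst ((measurable_arrival (k + 1)).comp measurable_snd)
  refine measurable_of_Iic fun k => ?_
  -- The second set is the exploding case, where `sInf ∅ = 0` puts the count below every `k`.
  have : (fun q : ℝ × (ℕ → ℝ × M) => jumpCount q.1 q.2) ⁻¹' Set.Iic k =
      (⋃ j ∈ Finset.range (k + 1), {q | q.1 < arrival q.2 (j + 1)}) ∪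
        (⋂ j, {q | q.1 < arrival q.2 (j + 1)}ᶜ) := by
    ext q
    simp only [Set.mem_preimage, Set.mem_Iic, Set.mem_union, Set.mem_iUnion, Set.mem_iInter,
      Finset.mem_range, Set.mem_ofPred_eq, Set.mem_compl_iff, exists_prop]
    by_cases h : ∃ j, q.1 < arrival q.2 (j + 1)
    · have hm := Nat.sInf_mem (s := {k | q.1 < arrival q.2 (k + 1)}) h
      constructor
      · intro hk
        exact Or.inl ⟨_, Nat.lt_succ_of_le hk, hm⟩
      · rintro (⟨j, hj, h'⟩ | h')
        · exact (Nat.sInf_le (s := {k | q.1 < arrival q.2 (k + 1)}) h').trans (by omega)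
        · obtain ⟨j, hj⟩ := h; exact absurd hj (h' j)
    · push Not at h
      have h0 : jumpCount q.1 q.2 = 0 := by
        refine Nat.sInf_eq_zero.2 (Or.inr ?_)
        ext j; simpa using h j
      simp [h0, h]
  rw [this]
  exact (Finset.measurableSet_biUnion _ fun j _ => hA j).union (.iInter fun j => (hA j).compl)

end Measurability

section

variable [MeasurableSpace S] [Finite S] [DiscreteMeasurableSpace S]

lemma measurable_chain (z : S) (k : ℕ) :
    Measurable fun ω : ℕ → ℝ × (S → S) => chain z ω k := by
  induction k with
  | zero => exact measurable_const
  | succ k ih =>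
    have h1 : Measurable fun q : S × (S → S) => q.2 q.1 := by
      refine measurable_from_prod_countable_right fun y => measurable_pi_apply y
    exact h1.comp (ih.prodMk (measurable_snd.comp (measurable_pi_apply k)))

lemma measurable_path (z : S) :
    Measurable fun q : ℝ × (ℕ → ℝ × (S → S)) => path z q.2 q.1 := by
  have h1 : Measurable fun q : ℕ × (ℕ → ℝ × (S → S)) => chain z q.2 q.1 :=
    measurable_from_prod_countable_right fun k => measurable_chain z k
  exact h1.comp (measurable_jumpCount.prodMk measurable_snd)

/-- The path from time `t` on, as a function of nonnegative time. -/
def shiftPath (z : S) (t : ℝ) (ω : ℕ → ℝ × (S → S)) : ℝ≥0 → S := fun s => path z ω (t + s)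

lemma measurable_shiftPath (z : S) :
    Measurable fun q : ℝ × (ℕ → ℝ × (S → S)) => shiftPath z q.1 q.2 := by
  refine measurable_pi_lambda _ fun s => ?_
  exact (measurable_path z).comp ((measurable_fst.add_const _).prodMk measurable_snd)

end

end FiniteMarkov

end

/-! ### The uniformized chain, driven by waiting times and random maps independent of the initial
state, and its renewal equation. -/

open scoped NNReal Topology

noncomputable section

namespace FiniteMarkov

open MeasureTheory Matrix

variable {S : Type*} [Fintype S]

/-- A stochastic matrix together with the rate of the Poisson clock at which it is applied. -/
structure Uniformized (S : Type*) [Fintype S] where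
  c : ℝ
  P : Matrix S S ℝ
  c_pos : 0 < c
  nonneg : ∀ i j, 0 ≤ P i j
  row_sum : ∀ i, ∑ j, P i j = 1

namespace Uniformized

/-- The generator of the uniformized chain. -/
def gen [DecidableEq S] (D : Uniformized S) : Matrix S S ℝ := D.c • (D.P - 1)

variable [MeasurableSpace S]

/-- The law of one step of the embedded chain. -/
def rowLaw (D : Uniformized S) (z : S) : Measure S :=
  ∑ y, ENNReal.ofReal (D.P z y) • Measure.dirac y

instance (D : Uniformized S) (z : S) : IsProbabilityMeasure (D.rowLaw z) := ⟨by
  simp only [rowLaw, Measure.coe_finsetSum, Finset.sum_apply, Measure.smul_apply, measure_univ,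
    smul_eq_mul, mul_one]
  rw [← ENNReal.ofReal_sum_of_nonneg fun j _ => D.nonneg z j, D.row_sum, ENNReal.ofReal_one]⟩

instance (D : Uniformized S) : IsProbabilityMeasure (waiting D.c) :=
  isProbabilityMeasure_waiting D.c_pos

/-- The law of a waiting time and an independent random map of the state space. -/
def stepLaw (D : Uniformized S) : Measure (ℝ × (S → S)) :=
  (waiting D.c).prod (Measure.pi D.rowLaw)

instance (D : Uniformized S) : IsProbabilityMeasure D.stepLaw := by
  unfold stepLaw; infer_instance

/-- The law of the i.i.d. sequence that drives the chain. -/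
def pathLaw (D : Uniformized S) : Measure (ℕ → ℝ × (S → S)) :=
  Measure.infinitePi fun _ => D.stepLaw

instance (D : Uniformized S) : IsProbabilityMeasure D.pathLaw := by
  unfold pathLaw; infer_instance

lemma stepLaw_ae_pos (D : Uniformized S) : ∀ᵐ a ∂D.stepLaw, 0 < a.1 :=
  Measure.quasiMeasurePreserving_fst.ae (waiting_ae_pos D.c)

lemma pathLaw_ae_pos (D : Uniformized S) : ∀ᵐ ω ∂D.pathLaw, 0 < (ω 0).1 :=
  (measurePreserving_eval_infinitePi (fun _ : ℕ => D.stepLaw) 0).quasiMeasurePreserving.ae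
    D.stepLaw_ae_pos

/-- If all arrivals occur by time `t`, then the first waiting time is at most `t` and the remaining
sequence has the same property. So the probability `x` of this event satisfies `x ≤ P(W ≤ t) x` for
an exponential variable `W`, which forces `x = 0`. -/
lemma ae_nonExplosive (D : Uniformized S) : ∀ᵐ ω ∂D.pathLaw, NonExplosive ω := by
  have key : ∀ t : ℝ, D.pathLaw {ω | ∀ k, arrival ω (k + 1) ≤ t} = 0 := by
    intro t
    set B : Set (ℕ → ℝ × (S → S)) := {ω | ∀ k, arrival ω (k + 1) ≤ t} with hB
    have hBm : MeasurableSet B := by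
      have : B = ⋂ k, {ω | arrival ω (k + 1) ≤ t} := by ext ω; simp [hB]
      rw [this]
      exact MeasurableSet.iInter fun k =>
        measurableSet_le (measurable_arrival (k + 1)) measurable_const
    have h1 : D.pathLaw B ≤ waiting D.c (Set.Iic t) * D.pathLaw B := by
      calc D.pathLaw B = ∫⁻ a, D.pathLaw {ω | cons a ω ∈ B} ∂D.stepLaw :=
            infinitePi_apply_cons D.stepLaw hBm
        _ ≤ ∫⁻ a, (Set.Iic t ×ˢ Set.univ : Set (ℝ × (S → S))).indicator
              (fun _ => D.pathLaw B) a ∂D.stepLaw := by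
            refine lintegral_mono_ae ?_
            filter_upwards [D.stepLaw_ae_pos] with a ha
            by_cases hat : a.1 ≤ t
            · rw [Set.indicator_of_mem (by simpa using hat)]
              refine measure_mono fun ω hω k => ?_
              have := hω (k + 1)
              rw [arrival_cons] at this
              linarith
            · rw [Set.indicator_of_notMem (by simpa using hat)]
              refine le_of_eq (measure_mono_null (t := ∅) (fun ω hω => ?_) measure_empty)
              have := hω 0
              rw [arrival_cons] at this
              simp only [arrival, Finset.range_zero, Finset.sum_empty, add_zero] at this
              exact hat this
        _ = waiting D.c (Set.Iic t) * D.pathLaw B := by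
            rw [lintegral_indicator_const (measurableSet_Iic.prod MeasurableSet.univ), stepLaw,
              Measure.prod_prod, measure_univ, mul_one, mul_comm]
    by_contra h0
    have h2 : waiting D.c (Set.Iic t) * D.pathLaw B < 1 * D.pathLaw B :=
      ENNReal.mul_lt_mul_left h0 (measure_ne_top _ _) (waiting_Iic_lt_one D.c_pos t)
    rw [one_mul] at h2
    exact absurd h1 (not_le.2 h2)
  have h : ∀ᵐ ω ∂D.pathLaw, ∀ m : ℕ, ∃ k, (m : ℝ) < arrival ω (k + 1) := by
    refine ae_all_iff.2 fun m => ?_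
    refine measure_mono_null ?_ (key m)
    intro ω hω k
    simp only [Set.mem_compl_iff, Set.mem_ofPred_eq, not_exists, not_lt] at hω
    exact hω k
  filter_upwards [h] with ω hω t
  obtain ⟨m, hm⟩ := exists_nat_gt t
  obtain ⟨k, hk⟩ := hω m
  exact ⟨k, hm.trans hk⟩

variable [DiscreteMeasurableSpace S]

lemma lintegral_rowLaw (D : Uniformized S) (z : S) (F : S → ENNReal) :
    ∫⁻ φ, F (φ z) ∂Measure.pi D.rowLaw = ∑ y, ENNReal.ofReal (D.P z y) * F y := by
  rw [(measurePreserving_eval D.rowLaw z).lintegral_comp (f := F) .of_discrete, rowLaw,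
    lintegral_finsetSum_measure]
  simp [lintegral_smul_measure, lintegral_dirac]

/-- The renewal equation. -/
lemma pathLaw_renewal (D : Uniformized S) {A : Set (ℝ≥0 → S)} (hA : MeasurableSet A) (z : S)
    {t : ℝ} (ht : 0 ≤ t) :
    D.pathLaw {ω | shiftPath z t ω ∈ A} =
      (∫⁻ a in Set.Ioc 0 t, ENNReal.ofReal (D.c * Real.exp (-(D.c * a))) *
        ∑ y, ENNReal.ofReal (D.P z y) * D.pathLaw {ω | shiftPath y (t - a) ω ∈ A}) +
      ENNReal.ofReal (Real.exp (-(D.c * t))) * D.pathLaw {ω | shiftPath z 0 ω ∈ A} := by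
  have hm : ∀ s, MeasurableSet {ω | shiftPath z s ω ∈ A} := fun s =>
    (measurable_shiftPath z).comp measurable_prodMk_left hA
  have hcons : Measurable fun q : (ℝ × (S → S)) × (ℕ → ℝ × (S → S)) => cons q.1 q.2 :=
    measurable_cons
  set g : ℝ → ℝ → ENNReal := fun s a =>
    ∫⁻ φ, D.pathLaw {ω | shiftPath z s (cons (a, φ) ω) ∈ A} ∂Measure.pi D.rowLaw with hg
  have hgm0 : ∀ s, Measurable fun a : ℝ × (S → S) =>
      D.pathLaw {ω | shiftPath z s (cons a ω) ∈ A} := fun s =>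
    measurable_measure_prodMk_left (hcons (hm s))
  have hgm : ∀ s, Measurable (g s) := fun s => (hgm0 s).lintegral_prod_right'
  have hdis : ∀ s, D.pathLaw {ω | shiftPath z s ω ∈ A} = ∫⁻ a, g s a ∂waiting D.c := by
    intro s
    rw [pathLaw, infinitePi_apply_cons D.stepLaw (hm s)]
    exact lintegral_prod _ (hgm0 s).aemeasurable
  rw [hdis t, lintegral_waiting_split ht (hgm t), hdis 0, lintegral_waiting _ (hgm 0)]
  congr 1
  -- First ring at `a ≤ t`: the path restarts from `φ z`, with `t - a` left to run.
  · refine setLIntegral_congr_fun measurableSet_Ioc fun a ha => ?_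
    congr 1
    rw [← D.lintegral_rowLaw z fun y => D.pathLaw {ω | shiftPath y (t - a) ω ∈ A}]
    refine lintegral_congr fun φ => measure_congr ?_
    filter_upwards [D.ae_nonExplosive] with ω hω
    have : shiftPath z t (cons (a, φ) ω) = shiftPath (φ z) (t - a) ω := by
      funext s
      have hle : a ≤ t + s := ha.2.trans (le_add_of_nonneg_right s.2)
      rw [shiftPath, path_cons_of_le hω hle, shiftPath]
      congr 1
      ring
    exact propext (by
      change shiftPath z t (cons (a, φ) ω) ∈ A ↔ shiftPath (φ z) (t - a) ω ∈ A
      rw [this])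
  -- No ring before `t`: by lack of memory the process starts afresh from `z`.
  · rw [← lintegral_density_memoryless (g 0)]
    refine setLIntegral_congr_fun measurableSet_Ioi fun a _ => ?_
    congr 1
    refine lintegral_congr fun φ => ?_
    congr 1
    ext ω
    have : shiftPath z t (cons (a, φ) ω) = shiftPath z 0 (cons (a - t, φ) ω) := by
      funext s
      rw [shiftPath, path_cons_shift, shiftPath, zero_add]
    rw [Set.mem_ofPred_eq, Set.mem_ofPred_eq, this]

/-- Real-valued form of the renewal equation. -/
lemma real_pathLaw_renewal (D : Uniformized S) {A : Set (ℝ≥0 → S)} (hA : MeasurableSet A) (z : S)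
    {t : ℝ} (ht : 0 ≤ t) :
    D.pathLaw.real {ω | shiftPath z t ω ∈ A} =
      (∫ a in 0..t, D.c * Real.exp (-(D.c * a)) *
        ∑ y, D.P z y * D.pathLaw.real {ω | shiftPath y (t - a) ω ∈ A}) +
      Real.exp (-(D.c * t)) * D.pathLaw.real {ω | shiftPath z 0 ω ∈ A} := by
  have hum : ∀ y, Measurable fun s => D.pathLaw {ω | shiftPath y s ω ∈ A} := fun y =>
    measurable_measure_prodMk_left ((measurable_shiftPath y) hA)
  have h := congrArg ENNReal.toReal (D.pathLaw_renewal hA z ht)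
  have hnn : ∀ a, 0 ≤ D.c * Real.exp (-(D.c * a)) *
      ∑ y, D.P z y * D.pathLaw.real {ω | shiftPath y (t - a) ω ∈ A} := fun a =>
    mul_nonneg (mul_nonneg D.c_pos.le (Real.exp_pos _).le)
      (Finset.sum_nonneg fun y _ => mul_nonneg (D.nonneg z y) measureReal_nonneg)
  have e : ∀ a, ENNReal.ofReal (D.c * Real.exp (-(D.c * a))) *
        ∑ y, ENNReal.ofReal (D.P z y) * D.pathLaw {ω | shiftPath y (t - a) ω ∈ A} =
      ENNReal.ofReal (D.c * Real.exp (-(D.c * a)) *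
        ∑ y, D.P z y * D.pathLaw.real {ω | shiftPath y (t - a) ω ∈ A}) := by
    intro a
    rw [ENNReal.ofReal_mul (mul_nonneg D.c_pos.le (Real.exp_pos _).le),
      ENNReal.ofReal_sum_of_nonneg fun y _ => mul_nonneg (D.nonneg z y) measureReal_nonneg]
    congr 1
    refine Finset.sum_congr rfl fun y _ => ?_
    rw [ENNReal.ofReal_mul (D.nonneg z y), ofReal_measureReal]
  have hle : (∫⁻ a in Set.Ioc 0 t, ENNReal.ofReal (D.c * Real.exp (-(D.c * a))) *
        ∑ y, ENNReal.ofReal (D.P z y) * D.pathLaw {ω | shiftPath y (t - a) ω ∈ A}) ≠ ⊤ := by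
    have := D.pathLaw_renewal hA z ht
    intro htop
    rw [htop, top_add] at this
    exact measure_ne_top _ _ this
  rw [ENNReal.toReal_add hle (ENNReal.mul_ne_top ENNReal.ofReal_ne_top (measure_ne_top _ _)),
    ENNReal.toReal_mul, ENNReal.toReal_ofReal (Real.exp_pos _).le] at h
  rw [measureReal_def, h, intervalIntegral.integral_of_le ht, measureReal_def]
  congr 1
  simp only [e]
  rw [integral_eq_lintegral_of_nonneg_ae (ae_of_all _ hnn)]
  refine Measurable.aestronglyMeasurable ?_
  refine Measurable.mul (by fun_prop) (Finset.measurable_sum _ fun y _ => ?_)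
  exact ((hum y).ennreal_toReal.comp (measurable_const.sub measurable_id)).const_mul _

end Uniformized

end FiniteMarkov

end

/-! ### Markov property and finite-dimensional distributions. -/

open scoped NNReal Topology

noncomputable section

namespace FiniteMarkov

open MeasureTheory Matrix

variable {S : Type*} [Fintype S] [DecidableEq S]

namespace Uniformized

lemma isQMatrix_gen (D : Uniformized S) : IsQMatrix D.gen where
  offDiag_nonneg i j hij := by
    rw [gen, Matrix.smul_apply, Matrix.sub_apply, Matrix.one_apply_ne hij, sub_zero, smul_eq_mul]
    exact mul_nonneg D.c_pos.le (D.nonneg i j)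
  row_sum i := by
    simp only [gen, Matrix.smul_apply, Matrix.sub_apply, smul_eq_mul, ← Finset.mul_sum,
      Finset.sum_sub_distrib, D.row_sum, Matrix.one_apply]
    simp

lemma hasDerivAt_exp_neg_mul (c a : ℝ) :
    HasDerivAt (fun a => Real.exp (-(c * a))) (Real.exp (-(c * a)) * -c) a := by
  have := ((hasDerivAt_id a).const_mul c).neg.exp
  simpa using this

lemma continuous_exp_mulVec (Q : Matrix S S ℝ) (b : S → ℝ) (z : S) :
    Continuous fun t : ℝ => (NormedSpace.exp (t • Q) *ᵥ b) z :=
  continuous_iff_continuousAt.2 fun t =>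
    (hasDerivAt_exp_mulVec Q (f := fun _ => b) (f' := fun _ => 0)
      (fun y => hasDerivAt_const t (b y)) z).continuousAt

lemma continuous_renewal_integrand (D : Uniformized S) (b : S → ℝ) (z : S) (t : ℝ) :
    Continuous fun a => D.c * Real.exp (-(D.c * a)) *
      ∑ y, D.P z y * (NormedSpace.exp ((t - a) • D.gen) *ᵥ b) y := by
  refine Continuous.mul (by fun_prop) (continuous_finsetSum _ fun y _ => ?_)
  exact continuous_const.mul
    ((continuous_exp_mulVec D.gen b y).comp (continuous_const.sub continuous_id))

/-- Variation of constants: the integrand is the derivative in `a` of `-e^{-ca} e^{(t-a)L} b`, with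
`L` the generator. Thus the semigroup satisfies the renewal equation of the path probabilities. -/
lemma exp_gen_renewal (D : Uniformized S) (b : S → ℝ) (z : S) (t : ℝ) :
    (NormedSpace.exp (t • D.gen) *ᵥ b) z =
      (∫ a in 0..t, D.c * Real.exp (-(D.c * a)) *
        ∑ y, D.P z y * (NormedSpace.exp ((t - a) • D.gen) *ᵥ b) y) +
      Real.exp (-(D.c * t)) * b z := by
  have hd : ∀ a ∈ Set.uIcc 0 t, HasDerivAt
      (fun a => -(Real.exp (-(D.c * a)) * (NormedSpace.exp ((t - a) • D.gen) *ᵥ b) z))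
      (D.c * Real.exp (-(D.c * a)) *
        ∑ y, D.P z y * (NormedSpace.exp ((t - a) • D.gen) *ᵥ b) y) a := by
    intro a _
    have h1 := hasDerivAt_exp_mulVec D.gen (f := fun _ => b) (f' := fun _ => 0) (t := t - a)
      (fun y => hasDerivAt_const _ _) z
    have h2 := HasDerivAt.scomp a h1 ((hasDerivAt_id a).const_sub t)
    have h4 := ((hasDerivAt_exp_neg_mul D.c a).mul h2).neg
    refine h4.congr_deriv ?_
    have e : (NormedSpace.exp ((t - a) • D.gen) *ᵥ (D.gen *ᵥ b + 0)) z
        = D.c * (∑ y, D.P z y * (NormedSpace.exp ((t - a) • D.gen) *ᵥ b) y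
          - (NormedSpace.exp ((t - a) • D.gen) *ᵥ b) z) := by
      rw [add_zero, mulVec_mulVec, exp_commute, ← mulVec_mulVec]
      conv_lhs => rw [gen, smul_mulVec, sub_mulVec, one_mulVec]
      rfl
    rw [e]
    simp only [smul_eq_mul, Function.comp_apply]
    ring
  rw [intervalIntegral.integral_eq_sub_of_hasDerivAt hd
    ((D.continuous_renewal_integrand b z t).intervalIntegrable 0 t)]
  simp

variable [MeasurableSpace S] [DiscreteMeasurableSpace S]

/-- The Markov property. -/
lemma pathLaw_markov (D : Uniformized S) {A : Set (ℝ≥0 → S)} (hA : MeasurableSet A) (z : S)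
    {t : ℝ} (ht : 0 ≤ t) :
    D.pathLaw.real {ω | shiftPath z t ω ∈ A} =
      (NormedSpace.exp (t • D.gen) *ᵥ fun y => D.pathLaw.real {ω | shiftPath y 0 ω ∈ A}) z := by
  set u : ℝ → S → ℝ := fun s y => D.pathLaw.real {ω | shiftPath y s ω ∈ A} with hu
  set v : ℝ → S → ℝ := fun s y => (NormedSpace.exp (s • D.gen) *ᵥ u 0) y with hv
  have hum : ∀ y, Measurable fun s => u s y := fun y =>
    (measurable_measure_prodMk_left ((measurable_shiftPath y) hA)).ennreal_toReal
  have hu1 : ∀ s y, u s y ≤ 1 := fun s y => measureReal_le_one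
  have hu0 : ∀ s y, 0 ≤ u s y := fun s y => measureReal_nonneg
  have hv1 : ∀ s, 0 ≤ s → ∀ y, v s y ≤ 1 := fun s hs y =>
    (D.isQMatrix_gen.exp_mulVec_mono hs (hu1 0) y).trans
      (D.isQMatrix_gen.exp_mulVec_const hs 1 y).le
  have hv0 : ∀ s, 0 ≤ s → ∀ y, 0 ≤ v s y := fun s hs y =>
    (D.isQMatrix_gen.exp_mulVec_const hs 0 y).symm.le.trans
      (D.isQMatrix_gen.exp_mulVec_mono hs (hu0 0) y)
  set q : ℝ := 1 - Real.exp (-(D.c * t)) with hq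
  have hq0 : 0 ≤ q := by
    have : Real.exp (-(D.c * t)) ≤ 1 :=
      Real.exp_le_one_iff.2 (neg_nonpos.2 (mul_nonneg D.c_pos.le ht))
    rw [hq]; linarith
  have hq1 : q < 1 := by
    have := Real.exp_pos (-(D.c * t))
    rw [hq]; linarith
  -- Uniqueness for the renewal equation: on `[0, t]` its integral operator has norm at most `q = 1
  -- - e^{-ct} < 1`, and it is iterated from the bound 1, both functions lying in `[0, 1]`.
  have key : ∀ k : ℕ, ∀ s ∈ Set.Icc 0 t, ∀ y, |u s y - v s y| ≤ q ^ k := by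
    intro k
    induction k with
    | zero =>
      intro s hs y
      rw [pow_zero, abs_le]
      constructor <;> linarith [hu1 s y, hu0 s y, hv1 s hs.1 y, hv0 s hs.1 y]
    | succ k ih =>
      intro s hs y
      have hi : IntervalIntegrable (fun a => D.c * Real.exp (-(D.c * a)) *
          ∑ x, D.P y x * u (s - a) x) volume 0 s := by
        refine (intervalIntegrable_const (c := D.c)).mono_fun' ?_ ?_
        · refine Measurable.aestronglyMeasurable ?_
          exact Measurable.mul (by fun_prop) (Finset.measurable_sum _ fun x _ =>
            ((hum x).comp (measurable_const.sub measurable_id)).const_mul _)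
        · refine (ae_restrict_iff' measurableSet_uIoc).2 (ae_of_all _ fun a ha => ?_)
          rw [Set.uIoc_of_le hs.1] at ha
          have h1 : Real.exp (-(D.c * a)) ≤ 1 :=
            Real.exp_le_one_iff.2 (neg_nonpos.2 (mul_nonneg D.c_pos.le ha.1.le))
          have h2 : ∑ x, D.P y x * u (s - a) x ≤ 1 := by
            rw [← D.row_sum y]
            exact Finset.sum_le_sum fun x _ => mul_le_of_le_one_right (D.nonneg y x) (hu1 _ x)
          have h3 : 0 ≤ ∑ x, D.P y x * u (s - a) x :=
            Finset.sum_nonneg fun x _ => mul_nonneg (D.nonneg y x) (hu0 _ x)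
          have h4 := D.c_pos
          refine (Real.norm_of_nonneg (by positivity)).trans_le ?_
          calc D.c * Real.exp (-(D.c * a)) * ∑ x, D.P y x * u (s - a) x
              ≤ D.c * 1 * 1 := by gcongr
            _ = D.c := by ring
      have e : u s y - v s y = ∫ a in 0..s, D.c * Real.exp (-(D.c * a)) *
          ∑ x, D.P y x * (u (s - a) x - v (s - a) x) := by
        have h1 : u s y = _ := D.real_pathLaw_renewal hA y hs.1
        have h2 : v s y = _ := D.exp_gen_renewal (u 0) y s
        rw [h1, h2, add_sub_add_right_eq_sub, ← intervalIntegral.integral_sub hi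
          ((D.continuous_renewal_integrand (u 0) y s).intervalIntegrable 0 s)]
        · congr 1
          funext a
          rw [← mul_sub, ← Finset.sum_sub_distrib]
          congr 1
          exact Finset.sum_congr rfl fun x _ => by rw [mul_sub]
      have e2 : ∫ a in 0..s, D.c * Real.exp (-(D.c * a)) * q ^ k
          = (1 - Real.exp (-(D.c * s))) * q ^ k := by
        rw [intervalIntegral.integral_mul_const]
        congr 1
        have hd : ∀ a ∈ Set.uIcc 0 s, HasDerivAt (fun a => -Real.exp (-(D.c * a)))
            (D.c * Real.exp (-(D.c * a))) a := by
          intro a _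
          exact (hasDerivAt_exp_neg_mul D.c a).neg.congr_deriv (by ring)
        rw [intervalIntegral.integral_eq_sub_of_hasDerivAt hd
          (Continuous.intervalIntegrable (by fun_prop) 0 s)]
        simp; ring
      rw [e]
      have hb := intervalIntegral.norm_integral_le_of_norm_le hs.1
        (g := fun a => D.c * Real.exp (-(D.c * a)) * q ^ k)
        (f := fun a => D.c * Real.exp (-(D.c * a)) *
          ∑ x, D.P y x * (u (s - a) x - v (s - a) x))
        (μ := volume) (ae_of_all _ fun a ha => ?_)
        (Continuous.intervalIntegrable (by fun_prop) 0 s)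
      · rw [Real.norm_eq_abs, e2] at hb
        refine hb.trans ?_
        rw [pow_succ, mul_comm (q ^ k) q]
        refine mul_le_mul_of_nonneg_right ?_ (pow_nonneg hq0 k)
        have : Real.exp (-(D.c * t)) ≤ Real.exp (-(D.c * s)) :=
          Real.exp_le_exp.2 (neg_le_neg (mul_le_mul_of_nonneg_left hs.2 D.c_pos.le))
        rw [hq]; linarith
      · have h4 := D.c_pos
        rw [norm_mul, Real.norm_of_nonneg (by positivity : 0 ≤ D.c * Real.exp (-(D.c * a)))]
        refine mul_le_mul_of_nonneg_left ?_ (by positivity)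
        rw [Real.norm_eq_abs]
        calc |∑ x, D.P y x * (u (s - a) x - v (s - a) x)|
            ≤ ∑ x, D.P y x * q ^ k := by
              refine (Finset.abs_sum_le_sum_abs _ _).trans (Finset.sum_le_sum fun x _ => ?_)
              rw [abs_mul, abs_of_nonneg (D.nonneg y x)]
              exact mul_le_mul_of_nonneg_left
                (ih (s - a) ⟨by linarith [ha.2], by linarith [ha.1, hs.2]⟩ x) (D.nonneg y x)
          _ = q ^ k := by rw [← Finset.sum_mul, D.row_sum, one_mul]
  have hlim := tendsto_pow_atTop_nhds_zero_of_lt_one hq0 hq1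
  have h0 : |u t z - v t z| ≤ 0 :=
    ge_of_tendsto hlim (Filter.Eventually.of_forall fun k => key k t ⟨ht, le_rfl⟩ z)
  exact sub_eq_zero.1 (abs_eq_zero.1 (le_antisymm h0 (abs_nonneg _)))

/-- Finite-dimensional distributions of a projection whose generator is intertwined with that of
the chain. -/
lemma pathLaw_fdd (D : Uniformized S) {R : Type*} [Fintype R] [DecidableEq R] {π : S → R}
    {Q : Matrix R R ℝ} (hπ : ∀ (f : R → ℝ) z, (D.gen *ᵥ (f ∘ π)) z = (Q *ᵥ f) (π z)) :
    ∀ (k : ℕ) (t : Fin (k + 1) → ℝ≥0) (η : Fin (k + 1) → R) (z : S), Monotone t → t 0 = 0 →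
      η 0 = π z →
      D.pathLaw.real {ω | ∀ i, π (path z ω (t i)) = η i} =
        ∏ i : Fin k, NormedSpace.exp (((t i.succ : ℝ) - (t i.castSucc : ℝ)) • Q)
          (η i.castSucc) (η i.succ) := by
  have hzero : ∀ z, ∀ᵐ ω ∂D.pathLaw, path z ω 0 = z := fun z => by
    filter_upwards [D.pathLaw_ae_pos] with ω hω using path_zero_of_pos hω
  intro k
  -- The start `z` remains universally quantified: after one time step only the projection of the
  -- state is prescribed.
  induction k with
  | zero =>
    intro t η z _ ht0 hη
    rw [Finset.univ_eq_empty, Finset.prod_empty, ← probReal_univ (μ := D.pathLaw)]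
    refine measureReal_congr ?_
    filter_upwards [hzero z] with ω hω
    refine propext ⟨fun _ => trivial, fun _ i => ?_⟩
    rw [show i = 0 from Fin.fin_one_eq_zero i, ht0, NNReal.coe_zero, hω, hη]
  | succ k ih =>
    intro t η z ht ht0 hη
    -- The constraints after the first interval, with time measured from `t 1`, so that the Markov
    -- property at `t 1` applies.
    set A : Set (ℝ≥0 → S) := {x | ∀ i : Fin (k + 1), π (x (t i.succ - t 1)) = η i.succ} with hA
    have hAm : MeasurableSet A := by
      have : A = ⋂ i : Fin (k + 1), (fun x : ℝ≥0 → S => x (t i.succ - t 1)) ⁻¹'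
          {y | π y = η i.succ} := by
        ext x; simp [hA]
      rw [this]
      exact MeasurableSet.iInter fun i => measurable_pi_apply _ .of_discrete
    have hle : ∀ i : Fin (k + 1), t 1 ≤ t i.succ := fun i =>
      ht (Fin.succ_le_succ_iff.2 (Fin.zero_le i) : (0 : Fin (k + 1)).succ ≤ i.succ)
    have h1 : D.pathLaw.real {ω | ∀ i, π (path z ω (t i)) = η i} =
        D.pathLaw.real {ω | shiftPath z (t 1) ω ∈ A} := by
      refine measureReal_congr ?_
      filter_upwards [hzero z] with ω hω
      have e : ∀ i : Fin (k + 1), shiftPath z (t 1) ω (t i.succ - t 1) = path z ω (t i.succ) := by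
        intro i
        rw [shiftPath, NNReal.coe_sub (hle i), add_sub_cancel]
      refine propext ⟨fun h i => ?_, fun h i => ?_⟩
      · rw [e]; exact h i.succ
      · cases i using Fin.cases with
        | zero => rw [ht0, NNReal.coe_zero, hω, hη]
        | succ i => have := h i; rwa [e] at this
    set p : ℝ := ∏ i : Fin k, NormedSpace.exp
      (((t i.succ.succ : ℝ) - (t i.castSucc.succ : ℝ)) • Q) (η i.castSucc.succ) (η i.succ.succ)
      with hp
    have h2 : ∀ y, D.pathLaw.real {ω | shiftPath y 0 ω ∈ A}
        = p * ((fun r => if r = η 1 then 1 else 0) ∘ π) y := by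
      intro y
      have e : ∀ s : ℝ≥0, ∀ ω, shiftPath y 0 ω s = path y ω s := fun s ω => by
        rw [shiftPath, zero_add]
      by_cases hy : π y = η 1
      · have := ih (fun i => t i.succ - t 1) (fun i => η i.succ) y
          (fun i j hij => tsub_le_tsub_right (ht (Fin.succ_le_succ_iff.2 hij)) _)
          (tsub_self (t 1)) hy.symm
        simp only [Function.comp_apply, hy, if_true, mul_one, hA, Set.mem_ofPred_eq, e]
        rw [this, hp]
        refine Finset.prod_congr rfl fun i _ => ?_
        rw [NNReal.coe_sub (hle _), NNReal.coe_sub (hle _), sub_sub_sub_cancel_right]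
      · simp only [Function.comp_apply, hy, if_false, mul_zero]
        rw [measureReal_def, ENNReal.toReal_eq_zero_iff]
        left
        refine measure_mono_null ?_ (hzero y)
        intro ω hω h0
        have := hω 0
        rw [show (0 : Fin (k + 1)).succ = 1 from rfl, tsub_self, e, NNReal.coe_zero, h0] at this
        exact hy this
    rw [h1, D.pathLaw_markov hAm z (t 1).coe_nonneg]
    have h3 : (fun y => D.pathLaw.real {ω | shiftPath y 0 ω ∈ A})
        = p • ((fun r => if r = η 1 then (1 : ℝ) else 0) ∘ π) := by
      funext y; rw [h2 y]; rfl
    rw [h3, mulVec_smul, Pi.smul_apply, smul_eq_mul, exp_mulVec_comp hπ (t 1).coe_nonneg,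
      Fin.prod_univ_succ, mul_comm, hp]
    congr 1
    rw [← hη, Fin.castSucc_zero, ht0, NNReal.coe_zero, sub_zero]
    simp [mulVec, dotProduct, Fin.succ_zero_eq_one]

end Uniformized

end FiniteMarkov

end

/-! ### Existence of the process. -/

open scoped NNReal Topology

noncomputable section

namespace FiniteMarkov

open MeasureTheory Matrix

/-- Existence of the Markov jump process with a given `Q`-matrix, together with the
finite-dimensional distributions of all its Markovian projections. -/
theorem IsQMatrix.exists_process {S : Type} [Fintype S] [DecidableEq S] {Q : Matrix S S ℝ}
    (hQ : IsQMatrix Q) (z : S) :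
    ∃ (Ω : Type) (_ : MeasurableSpace Ω) (μ : Measure Ω) (X : ℝ≥0 → Ω → S),
      IsProbabilityMeasure μ ∧
      (∀ t (A : Set S), MeasurableSet {ω | X t ω ∈ A}) ∧
      (∀ᵐ ω ∂μ, ∀ t : ℝ≥0, ∀ᶠ s in 𝓝[>] t, X s ω = X t ω) ∧
      (∀ᵐ ω ∂μ, ∀ t : ℝ≥0, ∃ y, ∀ᶠ s in 𝓝[<] t, X s ω = y) ∧
      (∀ (t : ℝ≥0) (f : S → ℝ),
        ∫ ω, f (X t ω) ∂μ = (NormedSpace.exp ((t : ℝ) • Q) *ᵥ f) z) ∧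
      ∀ (R : Type) [Fintype R] [DecidableEq R] (π : S → R) (Q' : Matrix R R ℝ),
        (∀ (f : R → ℝ) y, (Q *ᵥ (f ∘ π)) y = (Q' *ᵥ f) (π y)) →
        ∀ (k : ℕ) (t : Fin (k + 1) → ℝ≥0) (η : Fin (k + 1) → R), Monotone t → t 0 = 0 →
          η 0 = π z → μ.real {ω | ∀ i, π (X (t i) ω) = η i} =
            ∏ i : Fin k, NormedSpace.exp (((t i.succ : ℝ) - (t i.castSucc : ℝ)) • Q')
              (η i.castSucc) (η i.succ) := by
  obtain ⟨c, P, hc, hP, hP1, rfl⟩ := hQ.exists_rate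
  let _ : MeasurableSpace S := ⊤
  have : Nonempty S := ⟨z⟩
  set D : Uniformized S := ⟨c, P, hc, hP, hP1⟩ with hD
  have hfdd := fun (R : Type) [Fintype R] [DecidableEq R] (π : S → R) (Q' : Matrix R R ℝ)
    (h : ∀ (f : R → ℝ) y, ((c • (P - 1)) *ᵥ (f ∘ π)) y = (Q' *ᵥ f) (π y)) (k : ℕ)
    (t : Fin (k + 1) → ℝ≥0) (η : Fin (k + 1) → R) ht ht0 hη =>
      D.pathLaw_fdd (π := π) (Q := Q') h k t η z ht ht0 hη
  have hms : ∀ (t : ℝ≥0) (A : Set S),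
      MeasurableSet {ω : ℕ → ℝ × (S → S) | path z ω t ∈ A} := fun t A =>
    (measurable_path z).comp measurable_prodMk_left (MeasurableSet.of_discrete (s := A))
  refine ⟨ℕ → ℝ × (S → S), inferInstance, D.pathLaw, fun t ω => path z ω t, inferInstance,
    hms, ?_, ?_, fun t f => ?_, hfdd⟩
  · filter_upwards [D.ae_nonExplosive] with ω hω t using path_right_continuous z hω t
  · filter_upwards [D.ae_nonExplosive] with ω hω t using path_left_limits z hω t
  · have h1 : ∀ y, D.pathLaw.real {ω | path z ω t = y}
        = NormedSpace.exp ((t : ℝ) • (c • (P - 1))) z y := by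
      intro y
      have h2 := hfdd S id (c • (P - 1)) (fun f y => rfl) 1 ![0, t] ![z, y]
        (by intro i j hij; fin_cases i <;> fin_cases j <;> simp at hij ⊢) rfl rfl
      have h0 : ∀ᵐ ω ∂D.pathLaw, path z ω 0 = z := by
        filter_upwards [D.pathLaw_ae_pos] with ω hω using path_zero_of_pos hω
      have h3 : D.pathLaw.real {ω | path z ω t = y}
          = D.pathLaw.real {ω | ∀ i : Fin (1 + 1), id (path z ω ((![0, t] : Fin 2 → ℝ≥0) i))
            = (![z, y] : Fin 2 → S) i} := by
        refine measureReal_congr ?_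
        filter_upwards [h0] with ω hω
        refine propext ⟨fun h i => ?_, fun h => h 1⟩
        fin_cases i
        · simpa using hω
        · exact h
      rw [h3, h2]
      simp
    have h2 : ∀ ω, f (path z ω t)
        = ∑ y, Set.indicator {ω | path z ω t = y} (fun _ => f y) ω := by
      intro ω
      rw [Finset.sum_eq_single (path z ω t)]
      · rw [Set.indicator_of_mem]; rfl
      · intro y _ hy
        rw [Set.indicator_of_notMem]
        exact fun h => hy h.symm
      · simp
    simp only [h2]
    have hm : ∀ y, MeasurableSet {ω : ℕ → ℝ × (S → S) | path z ω t = y} := fun y => hms t {y}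
    rw [integral_finsetSum _ fun y _ => (integrable_const (f y)).indicator (hm y)]
    refine Finset.sum_congr rfl fun y _ => ?_
    rw [integral_indicator_const _ (hm y), h1, smul_eq_mul]

end FiniteMarkov

end

/-! ### Generators given by moves; spin flips, Metropolis rates and the coupled generator. -/

open scoped NNReal Topology

noncomputable section

namespace FiniteMarkov

open Matrix

/-- The `Q`-matrix of the process that makes the move `m i` at rate `a i`. -/
def moveGen {S I : Type*} [DecidableEq S] [Fintype I] (a : I → S → ℝ) (m : I → S → S) :
    Matrix S S ℝ :=
  Matrix.of fun z y => ∑ i, a i z * ((if m i z = y then 1 else 0) - if z = y then 1 else 0)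

variable {S I : Type*} [Fintype S] [DecidableEq S] [Fintype I] {a : I → S → ℝ} {m : I → S → S}

lemma moveGen_mulVec (f : S → ℝ) (z : S) :
    (moveGen a m *ᵥ f) z = ∑ i, a i z * (f (m i z) - f z) := by
  simp only [moveGen, mulVec, dotProduct, Matrix.of_apply, Finset.sum_mul]
  rw [Finset.sum_comm]
  refine Finset.sum_congr rfl fun i _ => ?_
  simp only [mul_assoc, sub_mul, ite_mul, one_mul, zero_mul, ← Finset.mul_sum,
    Finset.sum_sub_distrib, Finset.sum_ite_eq, Finset.mem_univ, if_true]

lemma isQMatrix_moveGen (ha : ∀ i z, 0 ≤ a i z) : IsQMatrix (moveGen a m) where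
  offDiag_nonneg z y hzy := by
    simp only [moveGen, Matrix.of_apply, hzy, if_false, sub_zero]
    exact Finset.sum_nonneg fun i _ => mul_nonneg (ha i z) (by split_ifs <;> norm_num)
  row_sum z := by
    have := moveGen_mulVec (a := a) (m := m) (fun _ => 1) z
    simpa [mulVec, dotProduct] using this

end FiniteMarkov

namespace ERGlauber

open Matrix FiniteMarkov

variable {n : ℕ}

/-! ### Spins and flips -/

/-- Flip the spin at `v`. -/
def flip (v : Fin n) (σ : Config n) : Config n := Function.update σ v (-σ v)

lemma flip_self (v : Fin n) (σ : Config n) : flip v σ v = -σ v := Function.update_self _ _ _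

lemma flip_of_ne {v w : Fin n} (h : w ≠ v) (σ : Config n) : flip v σ w = σ w :=
  Function.update_of_ne h _ _

lemma spin_flip_self (v : Fin n) (σ : Config n) : spin (flip v σ) v = -spin σ v := by
  simp [spin, flip_self]

lemma spin_flip_of_ne {v w : Fin n} (h : w ≠ v) (σ : Config n) :
    spin (flip v σ) w = spin σ w := by
  simp [spin, flip_of_ne h]

lemma neg_ne_self (x : ℤˣ) : -x ≠ x := by
  rcases Int.units_eq_one_or x with rfl | rfl <;> decide

lemma eq_neg_of_ne {x y : ℤˣ} (h : x ≠ y) : y = -x := by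
  rcases Int.units_eq_one_or x with rfl | rfl <;> rcases Int.units_eq_one_or y with rfl | rfl <;>
    simp_all

lemma spin_cases (σ : Config n) (v : Fin n) :
    (σ v = 1 ∧ spin σ v = 1) ∨ (σ v = -1 ∧ spin σ v = -1) := by
  rcases Int.units_eq_one_or (σ v) with h | h <;> simp [spin, h]

lemma abs_spin (σ : Config n) (v : Fin n) : |spin σ v| = 1 := by
  rcases spin_cases σ v with ⟨-, h⟩ | ⟨-, h⟩ <;> simp [h]

lemma abs_spin_sub (σ σ' : Config n) (v : Fin n) :
    |spin σ v - spin σ' v| = if σ v ≠ σ' v then 2 else 0 := by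
  rcases spin_cases σ v with ⟨h, e⟩ | ⟨h, e⟩ <;> rcases spin_cases σ' v with ⟨h', e'⟩ | ⟨h', e'⟩ <;>
    rw [h, e, h', e'] <;> norm_num [neg_ne_self, (neg_ne_self _).symm]

lemma card_disagreement (σ σ' : Config n) :
    ((disagreement σ σ').card : ℝ) = ∑ v, if σ v ≠ σ' v then 1 else 0 := by
  rw [disagreement, Finset.card_filter]
  push_cast
  rfl

lemma l1dist_eq (σ σ' : Config n) : l1dist σ σ' = 2 * (disagreement σ σ').card := by
  rw [card_disagreement, l1dist, Finset.mul_sum]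
  exact Finset.sum_congr rfl fun v _ => by rw [abs_spin_sub]; split_ifs <;> simp

lemma l1dist_eq_two_iff (σ σ' : Config n) : l1dist σ σ' = 2 ↔ ∃ v, flip v σ = σ' := by
  have h1 : l1dist σ σ' = 2 ↔ (disagreement σ σ').card = 1 := by
    rw [l1dist_eq]
    constructor
    · intro h
      have : ((disagreement σ σ').card : ℝ) = 1 := by linarith
      exact_mod_cast this
    · intro h; rw [h]; norm_num
  rw [h1, Finset.card_eq_one]
  have hmem : ∀ w, w ∈ disagreement σ σ' ↔ σ w ≠ σ' w := by simp [disagreement]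
  refine exists_congr fun v => ⟨fun h => ?_, ?_⟩
  · funext w
    by_cases hw : w = v
    · subst hw
      rw [flip_self, eq_neg_of_ne ((hmem w).1 (by rw [h]; exact Finset.mem_singleton_self w))]
    · rw [flip_of_ne hw]
      by_contra hne
      have := (hmem w).2 hne
      rw [h] at this
      exact hw (Finset.mem_singleton.1 this)
  · rintro rfl
    ext w
    rw [hmem, Finset.mem_singleton]
    by_cases hw : w = v
    · subst hw; simp [flip_self, (neg_ne_self (σ w)).symm]
    · simp [flip_of_ne hw, hw]

lemma flip_injective (σ : Config n) : Function.Injective fun v => flip v σ := by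
  intro v w h
  by_contra hne
  have := congrFun h v
  simp only [flip_self, flip_of_ne hne] at this
  exact neg_ne_self _ this

/-! ### The jump rates -/

open Classical in
/-- The adjacency matrix with real entries. -/
def adj (G : SimpleGraph (Fin n)) (v w : Fin n) : ℝ := if G.Adj v w then 1 else 0

/-- The local field felt by the vertex `v`. -/
def field (G : SimpleGraph (Fin n)) (h : ℝ) (σ : Config n) (v : Fin n) : ℝ :=
  1 / n * ∑ w, adj G v w * spin σ w + h

/-- The rate at which the vertex `v` flips. -/
def flipRate (G : SimpleGraph (Fin n)) (β h : ℝ) (v : Fin n) (σ : Config n) : ℝ :=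
  Real.exp (-β * max (2 * spin σ v * field G h σ v) 0)

/-- Only the edges at `v` change sign, and these are indexed by the neighbours of `v`. -/
lemma hamiltonian_flip (G : SimpleGraph (Fin n)) (h : ℝ) (v : Fin n) (σ : Config n) :
    hamiltonian G h (flip v σ) - hamiltonian G h σ = 2 * spin σ v * field G h σ v := by
  classical
  have h1 : ∑ w, spin (flip v σ) w - ∑ w, spin σ w = -2 * spin σ v := by
    rw [← Finset.sum_sub_distrib, Finset.sum_eq_single v]
    · rw [spin_flip_self]; ring
    · intro w _ hw; rw [spin_flip_of_ne hw, sub_self]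
    · simp
  have h2 : ∑ e ∈ G.edgeFinset, (e.map (spin (flip v σ))).mul
      - ∑ e ∈ G.edgeFinset, (e.map (spin σ)).mul
      = -2 * spin σ v * ∑ w, adj G v w * spin σ w := by
    rw [← Finset.sum_sub_distrib]
    have hsub : (G.incidenceFinset v) ⊆ G.edgeFinset := G.incidenceFinset_subset v
    rw [← Finset.sum_subset hsub]
    · have himg : G.incidenceFinset v = (G.neighborFinset v).image fun w => s(v, w) := by
        ext e
        induction e with | _ x y => ?_
        simp only [SimpleGraph.mem_incidenceFinset, Finset.mem_image, SimpleGraph.mem_neighborFinset,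
          SimpleGraph.mk'_mem_incidenceSet_iff, Sym2.eq_iff]
        constructor
        · rintro ⟨ha, rfl | rfl⟩
          · exact ⟨y, ha, Or.inl ⟨rfl, rfl⟩⟩
          · exact ⟨x, ha.symm, Or.inr ⟨rfl, rfl⟩⟩
        · rintro ⟨w, ha, ⟨rfl, rfl⟩ | ⟨rfl, rfl⟩⟩
          · exact ⟨ha, Or.inl rfl⟩
          · exact ⟨ha.symm, Or.inr rfl⟩
      rw [himg, Finset.sum_image, Finset.mul_sum]
      · rw [SimpleGraph.neighborFinset_eq_filter, Finset.sum_filter]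
        refine Finset.sum_congr rfl fun w _ => ?_
        unfold adj
        split_ifs with ha
        · have hw : w ≠ v := ha.ne'
          simp only [Sym2.map_mk, Sym2.mul_mk]
          rw [spin_flip_self, spin_flip_of_ne hw]; ring
        · ring
      · intro x _ y _ hxy
        exact Sym2.congr_right.1 hxy
    · intro e he hne
      induction e with | _ x y => ?_
      rw [SimpleGraph.mem_incidenceFinset, SimpleGraph.mk'_mem_incidenceSet_iff] at hne
      have hxy : G.Adj x y := by simpa using he
      have hx : x ≠ v := fun hx => hne ⟨hxy, Or.inl hx.symm⟩
      have hy : y ≠ v := fun hy => hne ⟨hxy, Or.inr hy.symm⟩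
      simp only [Sym2.map_mk, Sym2.mul_mk]
      rw [spin_flip_of_ne hx, spin_flip_of_ne hy, sub_self]
  have e : hamiltonian G h (flip v σ) - hamiltonian G h σ =
      -(1 / (n : ℝ)) * (∑ e ∈ G.edgeFinset, (e.map (spin (flip v σ))).mul
      - ∑ e ∈ G.edgeFinset, (e.map (spin σ)).mul) -
      h * (∑ w, spin (flip v σ) w - ∑ w, spin σ w) := by
    unfold hamiltonian; ring_nf
  rw [e, h1, h2, field]
  ring

lemma rate_flip (G : SimpleGraph (Fin n)) (β h : ℝ) (v : Fin n) (σ : Config n) :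
    rate G β h σ (flip v σ) = flipRate G β h v σ := by
  rw [rate, if_pos ((l1dist_eq_two_iff _ _).2 ⟨v, rfl⟩), hamiltonian_flip, flipRate]

lemma sum_rate_mul (G : SimpleGraph (Fin n)) (β h : ℝ) (σ : Config n) (g : Config n → ℝ) :
    ∑ η, rate G β h σ η * g η = ∑ v, flipRate G β h v σ * g (flip v σ) := by
  have h1 : ∑ v, flipRate G β h v σ * g (flip v σ)
      = ∑ η ∈ Finset.univ.image fun v => flip v σ, rate G β h σ η * g η := by
    rw [Finset.sum_image fun v _ w _ e => flip_injective σ e]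
    exact Finset.sum_congr rfl fun v _ => by rw [rate_flip]
  rw [h1]
  symm
  refine Finset.sum_subset (Finset.subset_univ _) fun η _ hη => ?_
  rw [rate, if_neg, zero_mul]
  rw [l1dist_eq_two_iff]
  rintro ⟨v, hv⟩
  exact hη (Finset.mem_image.2 ⟨v, Finset.mem_univ v, hv⟩)

lemma rate_self (G : SimpleGraph (Fin n)) (β h : ℝ) (σ : Config n) : rate G β h σ σ = 0 := by
  rw [rate, if_neg]
  simp [l1dist]

lemma generator_mulVec (G : SimpleGraph (Fin n)) (β h : ℝ) (f : Config n → ℝ) (σ : Config n) :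
    (generator G β h *ᵥ f) σ = ∑ v, flipRate G β h v σ * (f (flip v σ) - f σ) := by
  have h1 : ∀ η, generator G β h σ η * f η
      = rate G β h σ η * f η - if σ = η then (∑ η, rate G β h σ η) * f η else 0 := by
    intro η
    rw [generator, Matrix.of_apply]
    split_ifs with e
    · subst e; rw [rate_self]; ring
    · ring
  have h2 := sum_rate_mul G β h σ fun _ => 1
  simp only [mul_one] at h2
  simp only [mulVec, dotProduct, h1, Finset.sum_sub_distrib, sum_rate_mul, Finset.sum_ite_eq,
    Finset.mem_univ, if_true, h2, mul_sub, Finset.sum_mul]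

lemma flipRate_nonneg (G : SimpleGraph (Fin n)) (β h : ℝ) (v : Fin n) (σ : Config n) :
    0 ≤ flipRate G β h v σ := (Real.exp_pos _).le

lemma generator_eq_moveGen (G : SimpleGraph (Fin n)) (β h : ℝ) :
    generator G β h = moveGen (flipRate G β h) flip := by
  refine Matrix.ext_of_mulVec_single fun η => ?_
  funext σ
  rw [generator_mulVec, moveGen_mulVec]

lemma isQMatrix_generator (G : SimpleGraph (Fin n)) (β h : ℝ) : IsQMatrix (generator G β h) := by
  rw [generator_eq_moveGen]
  exact isQMatrix_moveGen (flipRate_nonneg G β h)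

/-! ### The coupled dynamics -/

/-- The rate at which both copies flip at `v` simultaneously. -/
def commonRate (G : SimpleGraph (Fin n)) (β h : ℝ) (v : Fin n) (z : Config n × Config n) : ℝ :=
  if z.1 v = z.2 v then min (flipRate G β h v z.1) (flipRate G β h v z.2) else 0

/-- The rates of the three kinds of moves of the coupled dynamics. -/
def coupledRate (G : SimpleGraph (Fin n)) (β h : ℝ) (i : Fin n × Fin 3)
    (z : Config n × Config n) : ℝ :=
  ![commonRate G β h i.1 z, flipRate G β h i.1 z.1 - commonRate G β h i.1 z,
    flipRate G β h i.1 z.2 - commonRate G β h i.1 z] i.2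

/-- The moves of the coupled dynamics: both copies, the first one, or the second one flip. -/
def coupledMove (i : Fin n × Fin 3) (z : Config n × Config n) : Config n × Config n :=
  ![(flip i.1 z.1, flip i.1 z.2), (flip i.1 z.1, z.2), (z.1, flip i.1 z.2)] i.2

/-- The generator of the coupled dynamics. -/
def coupledGen (G : SimpleGraph (Fin n)) (β h : ℝ) :
    Matrix (Config n × Config n) (Config n × Config n) ℝ :=
  moveGen (coupledRate G β h) coupledMove

lemma coupledGen_mulVec (G : SimpleGraph (Fin n)) (β h : ℝ) (f : Config n × Config n → ℝ)
    (z : Config n × Config n) :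
    (coupledGen G β h *ᵥ f) z = ∑ v,
      (commonRate G β h v z * (f (flip v z.1, flip v z.2) - f z) +
        (flipRate G β h v z.1 - commonRate G β h v z) * (f (flip v z.1, z.2) - f z) +
        (flipRate G β h v z.2 - commonRate G β h v z) * (f (z.1, flip v z.2) - f z)) := by
  rw [coupledGen, moveGen_mulVec, Fintype.sum_prod_type]
  refine Finset.sum_congr rfl fun v _ => ?_
  simp [Fin.sum_univ_three, coupledRate, coupledMove]

lemma isQMatrix_coupledGen (G : SimpleGraph (Fin n)) (β h : ℝ) :
    IsQMatrix (coupledGen G β h) := by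
  refine isQMatrix_moveGen fun i z => ?_
  obtain ⟨v, j⟩ := i
  have h1 := flipRate_nonneg G β h v z.1
  have h2 := flipRate_nonneg G β h v z.2
  fin_cases j
  · simp only [coupledRate, commonRate]
    change 0 ≤ ite _ _ _
    split_ifs
    · exact le_min h1 h2
    · exact le_rfl
  · change 0 ≤ _ - commonRate G β h v z
    rw [commonRate, sub_nonneg]
    split_ifs
    · exact min_le_left _ _
    · exact h1
  · change 0 ≤ _ - commonRate G β h v z
    rw [commonRate, sub_nonneg]
    split_ifs
    · exact min_le_right _ _
    · exact h2

/-- The common rate and the excess rate add up to the single-copy rate. This intertwining makes the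
first coordinate a version of the dynamics, and transfers single-copy estimates to the coupled
semigroup. -/
lemma coupledGen_fst (G : SimpleGraph (Fin n)) (β h : ℝ) (f : Config n → ℝ)
    (z : Config n × Config n) :
    (coupledGen G β h *ᵥ (f ∘ Prod.fst)) z = (generator G β h *ᵥ f) z.1 := by
  rw [coupledGen_mulVec, generator_mulVec]
  refine Finset.sum_congr rfl fun v _ => ?_
  simp only [Function.comp_apply]
  ring

lemma coupledGen_snd (G : SimpleGraph (Fin n)) (β h : ℝ) (f : Config n → ℝ)
    (z : Config n × Config n) :
    (coupledGen G β h *ᵥ (f ∘ Prod.snd)) z = (generator G β h *ᵥ f) z.2 := by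
  rw [coupledGen_mulVec, generator_mulVec]
  refine Finset.sum_congr rfl fun v _ => ?_
  simp only [Function.comp_apply]
  ring

/-- The number of disagreements between the two copies. -/
def discrepancy (z : Config n × Config n) : ℝ := (disagreement z.1 z.2).card

lemma discrepancy_comm (σ σ' : Config n) : discrepancy (σ, σ') = discrepancy (σ', σ) := by
  simp only [discrepancy, card_disagreement, ne_comm]

lemma discrepancy_flip_left (v : Fin n) (σ σ' : Config n) :
    discrepancy (flip v σ, σ') - discrepancy (σ, σ') = if σ v = σ' v then 1 else -1 := by
  simp only [discrepancy, card_disagreement]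
  rw [← Finset.sum_sub_distrib, Finset.sum_eq_single v]
  · rw [flip_self]
    by_cases h : σ v = σ' v
    · rw [h]; simp
    · rw [eq_neg_of_ne h]; simp [(neg_ne_self (σ v)).symm]
  · intro w _ hw; rw [flip_of_ne hw, sub_self]
  · simp

lemma discrepancy_flip_right (v : Fin n) (σ σ' : Config n) :
    discrepancy (σ, flip v σ') - discrepancy (σ, σ') = if σ v = σ' v then 1 else -1 := by
  rw [discrepancy_comm σ, discrepancy_comm σ, discrepancy_flip_left]
  simp only [eq_comm]

lemma discrepancy_flip_both (v : Fin n) (σ σ' : Config n) :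
    discrepancy (flip v σ, flip v σ') = discrepancy (σ, σ') := by
  simp only [discrepancy, card_disagreement]
  refine Finset.sum_congr rfl fun w _ => ?_
  by_cases hw : w = v
  · subst hw; simp [flip_self]
  · rw [flip_of_ne hw, flip_of_ne hw]

/-- Simultaneous flips leave the discrepancy unchanged. At an agreeing vertex the two excess rates
sum to the absolute difference; at a disagreeing one the common rate is zero and a flip of either
copy heals it. -/
lemma coupledGen_discrepancy (G : SimpleGraph (Fin n)) (β h : ℝ) (z : Config n × Config n) :
    (coupledGen G β h *ᵥ discrepancy) z = ∑ v, if z.1 v = z.2 v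
      then |flipRate G β h v z.1 - flipRate G β h v z.2|
      else -(flipRate G β h v z.1 + flipRate G β h v z.2) := by
  rw [coupledGen_mulVec]
  refine Finset.sum_congr rfl fun v _ => ?_
  obtain ⟨σ, σ'⟩ := z
  simp only [discrepancy_flip_left, discrepancy_flip_right, discrepancy_flip_both, sub_self,
    mul_zero, zero_add, commonRate]
  split_ifs with e
  · rcases le_total (flipRate G β h v σ) (flipRate G β h v σ') with hle | hle
    · rw [min_eq_left hle, abs_of_nonpos (sub_nonpos.2 hle)]; ring
    · rw [min_eq_right hle, abs_of_nonneg (sub_nonneg.2 hle)]; ring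
  · ring

/-- The coupled process, with the law of its discrepancy. -/
lemma exists_coupling (G : SimpleGraph (Fin n)) (β h : ℝ) (σ σ' : Config n) :
    ∃ c : Coupling G β h σ σ',
      (∀ t, c.meanDisagreement t =
        (NormedSpace.exp ((t : ℝ) • coupledGen G β h) *ᵥ discrepancy) (σ, σ')) ∧
      ∀ t, c.probNe t ≤
        (NormedSpace.exp ((t : ℝ) • coupledGen G β h) *ᵥ discrepancy) (σ, σ') := by
  obtain ⟨Ω, mΩ, μ, X, hμ, hm, hr, hl, hE, hfdd⟩ :=
    (isQMatrix_coupledGen G β h).exists_process (σ, σ')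
  refine ⟨⟨Ω, mΩ, μ, hμ, fun t ω => (X t ω).1, fun t ω => (X t ω).2, ?_, ?_⟩,
    fun t => hE t discrepancy, fun t => ?_⟩
  · refine ⟨fun t η => hm t {z | z.1 = η}, fun k t η ht ht0 hη =>
      hfdd (Config n) Prod.fst (generator G β h) (coupledGen_fst G β h) k t η ht ht0 hη, ?_, ?_⟩
    · filter_upwards [hr] with ω hω t
      filter_upwards [hω t] with s hs
      rw [hs]
    · filter_upwards [hl] with ω hω t
      obtain ⟨y, hy⟩ := hω t
      refine ⟨y.1, ?_⟩
      filter_upwards [hy] with s hs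
      rw [hs]
  · refine ⟨fun t η => hm t {z | z.2 = η}, fun k t η ht ht0 hη =>
      hfdd (Config n) Prod.snd (generator G β h) (coupledGen_snd G β h) k t η ht ht0 hη, ?_, ?_⟩
    · filter_upwards [hr] with ω hω t
      filter_upwards [hω t] with s hs
      rw [hs]
    · filter_upwards [hl] with ω hω t
      obtain ⟨y, hy⟩ := hω t
      refine ⟨y.2, ?_⟩
      filter_upwards [hy] with s hs
      rw [hs]
  -- The indicator that the copies differ is at most the number of disagreements.
  · have h1 : ∫ ω, (if (X t ω).1 ≠ (X t ω).2 then (1 : ℝ) else 0) ∂μ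
        = μ.real {ω | (X t ω).1 ≠ (X t ω).2} := by
      have hm' : MeasurableSet {ω | (X t ω).1 ≠ (X t ω).2} := hm t {z | z.1 ≠ z.2}
      rw [← MeasureTheory.integral_indicator_one hm']
      congr 1
      funext ω
      by_cases hω : (X t ω).1 = (X t ω).2 <;> simp [hω]
    change μ.real {ω | (X t ω).1 ≠ (X t ω).2} ≤ _
    rw [← h1, hE t fun z => if z.1 ≠ z.2 then 1 else 0]
    refine (isQMatrix_coupledGen G β h).exp_mulVec_mono t.coe_nonneg (fun z => ?_) _
    split_ifs with hz
    · obtain ⟨v, hv⟩ := Function.ne_iff.1 hz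
      have : 1 ≤ (disagreement z.1 z.2).card :=
        Finset.card_pos.2 ⟨v, by simpa [disagreement] using hv⟩
      exact Nat.one_le_cast.2 this
    · exact Nat.cast_nonneg _

end ERGlauber

end

open scoped NNReal Topology

noncomputable section

namespace ERGlauber

open Matrix FiniteMarkov

variable {n : ℕ}

/-! ### One-step estimates -/

/-- The Metropolis rate for flipping the spin `x` in the field `s`. -/
def metro (β x s : ℝ) : ℝ := Real.exp (-β * max (2 * x * s) 0)

lemma flipRate_eq_metro (G : SimpleGraph (Fin n)) (β h : ℝ) (v : Fin n) (σ : Config n) :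
    flipRate G β h v σ = metro β (spin σ v) (field G h σ v) := rfl

lemma metro_le_one {β : ℝ} (hβ : 0 ≤ β) (x s : ℝ) : metro β x s ≤ 1 := by
  rw [metro, Real.exp_le_one_iff, neg_mul]
  exact neg_nonpos.2 (mul_nonneg hβ (le_max_right _ _))

lemma flipRate_le_one {β : ℝ} (hβ : 0 ≤ β) (G : SimpleGraph (Fin n)) (h : ℝ) (v : Fin n)
    (σ : Config n) : flipRate G β h v σ ≤ 1 := metro_le_one hβ _ _

lemma abs_exp_neg_sub_le {a b : ℝ} (ha : 0 ≤ a) (hb : 0 ≤ b) :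
    |Real.exp (-a) - Real.exp (-b)| ≤ |a - b| := by
  wlog hab : a ≤ b generalizing a b
  · rw [abs_sub_comm, abs_sub_comm a]
    exact this hb ha (le_of_not_ge hab)
  have h1 : Real.exp (-b) ≤ Real.exp (-a) := Real.exp_le_exp.2 (neg_le_neg hab)
  have h2 : Real.exp (-a) ≤ 1 := Real.exp_le_one_iff.2 (neg_nonpos.2 ha)
  have h3 : -(b - a) + 1 ≤ Real.exp (-(b - a)) := Real.add_one_le_exp _
  have h4 : Real.exp (-b) = Real.exp (-a) * Real.exp (-(b - a)) := by
    rw [← Real.exp_add]; ring_nf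
  rw [abs_of_nonneg (sub_nonneg.2 h1), abs_sub_comm, abs_of_nonneg (sub_nonneg.2 hab), h4]
  nlinarith [Real.exp_pos (-a)]

lemma metro_lipschitz {β : ℝ} (hβ : 0 ≤ β) {x : ℝ} (hx : |x| = 1) (s s' : ℝ) :
    |metro β x s - metro β x s'| ≤ 2 * β * |s - s'| := by
  have h1 := abs_exp_neg_sub_le (mul_nonneg hβ (le_max_right (2 * x * s) 0))
    (mul_nonneg hβ (le_max_right (2 * x * s') 0))
  rw [metro, metro, neg_mul, neg_mul]
  refine h1.trans ?_
  rw [← mul_sub, abs_mul, abs_of_nonneg hβ]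
  have h2 := abs_max_sub_max_le_abs (2 * x * s) (2 * x * s') 0
  rw [← mul_sub, abs_mul, abs_mul, hx, abs_of_pos (by norm_num : (0 : ℝ) < 2)] at h2
  calc β * |max (2 * x * s) 0 - max (2 * x * s') 0| ≤ β * (2 * 1 * |s - s'|) := by gcongr
    _ = 2 * β * |s - s'| := by ring

lemma metro_one {β s : ℝ} (hs : s ≤ 0) : metro β 1 s = 1 := by
  rw [metro, max_eq_right (by linarith)]; simp

lemma metro_neg_one {β s : ℝ} (hs : s ≤ 0) : metro β (-1) s = Real.exp (2 * β * s) := by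
  rw [metro, max_eq_left (by linarith)]; ring_nf

/-- The drift of a single spin in a negative field. -/
lemma metro_mul_spin {β s : ℝ} (hs : s ≤ 0) (σ : Config n) (v : Fin n) :
    metro β (spin σ v) s * (-2 * spin σ v) =
      -(1 + Real.exp (2 * β * s)) * spin σ v + (Real.exp (2 * β * s) - 1) := by
  rcases spin_cases σ v with ⟨-, h⟩ | ⟨-, h⟩ <;> rw [h]
  · rw [metro_one hs]; ring
  · rw [metro_neg_one hs]; ring

/-- An affine function of the spins. -/
def affine (a : Fin n → ℝ) (b : ℝ) (σ : Config n) : ℝ := ∑ v, a v * spin σ v + b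

lemma affine_flip (a : Fin n → ℝ) (b : ℝ) (σ : Config n) (v : Fin n) :
    affine a b (flip v σ) = affine a b σ - 2 * a v * spin σ v := by
  have : ∑ w, a w * spin (flip v σ) w - ∑ w, a w * spin σ w = -2 * a v * spin σ v := by
    rw [← Finset.sum_sub_distrib, Finset.sum_eq_single v]
    · rw [spin_flip_self]; ring
    · intro w _ hw; rw [spin_flip_of_ne hw, sub_self]
    · simp
  unfold affine
  linarith

lemma abs_mul_spin_le {a : Fin n → ℝ} (ha : ∀ v, |a v| ≤ 1) (σ : Config n) (v : Fin n) :
    |a v * spin σ v| ≤ 1 := by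
  rw [abs_mul, abs_spin, mul_one]; exact ha v

/-- A flip changes the exponent by `y` with `|y| ≤ 2θ ≤ 1`, so `e^y - 1 ≤ y + y²`; since rates are
at most 1, the quadratic terms sum to at most `4θ²n`. -/
lemma generator_exp_affine_le {β : ℝ} (hβ : 0 ≤ β) (G : SimpleGraph (Fin n)) (h : ℝ)
    {a : Fin n → ℝ} (ha : ∀ v, |a v| ≤ 1) (b : ℝ) {θ : ℝ} (hθ0 : 0 ≤ θ) (hθ : θ ≤ 1 / 2)
    (σ : Config n) :
    (generator G β h *ᵥ fun σ => Real.exp (θ * affine a b σ)) σ ≤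
      Real.exp (θ * affine a b σ) *
        (θ * ∑ v, flipRate G β h v σ * (-2 * (a v * spin σ v)) + 4 * θ ^ 2 * n) := by
  rw [generator_mulVec]
  have key : ∀ v, flipRate G β h v σ *
      (Real.exp (θ * affine a b (flip v σ)) - Real.exp (θ * affine a b σ)) ≤
      Real.exp (θ * affine a b σ) *
        (θ * (flipRate G β h v σ * (-2 * (a v * spin σ v))) + 4 * θ ^ 2) := by
    intro v
    set y : ℝ := -2 * θ * (a v * spin σ v) with hy
    have hav := abs_mul_spin_le ha σ v
    have hy1 : |y| ≤ 2 * θ := by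
      have h2 : |-2 * θ| = 2 * θ := by rw [abs_mul, abs_of_nonneg hθ0]; norm_num
      rw [hy, abs_mul, h2]
      exact mul_le_of_le_one_right (by positivity) hav
    have h1 := (abs_le.1 (Real.abs_exp_sub_one_sub_id_le (x := y) (hy1.trans (by linarith)))).2
    have h2 : y ^ 2 ≤ 4 * θ ^ 2 := by
      rw [← sq_abs]
      nlinarith [abs_nonneg y]
    have e : Real.exp (θ * affine a b (flip v σ)) = Real.exp (θ * affine a b σ) * Real.exp y := by
      rw [affine_flip, ← Real.exp_add, hy]; ring_nf
    have h3 := flipRate_nonneg G β h v σ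
    have h4 := flipRate_le_one hβ G h v σ
    rw [e]
    have h5 : flipRate G β h v σ * (Real.exp y - 1) ≤
        θ * (flipRate G β h v σ * (-2 * (a v * spin σ v))) + 4 * θ ^ 2 := by
      calc flipRate G β h v σ * (Real.exp y - 1) ≤ flipRate G β h v σ * (y + 4 * θ ^ 2) :=
            mul_le_mul_of_nonneg_left (by linarith) h3
        _ = θ * (flipRate G β h v σ * (-2 * (a v * spin σ v)))
            + flipRate G β h v σ * (4 * θ ^ 2) := by rw [hy]; ring
        _ ≤ _ := by
            have : flipRate G β h v σ * (4 * θ ^ 2) ≤ 1 * (4 * θ ^ 2) :=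
              mul_le_mul_of_nonneg_right h4 (by positivity)
            linarith
    have := mul_le_mul_of_nonneg_left h5 (Real.exp_pos (θ * affine a b σ)).le
    linarith
  refine (Finset.sum_le_sum fun v _ => key v).trans (le_of_eq ?_)
  rw [← Finset.mul_sum, Finset.sum_add_distrib, ← Finset.mul_sum]
  simp [mul_comm]

/-- Replacing each local field by one value `s ≤ 0` makes the drift affine in the spins, at a cost
that depends only on the sum over vertices of the field errors. -/
lemma drift_le {β : ℝ} (hβ : 0 ≤ β) (G : SimpleGraph (Fin n)) (h : ℝ) {a : Fin n → ℝ}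
    (ha : ∀ v, |a v| ≤ 1) (σ : Config n) {s : ℝ} (hs : s ≤ 0) :
    ∑ v, flipRate G β h v σ * (-2 * (a v * spin σ v)) ≤
      ∑ v, a v * (-(1 + Real.exp (2 * β * s)) * spin σ v + (Real.exp (2 * β * s) - 1)) +
        4 * β * ∑ v, |field G h σ v - s| := by
  rw [Finset.mul_sum, ← Finset.sum_add_distrib]
  refine Finset.sum_le_sum fun v _ => ?_
  rw [← metro_mul_spin hs, flipRate_eq_metro]
  have h1 := metro_lipschitz hβ (abs_spin σ v) (field G h σ v) s
  have h2 := abs_mul_spin_le ha σ v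
  have h3 : (metro β (spin σ v) (field G h σ v) - metro β (spin σ v) s) *
      (-2 * (a v * spin σ v)) ≤ 4 * β * |field G h σ v - s| := by
    refine (le_abs_self _).trans ?_
    rw [abs_mul, abs_mul]
    calc |metro β (spin σ v) (field G h σ v) - metro β (spin σ v) s| *
          (|-2| * |a v * spin σ v|)
        ≤ (2 * β * |field G h σ v - s|) * (|-2| * 1) := by gcongr
      _ = 4 * β * |field G h σ v - s| := by norm_num; ring
  linarith

/-- The magnetization. -/
def mag (σ : Config n) : ℝ := 1 / n * ∑ v, spin σ v

lemma sum_spin (hn : 0 < n) (σ : Config n) : ∑ v, spin σ v = n * mag σ := by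
  have : (n : ℝ) ≠ 0 := (Nat.cast_pos.2 hn).ne'
  rw [mag]; field_simp

/-- Degrees close to `p n`, and cut-norm closeness to the constant `p`. -/
structure Quasirandom (G : SimpleGraph (Fin n)) (p δ : ℝ) : Prop where
  degree : ∀ w, |∑ v, adj G w v - p * n| ≤ δ * n
  discrepancy : ∀ σ : Config n, ∑ v, |∑ w, (adj G v w - p) * spin σ w| ≤ δ * (n : ℝ) ^ 2

/-- Cut-norm closeness controls the fields on average over the vertices, for every configuration,
however irregular. This is exactly the error that occurs in `drift_le`. -/
lemma Quasirandom.sum_abs_field_sub_le {G : SimpleGraph (Fin n)} {p δ : ℝ}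
    (hG : Quasirandom G p δ) (hn : 0 < n) (h : ℝ) (σ : Config n) (s : ℝ) :
    ∑ v, |field G h σ v - s| ≤ n * (δ + |p * mag σ + h - s|) := by
  have hn' : (0 : ℝ) < n := Nat.cast_pos.2 hn
  have e : ∀ v, field G h σ v - s =
      1 / n * ∑ w, (adj G v w - p) * spin σ w + (p * mag σ + h - s) := by
    intro v
    simp only [sub_mul, Finset.sum_sub_distrib, ← Finset.mul_sum, field, mag]
    ring
  calc ∑ v, |field G h σ v - s|
      ≤ ∑ v, (1 / n * |∑ w, (adj G v w - p) * spin σ w| + |p * mag σ + h - s|) := by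
        refine Finset.sum_le_sum fun v _ => ?_
        rw [e v]
        refine (abs_add_le _ _).trans ?_
        rw [abs_mul, abs_of_nonneg (by positivity : (0 : ℝ) ≤ 1 / n)]
    _ = 1 / n * ∑ v, |∑ w, (adj G v w - p) * spin σ w| + n * |p * mag σ + h - s| := by
        rw [Finset.sum_add_distrib, ← Finset.mul_sum]; simp
    _ ≤ 1 / n * (δ * (n : ℝ) ^ 2) + n * |p * mag σ + h - s| := by
        gcongr; exact hG.discrepancy σ
    _ = n * (δ + |p * mag σ + h - s|) := by field_simp

end ERGlauber

end

open scoped NNReal Topology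

noncomputable section

namespace ERGlauber

open Matrix FiniteMarkov

variable {n : ℕ}

/-! ### Confinement of the magnetization -/

lemma affine_const_eq (hn : 0 < n) (e m : ℝ) (σ : Config n) :
    affine (fun _ => e) (-(e * n * m)) σ = n * (e * (mag σ - m)) := by
  rw [affine, ← Finset.mul_sum, sum_spin hn]; ring

/-- The sign `e` selects the side of `m`. The truncation is there because the drift is known only
within `ε` of `m`. Beyond `nε` the function is at its maximum, so the generator is nonpositive;
between `nε/2` and `nε` the inward drift beats the field and quadratic errors; below `nε/2` the
crude bound suffices. -/
lemma generator_truncated_exp_le {G : SimpleGraph (Fin n)} {p β h m ε c lam δ e : ℝ}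
    (hn : 0 < n) (hβ : 0 ≤ β) (hG : Quasirandom G p δ) (he : |e| = 1) (hl0 : 0 < lam)
    (hl : lam ≤ 1 / 2) (hε : 0 < ε) (hneg : ∀ x, |x - m| ≤ ε → p * x + h ≤ 0)
    (hdrift : ∀ y ∈ Set.Icc (ε / 2) ε, e * ((1 - (m + e * y)) *
      Real.exp (2 * β * (p * (m + e * y) + h)) - (1 + (m + e * y))) ≤ -c)
    (hc : 4 * β * δ + 4 * lam ≤ c) (σ : Config n) :
    (generator G β h *ᵥ fun σ =>
        Real.exp (lam * min (affine (fun _ => e) (-(e * n * m)) σ) (n * ε))) σ ≤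
      3 * n * Real.exp (n * lam * ε / 2) := by
  have hn' : (0 : ℝ) < n := Nat.cast_pos.2 hn
  have he2 : e * e = 1 := by rw [← abs_mul_abs_self, he, mul_one]
  have ha : ∀ v : Fin n, |(fun _ : Fin n => e) v| ≤ 1 := fun _ => he.le
  set ℓ : Config n → ℝ := affine (fun _ => e) (-(e * n * m)) with hℓ
  have hℓe : ∀ σ, ℓ σ = n * (e * (mag σ - m)) := affine_const_eq hn e m
  have hpos : 0 ≤ 3 * n * Real.exp (n * lam * ε / 2) := by positivity
  have hflip : ∀ v, ℓ (flip v σ) ≤ ℓ σ + 2 := by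
    intro v
    rw [hℓ, affine_flip]
    have h1 : -1 ≤ e * spin σ v := (abs_le.1 (abs_mul_spin_le ha σ v)).1
    change ℓ σ - 2 * e * spin σ v ≤ ℓ σ + 2
    linarith
  rcases le_or_gt (n * ε) (ℓ σ) with h1 | h1
  · refine le_trans ?_ hpos
    rw [generator_mulVec]
    refine Finset.sum_nonpos fun v _ => mul_nonpos_of_nonneg_of_nonpos (flipRate_nonneg G β h v σ) ?_
    rw [min_eq_right h1, sub_nonpos]
    exact Real.exp_le_exp.2 (mul_le_mul_of_nonneg_left (min_le_right _ _) hl0.le)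
  rcases le_or_gt (n * (ε / 2)) (ℓ σ) with h2 | h2
  · refine le_trans ?_ hpos
    have h3 : (generator G β h *ᵥ fun σ => Real.exp (lam * min (ℓ σ) (n * ε))) σ ≤
        (generator G β h *ᵥ fun σ => Real.exp (lam * ℓ σ)) σ := by
      rw [generator_mulVec, generator_mulVec]
      refine Finset.sum_le_sum fun v _ => mul_le_mul_of_nonneg_left ?_ (flipRate_nonneg G β h v σ)
      rw [min_eq_left h1.le]
      exact sub_le_sub_right
        (Real.exp_le_exp.2 (mul_le_mul_of_nonneg_left (min_le_left _ _) hl0.le)) _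
    refine h3.trans ((generator_exp_affine_le hβ G h ha _ hl0.le hl σ).trans ?_)
    refine mul_nonpos_of_nonneg_of_nonpos (Real.exp_pos _).le ?_
    set y : ℝ := e * (mag σ - m) with hy
    have hyI : y ∈ Set.Icc (ε / 2) ε := by
      rw [hℓe] at h1 h2
      exact ⟨le_of_mul_le_mul_left h2 hn', (lt_of_mul_lt_mul_left h1 hn'.le).le⟩
    have hmag : mag σ = m + e * y := by rw [hy, ← mul_assoc, he2]; ring
    have hs : p * mag σ + h ≤ 0 := by
      refine hneg _ ?_
      rw [hmag, add_sub_cancel_left, abs_mul, he, one_mul, abs_of_nonneg]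
      · exact hyI.2
      · linarith [hyI.1]
    have h4 := drift_le hβ G h ha σ hs
    have h5 := hG.sum_abs_field_sub_le hn h σ (p * mag σ + h)
    rw [sub_self, abs_zero, add_zero] at h5
    have h6 : ∑ v, e * (-(1 + Real.exp (2 * β * (p * mag σ + h))) * spin σ v +
        (Real.exp (2 * β * (p * mag σ + h)) - 1)) = n * (e * ((1 - mag σ) *
          Real.exp (2 * β * (p * mag σ + h)) - (1 + mag σ))) := by
      rw [← Finset.mul_sum, Finset.sum_add_distrib, ← Finset.mul_sum, sum_spin hn]
      simp
      ring
    have h7 := hdrift y hyI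
    rw [← hmag] at h7
    have h8 : ∑ v, flipRate G β h v σ * (-2 * (e * spin σ v)) ≤ n * (-(4 * lam)) := by
      rw [h6] at h4
      refine h4.trans ?_
      have a1 := mul_le_mul_of_nonneg_left h7 hn'.le
      have a2 := mul_le_mul_of_nonneg_left h5 (by positivity : 0 ≤ 4 * β)
      have a3 := mul_le_mul_of_nonneg_left hc hn'.le
      linarith
    have h9 := mul_le_mul_of_nonneg_left h8 hl0.le
    nlinarith
  · rw [generator_mulVec]
    have key : ∀ v, flipRate G β h v σ * (Real.exp (lam * min (ℓ (flip v σ)) (n * ε)) -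
        Real.exp (lam * min (ℓ σ) (n * ε))) ≤ 3 * Real.exp (n * lam * ε / 2) := by
      intro v
      have h3 : Real.exp (lam * min (ℓ (flip v σ)) (n * ε)) ≤
          3 * Real.exp (n * lam * ε / 2) := by
        -- A flip raises `ℓ` by at most 2, and `2 lam ≤ 1`; the factor 3 comes from `e < 3`.
        have h4 : lam * min (ℓ (flip v σ)) (n * ε) ≤ 1 + n * lam * ε / 2 := by
          have : min (ℓ (flip v σ)) (n * ε) ≤ n * (ε / 2) + 2 :=
            (min_le_left _ _).trans ((hflip v).trans (by linarith))
          have := mul_le_mul_of_nonneg_left this hl0.le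
          linarith
        refine (Real.exp_le_exp.2 h4).trans ?_
        rw [Real.exp_add]
        exact mul_le_mul_of_nonneg_right Real.exp_one_lt_three.le (Real.exp_pos _).le
      calc _ ≤ flipRate G β h v σ * (3 * Real.exp (n * lam * ε / 2)) := by
            refine mul_le_mul_of_nonneg_left ?_ (flipRate_nonneg G β h v σ)
            linarith [Real.exp_pos (lam * min (ℓ σ) (n * ε))]
        _ ≤ 1 * (3 * Real.exp (n * lam * ε / 2)) :=
            mul_le_mul_of_nonneg_right (flipRate_le_one hβ G h v σ) (by positivity)
        _ = _ := one_mul _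
    refine (Finset.sum_le_sum fun v _ => key v).trans (le_of_eq ?_)
    simp
    ring

/-- Markov's inequality: the Lyapunov function starts at most at `e^{nλε/2}`, grows at most linearly
in time on that scale, and equals `e^{nλε}` on the event (λ being `lam`). -/
lemma magnetization_tail {G : SimpleGraph (Fin n)} {p β h m ε c lam δ e : ℝ}
    (hn : 0 < n) (hβ : 0 ≤ β) (hG : Quasirandom G p δ) (he : |e| = 1) (hl0 : 0 < lam)
    (hl : lam ≤ 1 / 2) (hε : 0 < ε) (hneg : ∀ x, |x - m| ≤ ε → p * x + h ≤ 0)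
    (hdrift : ∀ y ∈ Set.Icc (ε / 2) ε, e * ((1 - (m + e * y)) *
      Real.exp (2 * β * (p * (m + e * y) + h)) - (1 + (m + e * y))) ≤ -c)
    (hc : 4 * β * δ + 4 * lam ≤ c) {σ₀ : Config n} (h0 : e * (mag σ₀ - m) ≤ ε / 2)
    {t : ℝ} (ht : 0 ≤ t) :
    (NormedSpace.exp (t • generator G β h) *ᵥ
        fun σ => if ε ≤ e * (mag σ - m) then 1 else 0) σ₀ ≤
      (1 + 3 * n * t) * Real.exp (-(n * lam * ε / 2)) := by
  have hn' : (0 : ℝ) < n := Nat.cast_pos.2 hn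
  have hQ := isQMatrix_generator G β h
  set V : Config n → ℝ := fun σ =>
    Real.exp (lam * min (affine (fun _ => e) (-(e * n * m)) σ) (n * ε)) with hV
  have h1 := exp_mulVec_le_add (Q := generator G β h) (f := fun _ => V) (f' := fun _ => 0)
    (B := 3 * n * Real.exp (n * lam * ε / 2)) ht (fun _ _ _ => hasDerivAt_const _ _) σ₀
    (fun s hs => by
      rw [← hQ.exp_mulVec_const hs.1 (3 * n * Real.exp (n * lam * ε / 2)) σ₀, add_zero]
      exact hQ.exp_mulVec_mono hs.1
        (generator_truncated_exp_le hn hβ hG he hl0 hl hε hneg hdrift hc) σ₀)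
  simp only [exp_zero_smul, one_mulVec, sub_zero] at h1
  have h2 : V σ₀ ≤ Real.exp (n * lam * ε / 2) := by
    refine Real.exp_le_exp.2 ?_
    have : min (affine (fun _ => e) (-(e * n * m)) σ₀) (n * ε) ≤ n * (ε / 2) := by
      refine (min_le_left _ _).trans ?_
      rw [affine_const_eq hn]
      exact mul_le_mul_of_nonneg_left h0 hn'.le
    have := mul_le_mul_of_nonneg_left this hl0.le
    linarith
  have h3 : (NormedSpace.exp (t • generator G β h) *ᵥ
      fun σ => if ε ≤ e * (mag σ - m) then 1 else 0) σ₀ ≤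
      (NormedSpace.exp (t • generator G β h) *ᵥ (Real.exp (-(n * lam * ε)) • V)) σ₀ := by
    refine hQ.exp_mulVec_mono ht (fun σ => ?_) σ₀
    rw [Pi.smul_apply, smul_eq_mul]
    split_ifs with hσ
    · have : n * ε ≤ affine (fun _ => e) (-(e * n * m)) σ := by
        rw [affine_const_eq hn]; exact mul_le_mul_of_nonneg_left hσ hn'.le
      rw [hV]
      simp only
      rw [min_eq_right this, ← Real.exp_add]
      refine le_of_eq (Real.exp_eq_one_iff _ |>.2 (by ring)).symm
    · positivity
  rw [mulVec_smul, Pi.smul_apply, smul_eq_mul] at h3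
  refine h3.trans ?_
  have h4 : Real.exp (-(n * lam * ε)) * Real.exp (n * lam * ε / 2)
      = Real.exp (-(n * lam * ε / 2)) := by rw [← Real.exp_add]; ring_nf
  calc _ ≤ Real.exp (-(n * lam * ε)) *
        (Real.exp (n * lam * ε / 2) + 3 * n * Real.exp (n * lam * ε / 2) * t) := by
        gcongr
        linarith
    _ = (1 + 3 * n * t) * (Real.exp (-(n * lam * ε)) * Real.exp (n * lam * ε / 2)) := by ring
    _ = _ := by rw [h4]

/-! ### Concentration of the local fields -/

/-- The deviation of the local magnetization around `w`. -/
def localDev (G : SimpleGraph (Fin n)) (m : ℝ) (w : Fin n) (σ : Config n) : ℝ :=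
  1 / n * ∑ v, adj G w v * (spin σ v - m)

lemma adj_nonneg (G : SimpleGraph (Fin n)) (v w : Fin n) : 0 ≤ adj G v w := by
  unfold adj; split_ifs <;> norm_num

lemma adj_le_one (G : SimpleGraph (Fin n)) (v w : Fin n) : adj G v w ≤ 1 := by
  unfold adj; split_ifs <;> norm_num

lemma adj_comm (G : SimpleGraph (Fin n)) (v w : Fin n) : adj G v w = adj G w v := by
  by_cases hvw : G.Adj v w
  · simp [adj, hvw, hvw.symm]
  · simp [adj, hvw, mt SimpleGraph.Adj.symm hvw]

lemma abs_localDev_le (G : SimpleGraph (Fin n)) {m : ℝ} (hm : |m| ≤ 1) (w : Fin n)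
    (σ : Config n) : n * |localDev G m w σ| ≤ 2 * n := by
  rcases Nat.eq_zero_or_pos n with rfl | hn
  · exact w.elim0
  have hn' : (0 : ℝ) < n := Nat.cast_pos.2 hn
  rw [localDev, abs_mul, abs_of_nonneg (by positivity : (0 : ℝ) ≤ 1 / n), ← mul_assoc,
    mul_one_div_cancel hn'.ne', one_mul]
  refine (Finset.abs_sum_le_sum_abs _ _).trans ?_
  have : ∀ v ∈ Finset.univ, |adj G w v * (spin σ v - m)| ≤ 2 := by
    intro v _
    rw [abs_mul, abs_of_nonneg (adj_nonneg G w v)]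
    have h1 : |spin σ v - m| ≤ 2 := by
      refine (abs_sub _ _).trans ?_
      rw [abs_spin]; linarith
    calc adj G w v * |spin σ v - m| ≤ 1 * 2 :=
          mul_le_mul (adj_le_one G w v) h1 (abs_nonneg _) zero_le_one
      _ = 2 := by norm_num
  refine (Finset.sum_le_sum this).trans ?_
  simp [mul_comm]

lemma affine_adj_eq (G : SimpleGraph (Fin n)) (e m γ : ℝ) (w : Fin n) (hn : 0 < n)
    (σ : Config n) :
    affine (fun v => e * adj G w v) (-(∑ v, e * adj G w v * m) - n * γ) σ =
      n * (e * localDev G m w σ - γ) := by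
  have hn' : (n : ℝ) ≠ 0 := (Nat.cast_pos.2 hn).ne'
  have : n * (e * localDev G m w σ - γ) = e * ∑ v, adj G w v * (spin σ v - m) - n * γ := by
    rw [localDev]; field_simp
  rw [this, affine, Finset.mul_sum, ← add_sub_assoc, ← sub_eq_add_neg, ← Finset.sum_sub_distrib]
  congr 1
  exact Finset.sum_congr rfl fun v _ => by ring

/-- While the magnetization is near `m`, the local deviation has drift `-(1+r)` times itself, up to
errors which the shift `γ` absorbs. When it is not, a crude bound is weighted by the small
probability `η`. -/
lemma exp_localDev_le {G : SimpleGraph (Fin n)} {p β h m ε δ e θ₀ γ η t₁ : ℝ} {w : Fin n}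
    (hn : 0 < n) (hp : p ∈ Set.Icc (0 : ℝ) 1) (hβ : 0 ≤ β) (hG : Quasirandom G p δ)
    (hδ : 0 ≤ δ) (hε : 0 < ε) (hm : |m| ≤ 1) (hs : p * m + h ≤ 0)
    (hr : (1 + Real.exp (2 * β * (p * m + h))) * m = Real.exp (2 * β * (p * m + h)) - 1)
    (he : |e| = 1) (hθ0 : 0 < θ₀) (hθ : θ₀ ≤ 1 / 2) (hγ : γ = 4 * β * (δ + ε) + 4 * θ₀)
    (ht₁ : 0 ≤ t₁) {σ₀ : Config n}
    (hη : ∀ t ∈ Set.Icc 0 t₁, (NormedSpace.exp (t • generator G β h) *ᵥ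
      fun σ => if ε ≤ |mag σ - m| then 1 else 0) σ₀ ≤ η) :
    (NormedSpace.exp (t₁ • generator G β h) *ᵥ
        fun σ => Real.exp (θ₀ * (n * (e * localDev G m w σ - γ)))) σ₀ ≤
      Real.exp (2 * n * θ₀ * Real.exp (-t₁)) + 3 * n * Real.exp (2 * n * θ₀) * η * t₁ := by
  have hn' : (0 : ℝ) < n := Nat.cast_pos.2 hn
  have hQ := isQMatrix_generator G β h
  set r : ℝ := Real.exp (2 * β * (p * m + h)) with hrdef
  have hr0 : 0 < r := Real.exp_pos _
  have hr1 : r ≤ 1 := Real.exp_le_one_iff.2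
    (mul_nonpos_of_nonneg_of_nonpos (by positivity) hs)
  set a : Fin n → ℝ := fun v => e * adj G w v with ha'
  have ha : ∀ v, |a v| ≤ 1 := fun v => by
    rw [ha', abs_mul, he, one_mul, abs_of_nonneg (adj_nonneg G w v)]; exact adj_le_one G w v
  set b : ℝ := -(∑ v, e * adj G w v * m) - n * γ with hb
  set ℓ : Config n → ℝ := affine a b with hℓ
  have hγ0 : 0 ≤ γ := by rw [hγ]; positivity
  have hℓe : ∀ σ, ℓ σ = n * (e * localDev G m w σ - γ) := affine_adj_eq G e m γ w hn
  have hℓ2 : ∀ σ, ℓ σ ≤ 2 * n := by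
    intro σ
    rw [hℓe]
    have h1 := abs_localDev_le G hm w σ
    have h2 : e * localDev G m w σ ≤ |localDev G m w σ| := by
      refine (le_abs_self _).trans ?_
      rw [abs_mul, he, one_mul]
    have h3 := mul_le_mul_of_nonneg_left h2 hn'.le
    have h4 : 0 ≤ n * γ := by positivity
    linarith
  -- The solution of `θ' = (1+r)θ` ending at `θ₀`: its growth cancels the linear drift, and its
  -- initial value, at most `θ₀ e^{-t₁}`, makes the starting configuration almost irrelevant.
  set θ : ℝ → ℝ := fun t => θ₀ * Real.exp ((1 + r) * (t - t₁)) with hθdef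
  have hθpos : ∀ t, 0 < θ t := fun t => by positivity
  have hθle : ∀ t ≤ t₁, θ t ≤ θ₀ := fun t ht =>
    mul_le_of_le_one_right hθ0.le (Real.exp_le_one_iff.2
      (mul_nonpos_of_nonneg_of_nonpos (by positivity) (sub_nonpos.2 ht)))
  have hθd : ∀ t, HasDerivAt θ ((1 + r) * θ t) t := by
    intro t
    have := (((hasDerivAt_id t).sub_const t₁).const_mul (1 + r)).exp.const_mul θ₀
    refine this.congr_deriv ?_
    simp only [hθdef, id_eq]; ring
  set f : ℝ → Config n → ℝ := fun t σ => Real.exp (θ t * ℓ σ) with hf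
  set f' : ℝ → Config n → ℝ := fun t σ => Real.exp (θ t * ℓ σ) * ((1 + r) * θ t * ℓ σ) with hf'
  have hexp2 : ∀ t ≤ t₁, ∀ σ, f t σ ≤ Real.exp (2 * n * θ₀) := by
    intro t ht σ
    refine Real.exp_le_exp.2 ?_
    calc θ t * ℓ σ ≤ θ t * (2 * n) := mul_le_mul_of_nonneg_left (hℓ2 σ) (hθpos t).le
      _ ≤ θ₀ * (2 * n) := mul_le_mul_of_nonneg_right (hθle t ht) (by positivity)
      _ = 2 * n * θ₀ := by ring
  -- One part of the 3 bounds the generator term, two parts the time derivative.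
  set K : ℝ := 3 * n * Real.exp (2 * n * θ₀) with hK
  have hK0 : 0 ≤ K := by positivity
  have hpt : ∀ t ∈ Set.Icc 0 t₁, ∀ σ, (generator G β h *ᵥ f t + f' t) σ ≤
      (K • fun σ : Config n => if ε ≤ |mag σ - m| then (1 : ℝ) else 0) σ := by
    intro t ht σ
    rw [Pi.add_apply, Pi.smul_apply, smul_eq_mul]
    split_ifs with hbad
    · rw [mul_one]
      have h1 : (generator G β h *ᵥ f t) σ ≤ n * Real.exp (2 * n * θ₀) := by
        rw [generator_mulVec]
        calc _ ≤ ∑ v : Fin n, Real.exp (2 * n * θ₀) := by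
              refine Finset.sum_le_sum fun v _ => ?_
              have h2 := flipRate_nonneg G β h v σ
              have h3 := flipRate_le_one hβ G h v σ
              have h4 := hexp2 t ht.2 (flip v σ)
              have h5 : 0 < f t σ := Real.exp_pos _
              have h6 : 0 < f t (flip v σ) := Real.exp_pos _
              nlinarith
          _ = _ := by simp
      have h2 : f' t σ ≤ 2 * n * Real.exp (2 * n * θ₀) := by
        have h3 : (1 + r) * θ t * ℓ σ ≤ 2 * n := by
          have h4 : (1 + r) * θ t ≤ 1 := by
            have := hθle t ht.2
            nlinarith [hθpos t]
          have h5 : 0 ≤ (1 + r) * θ t := mul_nonneg (by positivity) (hθpos t).le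
          calc (1 + r) * θ t * ℓ σ ≤ (1 + r) * θ t * (2 * n) :=
                mul_le_mul_of_nonneg_left (hℓ2 σ) h5
            _ ≤ 1 * (2 * n) := mul_le_mul_of_nonneg_right h4 (by positivity)
            _ = 2 * n := one_mul _
        calc f' t σ ≤ f t σ * (2 * n) := mul_le_mul_of_nonneg_left h3 (Real.exp_pos _).le
          _ ≤ Real.exp (2 * n * θ₀) * (2 * n) :=
              mul_le_mul_of_nonneg_right (hexp2 t ht.2 σ) (by positivity)
          _ = _ := by ring
      rw [hK]; linarith
    · rw [mul_zero]
      have hθt := hθle t ht.2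
      have h1 := generator_exp_affine_le hβ G h ha b (hθpos t).le (hθt.trans hθ) σ
      have h2 := drift_le hβ G h ha σ hs
      have h3 := hG.sum_abs_field_sub_le hn h σ (p * m + h)
      have h4 : |p * mag σ + h - (p * m + h)| ≤ ε := by
        have : p * mag σ + h - (p * m + h) = p * (mag σ - m) := by ring
        rw [this, abs_mul, abs_of_nonneg hp.1]
        have h5 := (not_le.1 hbad).le
        calc p * |mag σ - m| ≤ 1 * ε := mul_le_mul hp.2 h5 (abs_nonneg _) zero_le_one
          _ = ε := one_mul _
      -- By `hr`, `m` is the fixed point of the single-spin drift, so the constant terms cancel.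
      have h5 : ∑ v, a v * (-(1 + r) * spin σ v + (r - 1)) = -(1 + r) * (ℓ σ + n * γ) := by
        rw [hℓ, affine, hb, ← hr]
        simp only [ha', Finset.mul_sum, mul_add, Finset.sum_add_distrib]
        rw [sub_eq_add_neg, ← Finset.sum_neg_distrib]
        simp only [mul_add, Finset.mul_sum]
        rw [add_assoc, add_assoc, ← mul_add, neg_add_cancel, mul_zero, add_zero]
        congr 1 <;> exact Finset.sum_congr rfl fun v _ => by ring
      have h6 : ∑ v, flipRate G β h v σ * (-2 * (a v * spin σ v)) ≤
          -(1 + r) * (ℓ σ + n * γ) + 4 * β * (n * (δ + ε)) := by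
        rw [h5] at h2
        refine h2.trans (add_le_add le_rfl (mul_le_mul_of_nonneg_left (h3.trans ?_)
          (by positivity)))
        gcongr
      have h7 : θ t * ∑ v, flipRate G β h v σ * (-2 * (a v * spin σ v)) + 4 * θ t ^ 2 * n
          ≤ -((1 + r) * θ t * ℓ σ) := by
        have h8 := mul_le_mul_of_nonneg_left h6 (hθpos t).le
        have h9 : θ t * (4 * β * (n * (δ + ε)) + 4 * θ t * n) ≤ θ t * ((1 + r) * (n * γ)) := by
          refine mul_le_mul_of_nonneg_left ?_ (hθpos t).le
          calc 4 * β * (n * (δ + ε)) + 4 * θ t * n ≤ 4 * β * (n * (δ + ε)) + 4 * θ₀ * n := by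
                gcongr
            _ = 1 * (n * γ) := by rw [hγ]; ring
            _ ≤ (1 + r) * (n * γ) := by
                refine mul_le_mul_of_nonneg_right (by linarith) (by positivity)
        linarith
      have h8 := mul_le_mul_of_nonneg_left h7 (Real.exp_pos (θ t * ℓ σ)).le
      change (generator G β h *ᵥ fun σ => Real.exp (θ t * affine a b σ)) σ +
        Real.exp (θ t * ℓ σ) * ((1 + r) * θ t * ℓ σ) ≤ 0
      linarith
  have hmain := exp_mulVec_le_add (Q := generator G β h) (f := f) (f' := f') (B := K * η) ht₁
    (fun t _ σ => by
      have := ((hθd t).mul_const (ℓ σ)).exp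
      exact this) σ₀
    (fun t ht => by
      refine (hQ.exp_mulVec_mono ht.1 (hpt t ht) σ₀).trans ?_
      rw [mulVec_smul, Pi.smul_apply, smul_eq_mul]
      exact mul_le_mul_of_nonneg_left (hη t ht) hK0)
  rw [exp_zero_smul, one_mulVec, sub_zero] at hmain
  have hft : f t₁ = fun σ => Real.exp (θ₀ * (n * (e * localDev G m w σ - γ))) := by
    funext σ
    simp only [hf, hθdef, sub_self, mul_zero, Real.exp_zero, mul_one, hℓe]
  rw [hft] at hmain
  refine hmain.trans (add_le_add (Real.exp_le_exp.2 ?_) le_rfl)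
  calc θ 0 * ℓ σ₀ ≤ θ 0 * (2 * n) := mul_le_mul_of_nonneg_left (hℓ2 σ₀) (hθpos 0).le
    _ ≤ (θ₀ * Real.exp (-t₁)) * (2 * n) := by
        refine mul_le_mul_of_nonneg_right (mul_le_mul_of_nonneg_left
          (Real.exp_le_exp.2 ?_) hθ0.le) (by positivity)
        nlinarith
    _ = 2 * n * θ₀ * Real.exp (-t₁) := by ring

end ERGlauber

end

/-! ### Tail bounds in the well and the contraction rate. -/

open scoped NNReal Topology

noncomputable section

namespace ERGlauber

open Matrix FiniteMarkov

variable {n : ℕ}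

/-- The constants that describe the potential well around `m`. -/
structure WellConstants (p β h m δ ε c lam θ₀ δ₂ : ℝ) : Prop where
  p_mem : p ∈ Set.Icc (0 : ℝ) 1
  β_nonneg : 0 ≤ β
  abs_m : |m| ≤ 1
  field_nonpos : p * m + h ≤ 0
  fixed : (1 + Real.exp (2 * β * (p * m + h))) * m = Real.exp (2 * β * (p * m + h)) - 1
  δ_nonneg : 0 ≤ δ
  ε_pos : 0 < ε
  field_nonpos_near : ∀ x, |x - m| ≤ ε → p * x + h ≤ 0
  drift : ∀ e : ℝ, |e| = 1 → ∀ y ∈ Set.Icc (ε / 2) ε, e * ((1 - (m + e * y)) *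
    Real.exp (2 * β * (p * (m + e * y) + h)) - (1 + (m + e * y))) ≤ -c
  drift_dominates : 4 * β * δ + 4 * lam ≤ c
  lam_pos : 0 < lam
  lam_le : lam ≤ 1 / 2
  θ_pos : 0 < θ₀
  θ_le : θ₀ ≤ 1 / 2
  θ_le_lam : 2 * θ₀ ≤ lam * ε / 2
  error_le : 4 * β * (δ + ε) + 4 * θ₀ ≤ δ₂ / 2

section Tail

variable {G : SimpleGraph (Fin n)} {p β h m δ ε c lam θ₀ δ₂ : ℝ}

lemma WellConstants.magnetization_tail (K : WellConstants p β h m δ ε c lam θ₀ δ₂) (hn : 0 < n)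
    (hG : Quasirandom G p δ) {σ₀ : Config n} (h0 : |mag σ₀ - m| ≤ ε / 2) {t : ℝ}
    (ht : t ∈ Set.Icc (0 : ℝ) (2 * n)) :
    (NormedSpace.exp (t • generator G β h) *ᵥ
        fun σ => if ε ≤ |mag σ - m| then 1 else 0) σ₀ ≤
      14 * (n : ℝ) ^ 2 * Real.exp (-(n * lam * ε / 2)) := by
  have hn1 : (1 : ℝ) ≤ n := Nat.one_le_cast.2 hn
  have hQ := isQMatrix_generator G β h
  have key : ∀ e : ℝ, |e| = 1 → (NormedSpace.exp (t • generator G β h) *ᵥ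
        fun σ => if ε ≤ e * (mag σ - m) then 1 else 0) σ₀ ≤
      7 * (n : ℝ) ^ 2 * Real.exp (-(n * lam * ε / 2)) := by
    intro e he
    have h1 : e * (mag σ₀ - m) ≤ ε / 2 := by
      refine (le_abs_self _).trans ?_
      rw [abs_mul, he, one_mul]; exact h0
    refine (ERGlauber.magnetization_tail hn K.β_nonneg hG he K.lam_pos K.lam_le K.ε_pos
      K.field_nonpos_near (K.drift e he) K.drift_dominates h1 ht.1).trans ?_
    refine mul_le_mul_of_nonneg_right ?_ (Real.exp_pos _).le
    -- For `t ≤ 2n` the prefactor `1 + 3nt` is at most `7n²`; the two sides of `m` give 14.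
    nlinarith [ht.2]
  have h1 := key 1 abs_one
  have h2 := key (-1) (by simp)
  calc _ ≤ (NormedSpace.exp (t • generator G β h) *ᵥ
        ((fun σ => if ε ≤ 1 * (mag σ - m) then 1 else 0) +
          fun σ => if ε ≤ -1 * (mag σ - m) then 1 else 0)) σ₀ := by
        refine hQ.exp_mulVec_mono ht.1 (fun σ => ?_) σ₀
        simp only [Pi.add_apply, one_mul, neg_one_mul, le_abs]
        split_ifs with ha hb hc' <;> first | (exfalso; tauto) | norm_num
    _ ≤ _ := by
        rw [mulVec_add, Pi.add_apply]
        linarith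

/-- Markov's inequality and a union bound over vertices and signs. The event forces an exponent of
at least `nθ₀δ₂/2`, since `γ ≤ δ₂/2`; by the burn-in condition on `t` the moment is only of order
`e^{nθ₀δ₂/4}`. The field `θ_le_lam` makes the crude `e^{2nθ₀}` harmless against the magnetization
tail. -/
lemma WellConstants.localDev_tail (K : WellConstants p β h m δ ε c lam θ₀ δ₂) (hn : 0 < n)
    (hG : Quasirandom G p δ) {σ₀ : Config n} (h0 : |mag σ₀ - m| ≤ ε / 2) {t : ℝ}
    (ht : t ∈ Set.Icc (0 : ℝ) (2 * n)) (hT : Real.exp (-t) ≤ δ₂ / 8) :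
    (NormedSpace.exp (t • generator G β h) *ᵥ
        fun σ => if ∃ w, δ₂ ≤ |localDev G m w σ| then 1 else 0) σ₀ ≤
      170 * (n : ℝ) ^ 5 * Real.exp (-(n * θ₀ * δ₂ / 4)) := by
  have hn' : (0 : ℝ) < n := Nat.cast_pos.2 hn
  have hn1 : (1 : ℝ) ≤ n := Nat.one_le_cast.2 hn
  have hQ := isQMatrix_generator G β h
  have hθ0 := K.θ_pos
  have hε := K.ε_pos
  have hlam := K.lam_pos
  have hδ₂ : 0 < δ₂ := by
    have := Real.exp_pos (-t)
    linarith
  set γ : ℝ := 4 * β * (δ + ε) + 4 * θ₀ with hγ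
  have key : ∀ (w : Fin n) (e : ℝ), |e| = 1 → (NormedSpace.exp (t • generator G β h) *ᵥ
        fun σ => if δ₂ ≤ e * localDev G m w σ then 1 else 0) σ₀ ≤
      85 * (n : ℝ) ^ 4 * Real.exp (-(n * θ₀ * δ₂ / 4)) := by
    intro w e he
    have h1 := exp_localDev_le (w := w) hn K.p_mem K.β_nonneg hG K.δ_nonneg K.ε_pos K.abs_m
      K.field_nonpos K.fixed he K.θ_pos K.θ_le hγ ht.1
      (fun s hs => K.magnetization_tail hn hG h0 ⟨hs.1, hs.2.trans ht.2⟩)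
    have h2 : Real.exp (2 * n * θ₀ * Real.exp (-t)) ≤ Real.exp (n * θ₀ * δ₂ / 4) := by
      refine Real.exp_le_exp.2 ?_
      have := mul_le_mul_of_nonneg_left hT (by positivity : 0 ≤ 2 * n * θ₀)
      linarith
    have h3 : 3 * n * Real.exp (2 * n * θ₀) * (14 * (n : ℝ) ^ 2 *
        Real.exp (-(n * lam * ε / 2))) * t ≤ 84 * (n : ℝ) ^ 4 * Real.exp (n * θ₀ * δ₂ / 4) := by
      have e1 : Real.exp (2 * n * θ₀) * Real.exp (-(n * lam * ε / 2)) ≤ 1 := by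
        rw [← Real.exp_add, Real.exp_le_one_iff]
        have := mul_le_mul_of_nonneg_left K.θ_le_lam hn'.le
        linarith
      have e2 : 1 ≤ Real.exp (n * θ₀ * δ₂ / 4) := Real.one_le_exp (by positivity)
      calc _ = 42 * (n : ℝ) ^ 3 * (Real.exp (2 * n * θ₀) * Real.exp (-(n * lam * ε / 2))) * t := by
            ring
        _ ≤ 42 * (n : ℝ) ^ 3 * 1 * (2 * n) := by
            gcongr
            · exact ht.1
            · exact ht.2
        _ = 84 * (n : ℝ) ^ 4 * 1 := by ring
        _ ≤ _ := by gcongr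
    have h4 : (NormedSpace.exp (t • generator G β h) *ᵥ
        fun σ => Real.exp (θ₀ * (n * (e * localDev G m w σ - γ)))) σ₀ ≤
        85 * (n : ℝ) ^ 4 * Real.exp (n * θ₀ * δ₂ / 4) := by
      have e3 : Real.exp (n * θ₀ * δ₂ / 4) ≤ (n : ℝ) ^ 4 * Real.exp (n * θ₀ * δ₂ / 4) :=
        le_mul_of_one_le_left (Real.exp_pos _).le (one_le_pow₀ hn1)
      linarith
    have h5 : (NormedSpace.exp (t • generator G β h) *ᵥ
        fun σ => if δ₂ ≤ e * localDev G m w σ then 1 else 0) σ₀ ≤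
        (NormedSpace.exp (t • generator G β h) *ᵥ (Real.exp (-(n * θ₀ * δ₂ / 2)) •
          fun σ => Real.exp (θ₀ * (n * (e * localDev G m w σ - γ))))) σ₀ := by
      refine hQ.exp_mulVec_mono ht.1 (fun σ => ?_) σ₀
      rw [Pi.smul_apply, smul_eq_mul, ← Real.exp_add]
      split_ifs with hσ
      · refine Real.one_le_exp ?_
        have e1 : δ₂ / 2 ≤ e * localDev G m w σ - γ := by linarith [K.error_le]
        have := mul_le_mul_of_nonneg_left e1 (by positivity : 0 ≤ θ₀ * n)
        linarith
      · exact (Real.exp_pos _).le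
    rw [mulVec_smul, Pi.smul_apply, smul_eq_mul] at h5
    refine h5.trans ((mul_le_mul_of_nonneg_left h4 (Real.exp_pos _).le).trans (le_of_eq ?_))
    have e4 : Real.exp (-(n * θ₀ * δ₂ / 2)) * Real.exp (n * θ₀ * δ₂ / 4)
        = Real.exp (-(n * θ₀ * δ₂ / 4)) := by rw [← Real.exp_add]; ring_nf
    rw [← e4]; ring
  calc _ ≤ (NormedSpace.exp (t • generator G β h) *ᵥ
        (∑ w : Fin n, ((fun σ => if δ₂ ≤ 1 * localDev G m w σ then 1 else 0) +
          fun σ => if δ₂ ≤ -1 * localDev G m w σ then 1 else 0))) σ₀ := by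
        refine hQ.exp_mulVec_mono ht.1 (fun σ => ?_) σ₀
        have hnn : ∀ w, 0 ≤ ((fun σ => if δ₂ ≤ 1 * localDev G m w σ then 1 else 0) +
          fun σ => if δ₂ ≤ -1 * localDev G m w σ then 1 else 0 : Config n → ℝ) σ := by
          intro w
          simp only [Pi.add_apply]
          split_ifs <;> norm_num
        rw [Finset.sum_apply]
        split_ifs with hσ
        · obtain ⟨w, hw⟩ := hσ
          refine le_trans ?_ (Finset.single_le_sum (fun w _ => hnn w) (Finset.mem_univ w))
          rw [le_abs] at hw
          simp only [Pi.add_apply, one_mul, neg_one_mul]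
          split_ifs with ha hb hb <;> first | (exfalso; tauto) | norm_num
        · exact Finset.sum_nonneg fun w _ => hnn w
    _ = ∑ w : Fin n, ((NormedSpace.exp (t • generator G β h) *ᵥ
        fun σ => if δ₂ ≤ 1 * localDev G m w σ then 1 else 0) σ₀ +
        (NormedSpace.exp (t • generator G β h) *ᵥ
        fun σ => if δ₂ ≤ -1 * localDev G m w σ then 1 else 0) σ₀) := by
        rw [← Matrix.mulVecLin_apply, map_sum, Finset.sum_apply]
        refine Finset.sum_congr rfl fun w _ => ?_
        rw [Matrix.mulVecLin_apply, mulVec_add, Pi.add_apply]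
    _ ≤ ∑ w : Fin n, 170 * (n : ℝ) ^ 4 * Real.exp (-(n * θ₀ * δ₂ / 4)) := by
        refine Finset.sum_le_sum fun w _ => ?_
        have h1 := key w 1 abs_one
        have h2 := key w (-1) (by simp)
        linarith
    _ = _ := by
        simp only [Finset.sum_const, Finset.card_univ, Fintype.card_fin, nsmul_eq_mul]
        ring

end Tail

/-! ### Contraction of the disagreement set -/

/-- The factor `e^M` must be kept: it becomes the rate `r` of minus spins, without which the
contraction would not come out under the sharp curvature condition. -/
lemma abs_exp_sub_le {x y M : ℝ} (hx : x ≤ M) (hy : y ≤ M) :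
    |Real.exp x - Real.exp y| ≤ Real.exp M * |x - y| := by
  have h := abs_exp_neg_sub_le (sub_nonneg.2 hx) (sub_nonneg.2 hy)
  have e : Real.exp x - Real.exp y =
      Real.exp M * (Real.exp (-(M - x)) - Real.exp (-(M - y))) := by
    rw [mul_sub, ← Real.exp_add, ← Real.exp_add]; ring_nf
  rw [e, abs_mul, abs_of_pos (Real.exp_pos M)]
  refine mul_le_mul_of_nonneg_left (h.trans (le_of_eq ?_)) (Real.exp_pos M).le
  rw [abs_sub_comm x y]; ring_nf

section Contraction

variable (G : SimpleGraph (Fin n)) (h : ℝ) (z : Config n × Config n)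

lemma abs_field_sub_field_le (v : Fin n) :
    |field G h z.1 v - field G h z.2 v| ≤
      2 / n * ∑ w, adj G w v * if z.1 w ≠ z.2 w then 1 else 0 := by
  have e : field G h z.1 v - field G h z.2 v =
      1 / n * ∑ w, adj G w v * (spin z.1 w - spin z.2 w) := by
    simp only [field, mul_sub, Finset.sum_sub_distrib, adj_comm G v]
    ring
  rw [e, abs_mul, abs_of_nonneg (by positivity : (0 : ℝ) ≤ 1 / n)]
  refine (mul_le_mul_of_nonneg_left (Finset.abs_sum_le_sum_abs _ _) (by positivity)).trans
    (le_of_eq ?_)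
  rw [Finset.mul_sum, Finset.mul_sum]
  refine Finset.sum_congr rfl fun w _ => ?_
  rw [abs_mul, abs_of_nonneg (adj_nonneg G w v), abs_spin_sub]
  split_ifs <;> ring

lemma discrepancy_eq_sum : discrepancy z = ∑ w, if z.1 w ≠ z.2 w then 1 else 0 :=
  card_disagreement _ _

lemma discrepancy_nonneg : 0 ≤ discrepancy z := Nat.cast_nonneg _

lemma discrepancy_le : discrepancy z ≤ n := by
  have := Finset.card_le_univ (disagreement z.1 z.2)
  rw [Fintype.card_fin] at this
  exact Nat.cast_le.2 this

/-- Double counting of the influence of the disagreement set on the vertices weighted by `x`. -/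
lemma sum_weighted_influence_le {x : Fin n → ℝ} {B : ℝ}
    (hB : ∀ w, 2 / n * ∑ v, adj G w v * x v ≤ B) :
    ∑ v, x v * (2 / n * ∑ w, adj G w v * if z.1 w ≠ z.2 w then 1 else 0) ≤
      B * discrepancy z := by
  have e : ∑ v, x v * (2 / n * ∑ w, adj G w v * if z.1 w ≠ z.2 w then 1 else 0) =
      ∑ w, (2 / n * ∑ v, adj G w v * x v) * if z.1 w ≠ z.2 w then 1 else 0 := by
    simp only [Finset.mul_sum, Finset.sum_mul]
    rw [Finset.sum_comm]
    exact Finset.sum_congr rfl fun w _ => Finset.sum_congr rfl fun v _ => by ring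
  rw [e, discrepancy_eq_sum, Finset.mul_sum]
  refine Finset.sum_le_sum fun w _ => mul_le_mul_of_nonneg_right (hB w) ?_
  split_ifs <;> norm_num

/-- Valid in every configuration: healing is ignored and all degrees are bounded by `n`. It serves
during the burn-in and on the bad events. -/
lemma coupledGen_discrepancy_le {β : ℝ} (hβ : 0 ≤ β) :
    (coupledGen G β h *ᵥ discrepancy) z ≤ 4 * β * discrepancy z := by
  rw [coupledGen_discrepancy]
  have h1 : ∀ w : Fin n, 2 / (n : ℝ) * ∑ v, adj G w v * (2 * β) ≤ 4 * β := by
    intro w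
    have hn : (0 : ℝ) < n := Nat.cast_pos.2 (lt_of_le_of_lt (Nat.zero_le _) w.2)
    have : ∑ v, adj G w v * (2 * β) ≤ n * (2 * β) := by
      rw [← Finset.sum_mul]
      refine mul_le_mul_of_nonneg_right ?_ (by positivity)
      exact (Finset.sum_le_sum fun v _ => adj_le_one G w v).trans (by simp)
    calc 2 / (n : ℝ) * ∑ v, adj G w v * (2 * β) ≤ 2 / (n : ℝ) * (n * (2 * β)) := by gcongr
      _ = 4 * β := by field_simp; ring
  refine le_trans (Finset.sum_le_sum fun v _ => ?_)
    (sum_weighted_influence_le G z (x := fun _ => 2 * β) h1)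
  split_ifs with hv
  · have h2 := metro_lipschitz hβ (abs_spin z.1 v) (field G h z.1 v) (field G h z.2 v)
    rw [flipRate_eq_metro, flipRate_eq_metro,
      show spin z.2 v = spin z.1 v by simp [spin, hv]]
    exact h2.trans (mul_le_mul_of_nonneg_left (abs_field_sub_field_le G h z v) (by positivity))
  · have h1 := flipRate_nonneg G β h v z.1
    have h2 := flipRate_nonneg G β h v z.2
    refine le_trans (by linarith) (mul_nonneg (by positivity : 0 ≤ 2 * β)
      (mul_nonneg (by positivity) (Finset.sum_nonneg fun w _ =>
        mul_nonneg (adj_nonneg G w v) (by split_ifs <;> norm_num))))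

variable {G}

/-- Here the field is controlled at every single vertex: the part proportional to `m` sees only the
degree. -/
lemma abs_field_sub_le {p δ m : ℝ} (hG : Quasirandom G p δ) (hm : |m| ≤ 1)
    (σ : Config n) (v : Fin n) :
    |field G h σ v - (p * m + h)| ≤ |localDev G m v σ| + δ := by
  have hn : (0 : ℝ) < n := Nat.cast_pos.2 (lt_of_le_of_lt (Nat.zero_le _) v.2)
  have e : field G h σ v - (p * m + h) =
      localDev G m v σ + m * (1 / n * (∑ w, adj G v w - p * n)) := by
    simp only [field, localDev, mul_sub, Finset.sum_sub_distrib, ← Finset.sum_mul]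
    field_simp
    ring
  rw [e]
  refine (abs_add_le _ _).trans (add_le_add le_rfl ?_)
  rw [abs_mul, abs_mul, abs_of_nonneg (by positivity : (0 : ℝ) ≤ 1 / n)]
  calc |m| * (1 / n * |∑ w, adj G v w - p * n|) ≤ 1 * (1 / n * (δ * n)) := by
        gcongr; exact hG.degree v
    _ = δ := by field_simp

/-- The balance of births and healing. In `hκ` the product is the birth rate per disagreement,
through minus neighbours, and the subtracted term is the healing rate, each at its worst within the
allowed errors. -/
lemma coupledGen_discrepancy_le_of_good {β p δ m δ₂ κ : ℝ} (hβ : 0 ≤ β) (hG : Quasirandom G p δ)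
    (hm : |m| ≤ 1) (hneg : p * m + h + (δ₂ + δ) ≤ 0)
    (hκ : 2 * β * Real.exp (2 * β * (p * m + h + (δ₂ + δ))) * ((1 - m) * (p + δ) + δ₂) -
      (1 + Real.exp (2 * β * (p * m + h - (δ₂ + δ)))) ≤ -κ)
    (hgood₁ : ∀ w, |localDev G m w z.1| ≤ δ₂) (hgood₂ : ∀ w, |localDev G m w z.2| ≤ δ₂) :
    (coupledGen G β h *ᵥ discrepancy) z ≤ -κ * discrepancy z := by
  have hf₁ : ∀ v, |field G h z.1 v - (p * m + h)| ≤ δ₂ + δ := fun v =>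
    (abs_field_sub_le h hG hm z.1 v).trans (by linarith [hgood₁ v])
  have hf₂ : ∀ v, |field G h z.2 v - (p * m + h)| ≤ δ₂ + δ := fun v =>
    (abs_field_sub_le h hG hm z.2 v).trans (by linarith [hgood₂ v])
  set R : ℝ := Real.exp (2 * β * (p * m + h + (δ₂ + δ))) with hR
  set r' : ℝ := Real.exp (2 * β * (p * m + h - (δ₂ + δ))) with hr'
  have hR0 : 0 < R := Real.exp_pos _
  -- Supported on the minus spins of the first copy: an agreeing plus spin flips at rate 1 in both
  -- copies and creates no disagreement.
  set x : Fin n → ℝ := fun v => 2 * β * R * ((1 - spin z.1 v) / 2) with hx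
  have hx0 : ∀ v, 0 ≤ x v := by
    intro v
    have : 0 ≤ (1 - spin z.1 v) / 2 := by
      have := (abs_le.1 (abs_spin z.1 v).le).2
      linarith
    exact mul_nonneg (by positivity) this
  have hB : ∀ w, 2 / (n : ℝ) * ∑ v, adj G w v * x v ≤ 2 * β * R * ((1 - m) * (p + δ) + δ₂) := by
    intro w
    have hn : (0 : ℝ) < n := Nat.cast_pos.2 (lt_of_le_of_lt (Nat.zero_le _) w.2)
    have e : 2 / (n : ℝ) * ∑ v, adj G w v * x v =
        2 * β * R * ((1 - m) * (1 / n * ∑ v, adj G w v) - localDev G m w z.1) := by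
      have e1 : ∑ v, adj G w v * x v = ∑ v, (2 * β * R) * ((1 - m) / 2 * adj G w v -
          1 / 2 * (adj G w v * (spin z.1 v - m))) :=
        Finset.sum_congr rfl fun v _ => by rw [hx]; ring
      rw [e1, localDev, ← Finset.mul_sum, Finset.sum_sub_distrib, ← Finset.mul_sum,
        ← Finset.mul_sum]
      ring
    rw [e]
    refine mul_le_mul_of_nonneg_left ?_ (by positivity)
    have h1 : 1 / n * ∑ v, adj G w v ≤ p + δ := by
      rw [one_div, inv_mul_le_iff₀ hn]
      have := (abs_le.1 (hG.degree w)).2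
      linarith
    have h2 : 0 ≤ 1 - m := by linarith [(abs_le.1 hm).2]
    have h3 := mul_le_mul_of_nonneg_left h1 h2
    have h4 := (abs_le.1 (hgood₁ w)).1
    linarith
  have hinf := sum_weighted_influence_le G z hB
  rw [coupledGen_discrepancy]
  have key : ∀ v, (if z.1 v = z.2 v then |flipRate G β h v z.1 - flipRate G β h v z.2|
      else -(flipRate G β h v z.1 + flipRate G β h v z.2)) ≤
      x v * (2 / n * ∑ w, adj G w v * if z.1 w ≠ z.2 w then 1 else 0) +
        (-(1 + r')) * if z.1 v ≠ z.2 v then 1 else 0 := by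
    intro v
    have g₁ := abs_le.1 (hf₁ v)
    have g₂ := abs_le.1 (hf₂ v)
    have s₁ : field G h z.1 v ≤ 0 := by linarith
    have s₂ : field G h z.2 v ≤ 0 := by linarith
    have hS : 0 ≤ 2 / (n : ℝ) * ∑ w, adj G w v * if z.1 w ≠ z.2 w then 1 else 0 :=
      mul_nonneg (by positivity) (Finset.sum_nonneg fun w _ =>
        mul_nonneg (adj_nonneg G w v) (by split_ifs <;> norm_num))
    rw [flipRate_eq_metro, flipRate_eq_metro]
    split_ifs with hv
    · exact absurd hv ‹_›
    · rw [mul_zero, add_zero, show spin z.2 v = spin z.1 v by simp [spin, hv]]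
      rcases spin_cases z.1 v with ⟨-, e⟩ | ⟨-, e⟩
      · rw [e, metro_one s₁, metro_one s₂, sub_self, abs_zero]
        exact mul_nonneg (hx0 v) hS
      · have h1 := abs_exp_sub_le
          (mul_le_mul_of_nonneg_left (by linarith : field G h z.1 v ≤ p * m + h + (δ₂ + δ))
            (by positivity : 0 ≤ 2 * β))
          (mul_le_mul_of_nonneg_left (by linarith : field G h z.2 v ≤ p * m + h + (δ₂ + δ))
            (by positivity : 0 ≤ 2 * β))
        rw [e, metro_neg_one s₁, metro_neg_one s₂]
        refine h1.trans ?_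
        rw [← mul_sub, abs_mul, abs_of_nonneg (by positivity : 0 ≤ 2 * β), hx]
        simp only [e]
        calc R * (2 * β * |field G h z.1 v - field G h z.2 v|)
            ≤ R * (2 * β * (2 / n * ∑ w, adj G w v * if z.1 w ≠ z.2 w then 1 else 0)) := by
              gcongr; exact abs_field_sub_field_le G h z v
          _ = _ := by ring
    · have h1 : 1 + r' ≤ metro β (spin z.1 v) (field G h z.1 v) +
          metro β (spin z.2 v) (field G h z.2 v) := by
        have e₁ : r' ≤ Real.exp (2 * β * field G h z.1 v) := Real.exp_le_exp.2
          (mul_le_mul_of_nonneg_left (by linarith) (by positivity))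
        have e₂ : r' ≤ Real.exp (2 * β * field G h z.2 v) := Real.exp_le_exp.2
          (mul_le_mul_of_nonneg_left (by linarith) (by positivity))
        rcases spin_cases z.1 v with ⟨a, e⟩ | ⟨a, e⟩ <;>
          rcases spin_cases z.2 v with ⟨b, e'⟩ | ⟨b, e'⟩
        · exact absurd (a.trans b.symm) hv
        · rw [e, e', metro_one s₁, metro_neg_one s₂]; linarith
        · rw [e, e', metro_neg_one s₁, metro_one s₂]; linarith
        · exact absurd (a.trans b.symm) hv
      have h2 := mul_nonneg (hx0 v) hS
      rw [mul_one]
      linarith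
  refine (Finset.sum_le_sum fun v _ => key v).trans ?_
  rw [Finset.sum_add_distrib, ← Finset.mul_sum, ← discrepancy_eq_sum]
  have := mul_le_mul_of_nonneg_right hκ (discrepancy_nonneg z)
  linarith

end Contraction

end ERGlauber

end

/-! ### Decay of the expected discrepancy. -/

open scoped NNReal Topology

noncomputable section

namespace ERGlauber

open Matrix FiniteMarkov

variable {n : ℕ} {G : SimpleGraph (Fin n)} {p β h m δ ε c lam θ₀ δ₂ κ : ℝ}

lemma exp_discrepancy_le (hβ : 0 ≤ β) (z : Config n × Config n) {t : ℝ} (ht : 0 ≤ t) :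
    (NormedSpace.exp (t • coupledGen G β h) *ᵥ discrepancy) z ≤
      Real.exp (4 * β * t) * discrepancy z := by
  have hQ := isQMatrix_coupledGen G β h
  have h1 := exp_mulVec_le_add (Q := coupledGen G β h) (B := 0)
    (f := fun s => Real.exp (-(4 * β * s)) • discrepancy)
    (f' := fun s => (Real.exp (-(4 * β * s)) * -(4 * β)) • discrepancy) ht
    (fun s _ y => (Uniformized.hasDerivAt_exp_neg_mul (4 * β) s).mul_const _) z
    (fun s hs => by
      rw [← hQ.exp_mulVec_const hs.1 0 z]
      refine hQ.exp_mulVec_mono hs.1 (fun y => ?_) z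
      rw [mulVec_smul, Pi.add_apply, Pi.smul_apply, Pi.smul_apply, smul_eq_mul, smul_eq_mul]
      have := mul_le_mul_of_nonneg_left (coupledGen_discrepancy_le G h y hβ)
        (Real.exp_pos (-(4 * β * s))).le
      linarith)
  simp only [mulVec_smul, exp_zero_smul, one_mulVec, mul_zero, neg_zero, Real.exp_zero, one_smul,
    zero_mul, add_zero, Pi.smul_apply, smul_eq_mul] at h1
  have h2 := mul_le_mul_of_nonneg_left h1 (Real.exp_pos (4 * β * t)).le
  rwa [← mul_assoc, ← Real.exp_add, add_neg_cancel, Real.exp_zero, one_mul] at h2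

/-- Exponential contraction of the disagreement set, up to an exponentially small error. -/
theorem WellConstants.discrepancy_decay (K : WellConstants p β h m δ ε c lam θ₀ δ₂) (hn : 0 < n)
    (hG : Quasirandom G p δ) (hκ0 : 0 ≤ κ) (hneg : p * m + h + (δ₂ + δ) ≤ 0)
    (hκ : 2 * β * Real.exp (2 * β * (p * m + h + (δ₂ + δ))) * ((1 - m) * (p + δ) + δ₂) -
      (1 + Real.exp (2 * β * (p * m + h - (δ₂ + δ)))) ≤ -κ)
    {T : ℝ} (hT0 : 0 ≤ T) (hT : Real.exp (-T) ≤ δ₂ / 8) {z : Config n × Config n}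
    (h₁ : |mag z.1 - m| ≤ ε / 2) (h₂ : |mag z.2 - m| ≤ ε / 2) {t : ℝ}
    (ht : t ∈ Set.Icc (0 : ℝ) (2 * n)) :
    (NormedSpace.exp (t • coupledGen G β h) *ᵥ discrepancy) z ≤
      Real.exp ((4 * β + κ) * T) * Real.exp (-κ * t) * discrepancy z +
        (4 * β + κ) * 680 * (n : ℝ) ^ 7 * Real.exp (-(n * θ₀ * δ₂ / 4)) := by
  have hβ := K.β_nonneg
  have hQ := isQMatrix_coupledGen G β h
  have hd := discrepancy_nonneg z
  have herr : 0 ≤ (4 * β + κ) * 680 * (n : ℝ) ^ 7 * Real.exp (-(n * θ₀ * δ₂ / 4)) := by positivity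
  -- Before `T` the crude growth `e^{4βt}` is at most `e^{(4β+κ)T} e^{-κt}`.
  rcases le_total t T with htT | htT
  · refine (exp_discrepancy_le hβ z ht.1).trans ?_
    rw [← Real.exp_add]
    have : Real.exp (4 * β * t) * discrepancy z ≤
        Real.exp ((4 * β + κ) * T + -κ * t) * discrepancy z := by
      refine mul_le_mul_of_nonneg_right (Real.exp_le_exp.2 ?_) hd
      nlinarith
    linarith
  set η : ℝ := 170 * (n : ℝ) ^ 5 * Real.exp (-(n * θ₀ * δ₂ / 4)) with hη
  have hη0 : 0 ≤ η := by positivity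
  set bad : Config n → ℝ := fun σ => if ∃ w, δ₂ ≤ |localDev G m w σ| then 1 else 0 with hbad
  have hbad0 : ∀ σ, 0 ≤ bad σ := fun σ => by rw [hbad]; dsimp only; split_ifs <;> norm_num
  -- Contraction at rate `κ` holds unless some neighbourhood of one copy is irregular; then the
  -- crude bound and `discrepancy ≤ n` apply.
  have hpt : ∀ y, (coupledGen G β h *ᵥ discrepancy) y + κ * discrepancy y ≤
      (((4 * β + κ) * n) • (bad ∘ Prod.fst + bad ∘ Prod.snd) : Config n × Config n → ℝ) y := by
    intro y
    rw [Pi.smul_apply, Pi.add_apply, Function.comp_apply, Function.comp_apply, smul_eq_mul]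
    have hd0 := discrepancy_nonneg y
    have hb₁ := hbad0 y.1
    have hb₂ := hbad0 y.2
    by_cases hg : (∃ w, δ₂ ≤ |localDev G m w y.1|) ∨ ∃ w, δ₂ ≤ |localDev G m w y.2|
    · have h1 : 1 ≤ bad y.1 + bad y.2 := by
        rcases hg with hg | hg
        · have : bad y.1 = 1 := if_pos hg
          linarith
        · have : bad y.2 = 1 := if_pos hg
          linarith
      have h2 := coupledGen_discrepancy_le G h y hβ
      have h3 := discrepancy_le y
      calc (coupledGen G β h *ᵥ discrepancy) y + κ * discrepancy y
          ≤ (4 * β + κ) * discrepancy y := by linarith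
        _ ≤ (4 * β + κ) * n := by gcongr
        _ ≤ (4 * β + κ) * n * (bad y.1 + bad y.2) := le_mul_of_one_le_right (by positivity) h1
    · push Not at hg
      have h2 := coupledGen_discrepancy_le_of_good h y hβ hG K.abs_m hneg hκ
        (fun w => (hg.1 w).le) fun w => (hg.2 w).le
      have h3 : 0 ≤ (4 * β + κ) * n * (bad y.1 + bad y.2) := by positivity
      linarith
  have htail : ∀ s ∈ Set.Icc T t, (NormedSpace.exp (s • coupledGen G β h) *ᵥ
      (bad ∘ Prod.fst + bad ∘ Prod.snd)) z ≤ 2 * η := by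
    intro s hs
    have hs0 : 0 ≤ s := hT0.trans hs.1
    have hsT : Real.exp (-s) ≤ δ₂ / 8 :=
      (Real.exp_le_exp.2 (neg_le_neg hs.1)).trans hT
    rw [mulVec_add, Pi.add_apply, exp_mulVec_comp (coupledGen_fst G β h) hs0,
      exp_mulVec_comp (coupledGen_snd G β h) hs0, two_mul]
    exact add_le_add (K.localDev_tail hn hG h₁ ⟨hs0, hs.2.trans ht.2⟩ hsT)
      (K.localDev_tail hn hG h₂ ⟨hs0, hs.2.trans ht.2⟩ hsT)
  -- Grönwall for `e^{κs}` times the discrepancy on `[T, t]`, starting from the crude bound at `T`.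
  -- The accumulated error `n · 2η · 2n` yields the 680 and the seventh power.
  have h1 := exp_mulVec_le_add (Q := coupledGen G β h)
    (B := Real.exp (κ * t) * ((4 * β + κ) * n * (2 * η)))
    (f := fun s => Real.exp (κ * s) • discrepancy)
    (f' := fun s => (Real.exp (κ * s) * κ) • discrepancy) htT
    (fun s _ y => by
      have := (((hasDerivAt_id s).const_mul κ).exp).mul_const (discrepancy y)
      simpa using this) z
    (fun s hs => by
      have hs0 : 0 ≤ s := hT0.trans hs.1
      have hle : (NormedSpace.exp (s • coupledGen G β h) *ᵥ
          (coupledGen G β h *ᵥ (Real.exp (κ * s) • discrepancy) +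
            (Real.exp (κ * s) * κ) • discrepancy)) z ≤
          (NormedSpace.exp (s • coupledGen G β h) *ᵥ (Real.exp (κ * s) •
            (((4 * β + κ) * n) • (bad ∘ Prod.fst + bad ∘ Prod.snd)))) z := by
        refine hQ.exp_mulVec_mono hs0 (fun y => ?_) z
        rw [mulVec_smul, Pi.add_apply, Pi.smul_apply, Pi.smul_apply, Pi.smul_apply _ _ y]
        simp only [smul_eq_mul]
        have := mul_le_mul_of_nonneg_left (hpt y) (Real.exp_pos (κ * s)).le
        linarith
      refine hle.trans ?_
      rw [mulVec_smul, mulVec_smul, Pi.smul_apply, Pi.smul_apply, smul_eq_mul, smul_eq_mul]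
      have := htail s hs
      have h2 : Real.exp (κ * s) ≤ Real.exp (κ * t) :=
        Real.exp_le_exp.2 (mul_le_mul_of_nonneg_left hs.2 hκ0)
      calc _ ≤ Real.exp (κ * s) * ((4 * β + κ) * n * (2 * η)) := by gcongr
        _ ≤ _ := by gcongr)
  simp only [mulVec_smul, Pi.smul_apply, smul_eq_mul] at h1
  have h2 := exp_discrepancy_le (G := G) (h := h) hβ z hT0
  have h3 : Real.exp (-κ * t) * Real.exp (κ * t) = 1 := by
    rw [← Real.exp_add]; simp
  have h4 : Real.exp (κ * T) * Real.exp (4 * β * T) = Real.exp ((4 * β + κ) * T) := by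
    rw [← Real.exp_add]; ring_nf
  calc (NormedSpace.exp (t • coupledGen G β h) *ᵥ discrepancy) z
      = Real.exp (-κ * t) *
        (Real.exp (κ * t) * (NormedSpace.exp (t • coupledGen G β h) *ᵥ discrepancy) z) := by
        rw [← mul_assoc, h3, one_mul]
    _ ≤ Real.exp (-κ * t) * (Real.exp (κ * T) * (Real.exp (4 * β * T) * discrepancy z) +
        Real.exp (κ * t) * ((4 * β + κ) * n * (2 * η)) * (2 * n)) := by
        refine mul_le_mul_of_nonneg_left (h1.trans (add_le_add ?_ ?_)) (Real.exp_pos _).le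
        · exact mul_le_mul_of_nonneg_left h2 (Real.exp_pos _).le
        · exact mul_le_mul_of_nonneg_left (by linarith [ht.2]) (by positivity)
    _ = (Real.exp (κ * T) * Real.exp (4 * β * T)) * Real.exp (-κ * t) * discrepancy z +
        (Real.exp (-κ * t) * Real.exp (κ * t)) * ((4 * β + κ) * n * (2 * η) * (2 * n)) := by ring
    _ = _ := by rw [h3, h4, hη]; ring

end ERGlauber

end

open scoped NNReal Topology

noncomputable section

namespace ERGlauber

open MeasureTheory ProbabilityTheory

variable {n : ℕ}

/-! ### The random graph is quasirandom -/

/-- Apply `e^y ≤ 1 + y + y²` at both values; the linear terms cancel by centring. -/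
lemma bernoulli_mgf_le {p a : ℝ} (hp : p ∈ Set.Icc (0 : ℝ) 1) (ha : |a| ≤ 1) :
    p * Real.exp (a * (1 - p)) + (1 - p) * Real.exp (a * (0 - p)) ≤ Real.exp (a ^ 2) := by
  have key : ∀ y : ℝ, |y| ≤ |a| → Real.exp y ≤ 1 + y + a ^ 2 := by
    intro y hy
    have h1 := (abs_le.1 (Real.abs_exp_sub_one_sub_id_le (hy.trans ha))).2
    have h2 : y ^ 2 ≤ a ^ 2 := sq_le_sq.2 hy
    linarith
  have h1 := key (a * (1 - p)) (by
    rw [abs_mul, abs_of_nonneg (sub_nonneg.2 hp.2)]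
    exact mul_le_of_le_one_right (abs_nonneg _) (by linarith [hp.1]))
  have h2 := key (a * (0 - p)) (by
    rw [zero_sub, abs_mul, abs_neg, abs_of_nonneg hp.1]
    exact mul_le_of_le_one_right (abs_nonneg _) hp.2)
  have h3 := mul_le_mul_of_nonneg_left h1 hp.1
  have h4 := mul_le_mul_of_nonneg_left h2 (sub_nonneg.2 hp.2)
  have h5 := Real.add_one_le_exp (a ^ 2)
  linarith

open Classical in
/-- The indicator of an edge, centred under the binomial law. -/
def centredEdge (p : ℝ) (G : SimpleGraph (Fin n)) (e : Sym2 (Fin n)) : ℝ :=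
  (if e ∈ G.edgeSet then 1 else 0) - if e.IsDiag then 0 else p

lemma measurable_centredEdge (p : ℝ) (e : Sym2 (Fin n)) :
    Measurable fun G : SimpleGraph (Fin n) => centredEdge p G e := by
  classical
  refine Measurable.sub (Measurable.ite ?_ measurable_const measurable_const) measurable_const
  exact measurableSet_setOfPred.2 (measurable_set_iff.1 SimpleGraph.measurable_edgeSet e)

lemma abs_centredEdge_le {p : ℝ} (hp : p ∈ Set.Icc (0 : ℝ) 1) (G : SimpleGraph (Fin n))
    (e : Sym2 (Fin n)) : |centredEdge p G e| ≤ 1 := by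
  unfold centredEdge
  rw [abs_le]
  split_ifs <;> constructor <;> linarith [hp.1, hp.2]

/-- The graph is the image of independent indicators on all of `Sym2`, so the integral factorizes;
diagonal pairs are discarded by `fromEdgeSet` and contribute a factor 1. -/
lemma integral_exp_centredEdge_le (p : unitInterval) {a : Sym2 (Fin n) → ℝ}
    (ha : ∀ e, |a e| ≤ 1) :
    ∫ G, Real.exp (∑ e, a e * centredEdge p G e) ∂SimpleGraph.binomialRandom (Fin n) p ≤
      Real.exp (∑ e, a e ^ 2) := by
  classical
  have hm : Measurable fun G : SimpleGraph (Fin n) =>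
      Real.exp (∑ e, a e * centredEdge p G e) :=
    (Finset.measurable_sum _ fun e _ => (measurable_centredEdge p e).const_mul _).exp
  set g : Sym2 (Fin n) → Prop → ℝ := fun e x =>
    Real.exp (a e * ((if x ∧ ¬ e.IsDiag then 1 else 0) - if e.IsDiag then 0 else (p : ℝ))) with hg
  have hs : Measurable fun q : Sym2 (Fin n) → Prop => {i | q i} :=
    MeasurableEquiv.setOfPred.measurable
  rw [SimpleGraph.binomialRandom_eq_map, setBernoulli_eq_map,
    Measure.map_map SimpleGraph.measurable_fromEdgeSet hs,
    integral_map (SimpleGraph.measurable_fromEdgeSet.comp hs).aemeasurable hm.aestronglyMeasurable,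
    Measure.infinitePi_eq_pi]
  have e1 : ∀ ω : Sym2 (Fin n) → Prop, Real.exp (∑ e, a e * centredEdge p
      ((SimpleGraph.fromEdgeSet ∘ fun q : Sym2 (Fin n) → Prop => {i | q i}) ω) e)
      = ∏ e, g e (ω e) := by
    intro ω
    rw [Real.exp_sum]
    refine Finset.prod_congr rfl fun e _ => ?_
    simp only [hg, centredEdge, Function.comp_apply, SimpleGraph.edgeSet_fromEdgeSet,
      Set.mem_sdiff, Set.mem_ofPred_eq, Sym2.mem_diagSet]
  simp only [e1]
  rw [integral_fintype_prod_eq_prod (𝕜 := ℝ) g, Real.exp_sum]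
  refine Finset.prod_le_prod (fun e _ => integral_nonneg fun x => (Real.exp_pos _).le)
    fun e _ => ?_
  rw [integral_add_measure .of_finite .of_finite, integral_smul_nnreal_measure,
    integral_smul_nnreal_measure, integral_dirac, integral_dirac]
  have hp1 : ((unitInterval.toNNReal p : ℝ≥0) : ℝ) = p := rfl
  have hp2 : ((unitInterval.toNNReal (unitInterval.symm p) : ℝ≥0) : ℝ) = 1 - p := rfl
  rw [NNReal.smul_def, NNReal.smul_def, hp1, hp2, smul_eq_mul, smul_eq_mul]
  by_cases hd : e.IsDiag
  · simp only [hg, Set.mem_compl_iff, Sym2.mem_diagSet, hd, not_true, and_false, if_false, if_true,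
      sub_zero, mul_zero, Real.exp_zero, mul_one, add_sub_cancel]
    exact Real.one_le_exp (sq_nonneg _)
  · simp only [hg, Set.mem_compl_iff, Sym2.mem_diagSet, hd, not_false_eq_true, and_true, if_false,
      if_true]
    exact bernoulli_mgf_le p.2 (ha e)

/-- Chernoff bound for a linear form in the edges of the binomial random graph. -/
lemma binomialRandom_linear_tail (p : unitInterval) {c : Fin n → Fin n → ℝ}
    (hc : ∀ v w, |c v w| ≤ 1) {S x θ : ℝ} (hS : ∑ v, ∑ w, |c v w| ≤ S) (hθ0 : 0 ≤ θ)
    (hθ : θ ≤ 1 / 2) :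
    (SimpleGraph.binomialRandom (Fin n) p).real
        {G | x ≤ ∑ v, ∑ w, c v w * (adj G v w - if v = w then 0 else (p : ℝ))} ≤
      Real.exp (2 * θ ^ 2 * S - θ * x) := by
  classical
  -- The entries at `(v, w)` and `(w, v)` are the same random variable; `b` collects the at most two
  -- coefficients of each edge. Hence `|b| ≤ 2` and `b² ≤ 2|b|`, the source of the factor 2 in the
  -- exponent.
  set b : Sym2 (Fin n) → ℝ := fun e =>
    ∑ q ∈ (Finset.univ : Finset (Fin n × Fin n)).filter (fun q => s(q.1, q.2) = e), c q.1 q.2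
    with hb
  have hfib : ∀ e, ((Finset.univ : Finset (Fin n × Fin n)).filter
      (fun q => s(q.1, q.2) = e)).card ≤ 2 := by
    intro e
    induction e with | _ v w => ?_
    refine (Finset.card_le_card (t := {(v, w), (w, v)}) fun q hq => ?_).trans Finset.card_le_two
    obtain ⟨x, y⟩ := q
    simp only [Finset.mem_filter, Finset.mem_univ, true_and, Sym2.eq_iff] at hq
    simp only [Finset.mem_insert, Finset.mem_singleton, Prod.mk.injEq]
    exact hq
  have hb2 : ∀ e, |b e| ≤ 2 := by
    intro e
    refine (Finset.abs_sum_le_sum_abs _ _).trans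
      ((Finset.sum_le_card_nsmul _ _ 1 fun q _ => hc q.1 q.2).trans ?_)
    rw [nsmul_eq_mul, mul_one]
    exact_mod_cast hfib e
  have hbS : ∑ e, |b e| ≤ S := by
    refine le_trans (Finset.sum_le_sum fun e _ => Finset.abs_sum_le_sum_abs _ _) ?_
    rw [Finset.sum_fiberwise (Finset.univ : Finset (Fin n × Fin n)) (fun q => s(q.1, q.2))
      fun q => |c q.1 q.2|, Fintype.sum_prod_type]
    exact hS
  have hlin : ∀ G : SimpleGraph (Fin n),
      ∑ v, ∑ w, c v w * (adj G v w - if v = w then 0 else (p : ℝ)) =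
        ∑ e, b e * centredEdge p G e := by
    intro G
    rw [← Fintype.sum_prod_type fun q : Fin n × Fin n =>
      c q.1 q.2 * (adj G q.1 q.2 - if q.1 = q.2 then 0 else (p : ℝ)),
      ← Finset.sum_fiberwise (Finset.univ : Finset (Fin n × Fin n)) fun q => s(q.1, q.2)]
    refine Finset.sum_congr rfl fun e _ => ?_
    rw [hb, Finset.sum_mul]
    refine Finset.sum_congr rfl fun q hq => ?_
    rw [← (Finset.mem_filter.1 hq).2]
    simp [centredEdge, adj]
  have hm : Measurable fun G : SimpleGraph (Fin n) => ∑ e, b e * centredEdge p G e :=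
    Finset.measurable_sum _ fun e _ => (measurable_centredEdge p e).const_mul _
  have hint : Integrable (fun G : SimpleGraph (Fin n) =>
      Real.exp (θ * ∑ e, b e * centredEdge p G e)) (SimpleGraph.binomialRandom (Fin n) p) := by
    refine Integrable.of_bound (hm.const_mul θ).exp.aestronglyMeasurable (Real.exp (θ * S))
      (ae_of_all _ fun G => ?_)
    rw [Real.norm_of_nonneg (Real.exp_pos _).le]
    refine Real.exp_le_exp.2 (mul_le_mul_of_nonneg_left (le_trans ?_ hbS) hθ0)
    refine Finset.sum_le_sum fun e _ => (le_abs_self _).trans ?_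
    rw [abs_mul]
    exact mul_le_of_le_one_right (abs_nonneg _) (abs_centredEdge_le p.2 G e)
  simp only [hlin]
  refine (measure_ge_le_exp_mul_mgf x hθ0 hint).trans ?_
  have h1 : mgf (fun G : SimpleGraph (Fin n) => ∑ e, b e * centredEdge p G e)
      (SimpleGraph.binomialRandom (Fin n) p) θ ≤ Real.exp (2 * θ ^ 2 * S) := by
    have h2 := integral_exp_centredEdge_le p (a := fun e => θ * b e) (fun e => by
      rw [abs_mul, abs_of_nonneg hθ0]
      calc θ * |b e| ≤ 1 / 2 * 2 := mul_le_mul hθ (hb2 e) (abs_nonneg _) (by norm_num)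
        _ = 1 := by norm_num)
    rw [mgf]
    simp only [Finset.mul_sum, ← mul_assoc]
    refine h2.trans (Real.exp_le_exp.2 ?_)
    calc ∑ e, (θ * b e) ^ 2 ≤ ∑ e, 2 * θ ^ 2 * |b e| := by
          refine Finset.sum_le_sum fun e _ => ?_
          have : b e ^ 2 ≤ 2 * |b e| := by
            rw [← sq_abs, sq]
            exact mul_le_mul_of_nonneg_right (hb2 e) (abs_nonneg _)
          have := mul_le_mul_of_nonneg_left this (sq_nonneg θ)
          linarith
      _ = 2 * θ ^ 2 * ∑ e, |b e| := by rw [Finset.mul_sum]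
      _ ≤ _ := mul_le_mul_of_nonneg_left hbS (by positivity)
  calc _ ≤ Real.exp (-θ * x) * Real.exp (2 * θ ^ 2 * S) :=
        mul_le_mul_of_nonneg_left h1 (Real.exp_pos _).le
    _ = _ := by rw [← Real.exp_add]; ring_nf

end ERGlauber

end

open scoped NNReal Topology

noncomputable section

namespace ERGlauber

open MeasureTheory ProbabilityTheory

variable {n : ℕ}

/-- An `ℓ¹`-norm is a maximum over sign vectors, so both requirements become finitely many linear
inequalities in the edges. The hypothesis `hn` pays, with the other half of `δ`, for the mean `p`
missing on the diagonal. -/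
lemma quasirandom_of_lt {G : SimpleGraph (Fin n)} {p δ : ℝ} (hp : p ∈ Set.Icc (0 : ℝ) 1)
    (hn : 1 ≤ δ / 2 * n)
    (hdeg : ∀ (w : Fin n) (s : ℤˣ), ∑ v, ∑ u, (if v = w then ((s : ℤ) : ℝ) else 0) *
      (adj G v u - if v = u then 0 else p) < δ / 2 * n)
    (hdisc : ∀ τ σ : Config n, ∑ v, ∑ w, spin τ v * spin σ w *
      (adj G v w - if v = w then 0 else p) < δ / 2 * (n : ℝ) ^ 2) :
    Quasirandom G p δ where
  degree w := by
    have e : ∀ s : ℤˣ, ∑ v, ∑ u, (if v = w then ((s : ℤ) : ℝ) else 0) *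
        (adj G v u - if v = u then 0 else p) =
        (s : ℤ) * (∑ v, adj G w v - p * n + p) := by
      intro s
      rw [Finset.sum_eq_single w]
      · have : ∀ u, (if w = u then 0 else p) = p - if w = u then p else 0 := by
          intro u; split_ifs <;> ring
        simp only [if_true, ← Finset.mul_sum, this]
        simp only [sub_sub_eq_add_sub, Finset.sum_sub_distrib, Finset.sum_add_distrib,
          Finset.sum_ite_eq, Finset.mem_univ, if_true, Finset.sum_const, Finset.card_univ,
          Fintype.card_fin, nsmul_eq_mul]
        ring
      · intro v _ hv; simp [hv]
      · simp
    have h1 := hdeg w 1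
    have h2 := hdeg w (-1)
    rw [e] at h1 h2
    push_cast at h1 h2
    have := hp.1
    have := hp.2
    rw [abs_le]
    constructor <;> linarith
  discrepancy σ := by
    set τ : Config n := fun v => if 0 ≤ ∑ w, (adj G v w - p) * spin σ w then 1 else -1 with hτ
    have h1 : ∀ v, |∑ w, (adj G v w - p) * spin σ w| =
        spin τ v * ∑ w, (adj G v w - p) * spin σ w := by
      intro v
      by_cases hv : 0 ≤ ∑ w, (adj G v w - p) * spin σ w
      · have ht : τ v = 1 := if_pos hv
        have : spin τ v = 1 := by simp [spin, ht]
        rw [this, one_mul, abs_of_nonneg hv]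
      · have ht : τ v = -1 := if_neg hv
        have : spin τ v = -1 := by simp [spin, ht]
        rw [this, abs_of_neg (not_le.1 hv)]; ring
    have h2 : ∑ v, spin τ v * ∑ w, (adj G v w - p) * spin σ w =
        ∑ v, ∑ w, spin τ v * spin σ w * (adj G v w - if v = w then 0 else p) -
          p * ∑ v, spin τ v * spin σ v := by
      rw [Finset.mul_sum, ← Finset.sum_sub_distrib]
      refine Finset.sum_congr rfl fun v _ => ?_
      have h3 : p * (spin τ v * spin σ v) =
          ∑ w, if v = w then p * (spin τ v * spin σ w) else 0 := by simp
      rw [h3, Finset.mul_sum, ← Finset.sum_sub_distrib]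
      refine Finset.sum_congr rfl fun w _ => ?_
      split_ifs <;> ring
    have h3 : -(p * ∑ v, spin τ v * spin σ v) ≤ n := by
      have h4 : |∑ v, spin τ v * spin σ v| ≤ n :=
        (Finset.abs_sum_le_sum_abs _ _).trans (by simp [abs_mul, abs_spin])
      refine (neg_le_abs _).trans ?_
      rw [abs_mul, abs_of_nonneg hp.1]
      calc p * |∑ v, spin τ v * spin σ v| ≤ 1 * n :=
            mul_le_mul hp.2 h4 (abs_nonneg _) zero_le_one
        _ = n := one_mul _
    have h4 := mul_le_mul_of_nonneg_right hn (Nat.cast_nonneg (α := ℝ) n)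
    rw [Finset.sum_congr rfl fun v _ => h1 v, h2]
    have h5 := hdisc τ σ
    nlinarith

lemma not_quasirandom_le (p : unitInterval) {δ : ℝ} (hδ0 : 0 < δ) (hδ : δ ≤ 1)
    (hn : 1 ≤ δ / 2 * n) :
    (SimpleGraph.binomialRandom (Fin n) p).real {G | ¬ Quasirandom G p δ} ≤
      2 * n * Real.exp (-(δ ^ 2 / 32 * n)) +
        (2 : ℝ) ^ n * 2 ^ n * Real.exp (-(δ ^ 2 / 32 * (n : ℝ) ^ 2)) := by
  set μ := SimpleGraph.binomialRandom (Fin n) p with hμ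
  set A : Fin n × ℤˣ → Set (SimpleGraph (Fin n)) := fun q =>
    {G | δ / 2 * n ≤ ∑ v, ∑ u, (if v = q.1 then ((q.2 : ℤ) : ℝ) else 0) *
      (adj G v u - if v = u then 0 else (p : ℝ))} with hA
  set B : Config n × Config n → Set (SimpleGraph (Fin n)) := fun q =>
    {G | δ / 2 * (n : ℝ) ^ 2 ≤ ∑ v, ∑ w, spin q.1 v * spin q.2 w *
      (adj G v w - if v = w then 0 else (p : ℝ))} with hB
  have hsub : {G | ¬ Quasirandom G p δ} ⊆ (⋃ q, A q) ∪ ⋃ q, B q := by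
    intro G hG
    by_contra hcon
    simp only [Set.mem_union, Set.mem_iUnion, not_or, not_exists] at hcon
    exact hG (quasirandom_of_lt p.2 hn (fun w s => not_le.1 (hcon.1 (w, s)))
      fun τ σ => not_le.1 (hcon.2 (τ, σ)))
  have hAq : ∀ q, μ.real (A q) ≤ Real.exp (-(δ ^ 2 / 32 * n)) := by
    intro q
    have hq : |((q.2 : ℤ) : ℝ)| = 1 := by
      rcases Int.units_eq_one_or q.2 with h | h <;> simp [h]
    -- With `θ = δ/8` and threshold `δS/2` the exponent is `2θ²S - θδS/2 = -δ²S/32`, here for `S =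
    -- n` and below for `S = n²`.
    refine (binomialRandom_linear_tail p
      (c := fun v _ => if v = q.1 then ((q.2 : ℤ) : ℝ) else 0) (S := n) (θ := δ / 8)
      (fun v w => ?_) ?_ (by positivity) (by linarith)).trans
      (Real.exp_le_exp.2 (le_of_eq (by ring)))
    · split_ifs
      · exact hq.le
      · simp
    · rw [Finset.sum_eq_single q.1]
      · simp [hq]
      · intro v _ hv; simp [hv]
      · simp
  have hBq : ∀ q, μ.real (B q) ≤ Real.exp (-(δ ^ 2 / 32 * (n : ℝ) ^ 2)) := by
    intro q
    refine (binomialRandom_linear_tail p (c := fun v w => spin q.1 v * spin q.2 w)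
      (S := (n : ℝ) ^ 2) (θ := δ / 8) (fun v w => ?_) ?_ (by positivity) (by linarith)).trans
      (Real.exp_le_exp.2 (le_of_eq (by ring)))
    · rw [abs_mul, abs_spin, abs_spin, mul_one]
    · simp [abs_mul, abs_spin, sq]
  calc μ.real {G | ¬ Quasirandom G p δ} ≤ μ.real ((⋃ q, A q) ∪ ⋃ q, B q) :=
        measureReal_mono hsub
    _ ≤ μ.real (⋃ q, A q) + μ.real (⋃ q, B q) := measureReal_union_le _ _
    _ ≤ ∑ q, μ.real (A q) + ∑ q, μ.real (B q) :=
        add_le_add (measureReal_iUnion_fintype_le A) (measureReal_iUnion_fintype_le B)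
    _ ≤ ∑ _q : Fin n × ℤˣ, Real.exp (-(δ ^ 2 / 32 * n)) +
        ∑ _q : Config n × Config n, Real.exp (-(δ ^ 2 / 32 * (n : ℝ) ^ 2)) :=
        add_le_add (Finset.sum_le_sum fun q _ => hAq q) (Finset.sum_le_sum fun q _ => hBq q)
    _ = _ := by
        simp [Config]
        ring

lemma tendsto_not_quasirandom (p : unitInterval) {δ : ℝ} (hδ0 : 0 < δ) (hδ : δ ≤ 1) :
    Filter.Tendsto
      (fun n : ℕ => (SimpleGraph.binomialRandom (Fin n) p).real {G | ¬ Quasirandom G p δ})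
      Filter.atTop (𝓝 0) := by
  have ha : 0 < δ ^ 2 / 32 := by positivity
  set a : ℝ := δ ^ 2 / 32 with hadef
  have h1 : Filter.Tendsto (fun n : ℕ => 2 * (n : ℝ) * Real.exp (-(a * n))) Filter.atTop (𝓝 0) := by
    have h := (Real.tendsto_pow_mul_exp_neg_atTop_nhds_zero 1).comp
      ((tendsto_natCast_atTop_atTop (R := ℝ)).const_mul_atTop ha)
    have h2 := h.const_mul (2 / a)
    rw [mul_zero] at h2
    refine h2.congr fun n => ?_
    simp only [Function.comp_apply, pow_one]
    field_simp
  have h2 : Filter.Tendsto (fun n : ℕ => Real.exp (-(n : ℝ))) Filter.atTop (𝓝 0) :=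
    Real.tendsto_exp_neg_atTop_nhds_zero.comp tendsto_natCast_atTop_atTop
  have h12 := h1.add h2
  rw [add_zero] at h12
  refine tendsto_of_tendsto_of_tendsto_of_le_of_le' tendsto_const_nhds h12
    (Filter.Eventually.of_forall fun n => measureReal_nonneg) ?_
  have hev : ∀ C : ℝ, ∀ᶠ n : ℕ in Filter.atTop, C ≤ n := fun C =>
    tendsto_natCast_atTop_atTop.eventually_ge_atTop C
  filter_upwards [hev (2 / δ), hev (3 / a)] with n hn1 hn2
  have hn1' : 1 ≤ δ / 2 * n := by
    rw [div_le_iff₀ hδ0] at hn1; linarith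
  have hn2' : 3 ≤ a * n := by
    rw [div_le_iff₀ ha] at hn2; linarith
  -- Once `an ≥ 3`, the union bound costs at most `e^{2n}` against `e^{-an²} ≤ e^{-3n}`.
  refine (not_quasirandom_le p hδ0 hδ hn1').trans (add_le_add le_rfl ?_)
  have h3 : (2 : ℝ) ^ n ≤ Real.exp n := by
    rw [← Real.exp_one_pow]
    exact pow_le_pow_left₀ (by norm_num) (by linarith [Real.add_one_le_exp (1 : ℝ)]) n
  calc (2 : ℝ) ^ n * 2 ^ n * Real.exp (-(a * (n : ℝ) ^ 2))
      ≤ Real.exp n * Real.exp n * Real.exp (-(a * (n : ℝ) ^ 2)) := by gcongr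
    _ = Real.exp (n + n + -(a * (n : ℝ) ^ 2)) := by rw [Real.exp_add, Real.exp_add]
    _ ≤ Real.exp (-n) := by
        refine Real.exp_le_exp.2 ?_
        have := mul_le_mul_of_nonneg_right hn2' (Nat.cast_nonneg (α := ℝ) n)
        nlinarith

end ERGlauber

end

open scoped NNReal Topology

noncomputable section

namespace ERGlauber

/-! ### The zeros of `J` -/

lemma hasDerivAt_J (p β h : ℝ) {a : ℝ} (ha : a ∈ Set.Ioo (-1 : ℝ) 1) :
    HasDerivAt (J p β h) (2 * β * p - 2 / (1 - a ^ 2)) a := by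
  have h1 : 0 < 1 - a := by linarith [ha.2]
  have h2 : 0 < 1 + a := by linarith [ha.1]
  have hd : HasDerivAt (fun a : ℝ => (1 - a) / (1 + a))
      ((-1 * (1 + a) - (1 - a) * 1) / (1 + a) ^ 2) a :=
    ((hasDerivAt_id a).const_sub 1).div ((hasDerivAt_id a).const_add 1) h2.ne'
  have hl := hd.log (div_pos h1 h2).ne'
  have h3 := ((((hasDerivAt_id a).const_mul p).add_const h).const_mul (2 * β)).add hl
  refine h3.congr_deriv ?_
  have h4 : 1 - a ^ 2 = (1 - a) * (1 + a) := by ring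
  rw [h4]
  field_simp
  ring

/-- The first zero of `J`: `J` is strictly decreasing on `(-1, b]` with `b < 0`, and changes sign
at `m`. -/
lemma exists_first_zero {p β h : ℝ} (hp : p ∈ Set.Ioo (0 : ℝ) 1) (hmeta : Metastable p β h) :
    ∃ m b : ℝ, -1 < m ∧ m < b ∧ b < 0 ∧ J p β h m = 0 ∧
      StrictAntiOn (J p β h) (Set.Ioc (-1) b) ∧ β * p < 1 / (1 - m ^ 2) := by
  obtain ⟨h1, h2, h3⟩ := hmeta
  have hp0 := hp.1
  have hl : 1 < β * p := by rwa [div_lt_iff₀ hp0] at h1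
  have hβ : 0 < β := lt_trans (by positivity) h1
  have hl0 : 0 < β * p := by positivity
  have hinv : 1 / (β * p) < 1 := by rw [div_lt_one hl0]; exact hl
  have hinv0 : 0 < 1 / (β * p) := by positivity
  set s : ℝ := √(1 - 1 / (β * p)) with hs
  have hs2 : s ^ 2 = 1 - 1 / (β * p) := Real.sq_sqrt (by linarith)
  have hs0 : 0 < s := Real.sqrt_pos.2 (by linarith)
  have hs1 : s < 1 := by nlinarith
  have hls : β * p * (1 - s ^ 2) = 1 := by rw [hs2]; field_simp; ring
  -- `-s` is the left critical point of `J`, and this is where the upper bound on `h` is used: it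
  -- says precisely that `J` is negative there.
  have hJs : J p β h (-s) < 0 := by
    have e1 : (1 - -s) / (1 + -s) = β * p * (1 + s) ^ 2 := by
      have : 1 + -s ≠ 0 := by linarith
      rw [div_eq_iff this]
      have : β * p * (1 + s) ^ 2 * (1 + -s) = β * p * (1 - s ^ 2) * (1 + s) := by ring
      rw [this, hls]; ring
    have e2 : 2 * β * (p * chi (β * p)) =
        2 * β * p * s - Real.log (β * p * (1 + s) ^ 2) := by
      rw [chi, ← hs]; field_simp
    have e3 := mul_lt_mul_of_pos_left h3 (by positivity : 0 < 2 * β)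
    rw [J, e1]
    linarith
  have hanti : StrictAntiOn (J p β h) (Set.Ioc (-1) (-s)) := by
    refine strictAntiOn_of_deriv_neg (convex_Ioc _ _) (fun a ha =>
      (hasDerivAt_J p β h ⟨ha.1, by linarith [ha.2]⟩).continuousAt.continuousWithinAt) ?_
    intro a ha
    rw [interior_Ioc] at ha
    rw [(hasDerivAt_J p β h ⟨ha.1, by linarith [ha.2]⟩).deriv]
    have h4 : s ^ 2 < a ^ 2 := by nlinarith [ha.2]
    have h5 : 0 < 1 - a ^ 2 := by nlinarith [ha.1, ha.2]
    have h6 : β * p < 1 / (1 - a ^ 2) := by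
      rw [lt_div_iff₀ h5, ← hls]
      exact mul_lt_mul_of_pos_left (by linarith) hl0
    have : 2 / (1 - a ^ 2) = 2 * (1 / (1 - a ^ 2)) := by ring
    linarith
  -- So close to `-1` the logarithm, at least `log (1/t) ≥ 2βp + 1`, outweighs the linear part, at
  -- least `-2βp`.
  set t : ℝ := min (Real.exp (-(2 * β * p + 1))) ((1 - s) / 2) with ht
  have ht0 : 0 < t := lt_min (Real.exp_pos _) (by linarith)
  have hts : t ≤ (1 - s) / 2 := min_le_right _ _
  have hJt : 0 < J p β h (-1 + t) := by
    have e1 : 1 / t ≤ (1 - (-1 + t)) / (1 + (-1 + t)) := by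
      rw [add_neg_cancel_left]
      exact div_le_div_of_nonneg_right (by linarith) ht0.le
    have e2 : 2 * β * p + 1 ≤ Real.log (1 / t) := by
      rw [one_div, Real.log_inv]
      have := Real.log_le_log ht0 (min_le_left _ _ : t ≤ Real.exp (-(2 * β * p + 1)))
      rw [Real.log_exp] at this
      linarith
    have e3 := Real.log_le_log (by positivity) e1
    rw [J]
    have e4 : 0 ≤ 2 * β * (p * t + h) := by positivity
    linarith
  have hcont : ContinuousOn (J p β h) (Set.Icc (-1 + t) (-s)) := fun a ha =>
    (hasDerivAt_J p β h ⟨by linarith [ha.1], by linarith [ha.2]⟩).continuousAt.continuousWithinAt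
  obtain ⟨m, hm, hm0⟩ := intermediate_value_Ioo' (by linarith : -1 + t ≤ -s) hcont
    (⟨hJs, hJt⟩ : (0 : ℝ) ∈ Set.Ioo _ _)
  refine ⟨m, -s, by linarith [hm.1], hm.2, by linarith, hm0, hanti, ?_⟩
  have h4 : s ^ 2 < m ^ 2 := by nlinarith [hm.2]
  have h5 : 0 < 1 - m ^ 2 := by nlinarith [hm.1, hm.2]
  rw [lt_div_iff₀ h5, ← hls]
  exact mul_lt_mul_of_pos_left (by linarith) hl0

/-! ### The lattice version `J_n` -/

/-- Telescoping `log ((j+2)/(j+1)) ≤ 1/(j+1)`. With its companion below it sandwiches the harmonic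
differences in `Jn_grid`. -/
lemma log_le_harmonic_sub {k N : ℕ} (hkN : k ≤ N) :
    Real.log ((N + 1) / (k + 1)) ≤ (harmonic N : ℝ) - harmonic k := by
  induction N, hkN using Nat.le_induction with
  | base => simp [div_self (by positivity : (k : ℝ) + 1 ≠ 0)]
  | succ N hN ih =>
    have h1 : Real.log ((N + 1 + 1) / (N + 1)) ≤ 1 / ((N : ℝ) + 1) := by
      refine (Real.log_le_sub_one_of_pos (by positivity)).trans (le_of_eq ?_)
      field_simp; ring
    have h2 : Real.log (((N + 1 : ℕ) + 1) / (k + 1)) =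
        Real.log ((N + 1) / (k + 1)) + Real.log ((N + 1 + 1) / ((N : ℝ) + 1)) := by
      rw [← Real.log_mul (by positivity) (by positivity)]
      congr 1; push_cast; field_simp
    rw [h2, harmonic_succ]
    push_cast
    rw [one_div] at h1
    linarith

lemma harmonic_sub_le_log {k N : ℕ} (hk : 0 < k) (hkN : k ≤ N) :
    (harmonic N : ℝ) - harmonic k ≤ Real.log (N / k) := by
  have hk' : (0 : ℝ) < k := Nat.cast_pos.2 hk
  induction N, hkN using Nat.le_induction with
  | base => simp [div_self hk'.ne']
  | succ N hN ih =>
    have hN' : (0 : ℝ) < N := Nat.cast_pos.2 (lt_of_lt_of_le hk hN)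
    have h1 : 1 / ((N : ℝ) + 1) ≤ Real.log ((N + 1) / N) := by
      refine le_trans (le_of_eq ?_) (Real.one_sub_inv_le_log_of_pos (by positivity))
      field_simp; ring
    have h2 : Real.log (((N + 1 : ℕ) : ℝ) / k) =
        Real.log (N / k) + Real.log ((N + 1) / N) := by
      rw [← Real.log_mul (by positivity) (by positivity)]
      congr 1; push_cast; field_simp
    rw [h2, harmonic_succ]
    push_cast
    rw [one_div] at h1
    linarith

/-- The logarithmic derivative of Gamma at `k + 1` is the `k`-th harmonic number minus Euler's
constant, which cancels between the two Gamma factors. -/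
lemma Jn_grid (p β h : ℝ) {n k : ℕ} (hn : 0 < n) (hk : k ≤ n) :
    Jn p β h n (-1 + 2 * (k : ℝ) / n) =
      2 * β * (p * (-1 + 2 * (k : ℝ) / n) + h) + ((harmonic (n - k) : ℝ) - harmonic k) := by
  have hn' : (n : ℝ) ≠ 0 := (Nat.cast_pos.2 hn).ne'
  set a : ℝ := -1 + 2 * (k : ℝ) / n with ha
  have hA : (1 + a) / 2 * n + 1 = k + 1 := by rw [ha]; field_simp; ring
  have hB : (1 - a) / 2 * n + 1 = ((n - k : ℕ) : ℝ) + 1 := by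
    rw [ha, Nat.cast_sub hk]; field_simp; ring
  have dA : HasDerivAt (fun a : ℝ => (1 + a) / 2 * n + 1) (1 / 2 * n) a :=
    ((((hasDerivAt_id a).const_add 1).div_const 2).mul_const (n : ℝ)).add_const 1
  have dB : HasDerivAt (fun a : ℝ => (1 - a) / 2 * n + 1) (-1 / 2 * n) a :=
    ((((hasDerivAt_id a).const_sub 1).div_const 2).mul_const (n : ℝ)).add_const 1
  have gA := HasDerivAt.comp a (hA ▸ Real.hasDerivAt_Gamma_nat k) dA
  have gB := HasDerivAt.comp a (hB ▸ Real.hasDerivAt_Gamma_nat (n - k)) dB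
  have eA : Real.Gamma ((1 + a) / 2 * n + 1) = k.factorial := by
    rw [hA, Real.Gamma_nat_eq_factorial]
  have eB : Real.Gamma ((1 - a) / 2 * n + 1) = (n - k).factorial := by
    rw [hB, Real.Gamma_nat_eq_factorial]
  have fA : (k.factorial : ℝ) ≠ 0 := Nat.cast_ne_zero.2 (Nat.factorial_ne_zero _)
  have fB : ((n - k).factorial : ℝ) ≠ 0 := Nat.cast_ne_zero.2 (Nat.factorial_ne_zero _)
  have fN : Real.Gamma ((n : ℝ) + 1) ≠ 0 := by
    rw [Real.Gamma_nat_eq_factorial]; exact Nat.cast_ne_zero.2 (Nat.factorial_ne_zero _)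
  have hAB : (Real.Gamma ∘ fun a : ℝ => (1 + a) / 2 * n + 1) a *
      (Real.Gamma ∘ fun a : ℝ => (1 - a) / 2 * n + 1) a ≠ 0 := by
    simp only [Function.comp_apply, eA, eB]; exact mul_ne_zero fA fB
  have hd := (((hasDerivAt_const a (Real.Gamma ((n : ℝ) + 1))).div (gA.mul gB) hAB).log
    (div_ne_zero fN hAB)).const_mul (-(1 / (n : ℝ)))
  have hI : deriv (In n) a = 1 / 2 * ((harmonic k : ℝ) - harmonic (n - k)) := by
    have hd' : HasDerivAt (In n) _ a := hd
    rw [hd'.deriv]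
    simp only [Pi.mul_apply, Pi.div_apply, Function.comp_apply, eA, eB]
    field_simp
    ring
  rw [Jn, hI]
  ring

end ERGlauber

end

/-! ### Comparison of `Jn` with `J` and convergence of `mn`. -/

open scoped NNReal Topology

noncomputable section

namespace ERGlauber

/-- The shifted point `a' = -1 + 2(k+1)/(n+2)` is the one with `(1-a')/(1+a') = (n-k+1)/(k+1)`, the
ratio in the harmonic lower bound. It stays inside the domain of `J` even for `k = 0`. -/
lemma J_le_Jn_grid {p β h : ℝ} (hp : 0 ≤ p) (hβ : 0 ≤ β) {n k : ℕ} (hn : 0 < n)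
    (hk : 2 * k ≤ n) :
    ∃ a' : ℝ, -1 < a' ∧ a' ≤ -1 + 2 * (k : ℝ) / n + 2 / n ∧
      J p β h a' - 4 * β * p / n ≤ Jn p β h n (-1 + 2 * (k : ℝ) / n) := by
  have hn' : (0 : ℝ) < n := Nat.cast_pos.2 hn
  have hk' : 2 * (k : ℝ) ≤ n := by exact_mod_cast hk
  have hkn : k ≤ n := by omega
  have hdiff : (-1 + 2 * ((k : ℝ) + 1) / (n + 2)) - (-1 + 2 * (k : ℝ) / n) =
      2 / n * (((n : ℝ) - 2 * k) / (n + 2)) := by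
    field_simp; ring
  have hfrac : ((n : ℝ) - 2 * k) / (n + 2) ≤ 1 := by
    rw [div_le_one (by positivity)]; linarith [(Nat.cast_nonneg k : (0 : ℝ) ≤ k)]
  have hle : 2 / (n : ℝ) * (((n : ℝ) - 2 * k) / (n + 2)) ≤ 2 / n :=
    mul_le_of_le_one_right (by positivity) hfrac
  refine ⟨-1 + 2 * ((k : ℝ) + 1) / (n + 2), ?_, by linarith, ?_⟩
  · have : 0 < 2 * ((k : ℝ) + 1) / (n + 2) := by positivity
    linarith
  · rw [Jn_grid p β h hn hkn, J]
    have h1 := log_le_harmonic_sub (show k ≤ n - k by omega)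
    have h2 : (1 - (-1 + 2 * ((k : ℝ) + 1) / (n + 2))) / (1 + (-1 + 2 * ((k : ℝ) + 1) / (n + 2))) =
        (((n - k : ℕ) : ℝ) + 1) / (k + 1) := by
      rw [Nat.cast_sub hkn, add_neg_cancel_left]
      field_simp; ring
    rw [h2]
    have h3 : 2 * β * p * ((-1 + 2 * ((k : ℝ) + 1) / (n + 2)) - (-1 + 2 * (k : ℝ) / n)) ≤
        2 * β * p * (2 / n) := by
      rw [hdiff]
      exact mul_le_mul_of_nonneg_left hle (by positivity)
    have h4 : 2 * β * p * (2 / n) = 4 * β * p / n := by ring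
    linarith

lemma Jn_grid_le_J {p β h : ℝ} {n k : ℕ} (hk0 : 0 < k) (hk : 2 * k ≤ n) :
    Jn p β h n (-1 + 2 * (k : ℝ) / n) ≤ J p β h (-1 + 2 * (k : ℝ) / n) := by
  have hn : 0 < n := by omega
  have hn' : (0 : ℝ) < n := Nat.cast_pos.2 hn
  have hkn : k ≤ n := by omega
  have hk' : (0 : ℝ) < k := Nat.cast_pos.2 hk0
  rw [Jn_grid p β h hn hkn, J]
  have h1 := harmonic_sub_le_log hk0 (show k ≤ n - k by omega)
  have h2 : (1 - (-1 + 2 * (k : ℝ) / n)) / (1 + (-1 + 2 * (k : ℝ) / n)) =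
      ((n - k : ℕ) : ℝ) / k := by
    rw [Nat.cast_sub hkn, add_neg_cancel_left]
    field_simp; ring
  rw [h2]
  linarith

/-- Grid points below `m - ε` have `Jn > 0`, by comparison with `J (m - ε/2) > 0`; the first grid
point to the right of `m` has `Jn ≤ J < 0`. -/
lemma tendsto_mn {p β h m b : ℝ} (hp : 0 ≤ p) (hβ : 0 ≤ β) (hm : -1 < m) (hmb : m < b)
    (hb : b < 0) (hJ : J p β h m = 0) (hanti : StrictAntiOn (J p β h) (Set.Ioc (-1) b)) :
    Filter.Tendsto (mn p β h) Filter.atTop (𝓝 m) := by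
  rw [Metric.tendsto_atTop]
  intro ε₀ hε₀
  set ε : ℝ := min (ε₀ / 2) (min (b - m) ((1 + m) / 2)) with hεdef
  have hε : 0 < ε := lt_min (by linarith) (lt_min (by linarith) (by linarith))
  have hε1 : ε ≤ ε₀ / 2 := min_le_left _ _
  have hε2 : ε ≤ b - m := (min_le_right _ _).trans (min_le_left _ _)
  have hε3 : ε ≤ (1 + m) / 2 := (min_le_right _ _).trans (min_le_right _ _)
  have hJε : 0 < J p β h (m - ε / 2) := by
    rw [← hJ]
    exact hanti ⟨by linarith, by linarith⟩ ⟨hm, hmb.le⟩ (by linarith)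
  obtain ⟨N, hN⟩ := exists_nat_gt (max (4 / ε) (4 * β * p / J p β h (m - ε / 2)))
  refine ⟨N, fun n hn => ?_⟩
  have hnN : (N : ℝ) ≤ n := Nat.cast_le.2 hn
  have hn1 : 4 / ε < n := (le_max_left _ _).trans_lt (hN.trans_le hnN)
  have hn2 : 4 * β * p / J p β h (m - ε / 2) < n :=
    (le_max_right _ _).trans_lt (hN.trans_le hnN)
  have hn' : (0 : ℝ) < n := lt_trans (by positivity) hn1
  have hn0 : 0 < n := Nat.cast_pos.1 hn'
  have h2n : 2 / (n : ℝ) < ε / 2 := by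
    rw [div_lt_iff₀ hε] at hn1
    rw [div_lt_iff₀ hn']; linarith
  have hJn : 4 * β * p / n < J p β h (m - ε / 2) := by
    rw [div_lt_iff₀ hJε] at hn2
    rw [div_lt_iff₀ hn']; linarith
  have hlower : ∀ a ∈ {a | a ∈ magGrid n ∧ Jn p β h n a ≤ 0}, m - ε ≤ a := by
    rintro a ⟨⟨k, hk, rfl⟩, ha⟩
    by_contra! hlt
    have hk2 : 2 * k ≤ n := by
      have : 2 * (k : ℝ) / n < 1 := by linarith
      rw [div_lt_one hn'] at this
      exact_mod_cast this.le
    obtain ⟨a', h1, h2, h3⟩ := J_le_Jn_grid (h := h) hp hβ hn0 hk2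
    have h4 := hanti.antitoneOn ⟨h1, by linarith⟩ ⟨by linarith, by linarith⟩
      (show a' ≤ m - ε / 2 by linarith)
    linarith
  have hupper : ∃ a ∈ {a | a ∈ magGrid n ∧ Jn p β h n a ≤ 0}, a ≤ m + ε := by
    set x : ℝ := n * (1 + m) / 2 with hx
    have hx0 : 0 ≤ x := by rw [hx]; nlinarith
    set k : ℕ := ⌊x⌋₊ + 1 with hk
    have hkx : x < k := by rw [hk]; push_cast; exact Nat.lt_floor_add_one x
    have hkx' : (k : ℝ) ≤ x + 1 := by
      rw [hk]; push_cast; linarith [Nat.floor_le hx0]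
    have h1 : m < -1 + 2 * (k : ℝ) / n := by
      have : 1 + m < 2 * (k : ℝ) / n := by
        rw [lt_div_iff₀ hn']; linarith
      linarith
    have h2 : -1 + 2 * (k : ℝ) / n ≤ m + 2 / n := by
      have : 2 * (k : ℝ) / n ≤ 1 + m + 2 / n := by
        rw [div_le_iff₀ hn', add_mul, div_mul_cancel₀ _ hn'.ne']; linarith
      linarith
    have hk2 : 2 * k ≤ n := by
      have : 2 * (k : ℝ) / n < 1 := by linarith
      rw [div_lt_one hn'] at this
      exact_mod_cast this.le
    refine ⟨-1 + 2 * (k : ℝ) / n, ⟨⟨k, by omega, rfl⟩, ?_⟩, by linarith⟩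
    refine (Jn_grid_le_J (Nat.succ_pos _) hk2).trans ?_
    rw [← hJ]
    exact (hanti ⟨hm, hmb.le⟩ ⟨by linarith, by linarith⟩ h1).le
  obtain ⟨a, ha, ham⟩ := hupper
  have hl : m - ε ≤ mn p β h n := le_csInf ⟨a, ha⟩ hlower
  have hu : mn p β h n ≤ m + ε := (csInf_le ⟨m - ε, hlower⟩ ha).trans ham
  rw [Real.dist_eq, abs_lt]
  constructor <;> linarith

end ERGlauber

end

/-! ### Choice of the constants, and passage to high probability. -/

open scoped NNReal Topology

noncomputable section

namespace ERGlauber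

open Matrix FiniteMarkov

/-- The right side is the mean-field drift of the magnetization at `a` where the field is
nonpositive; so its sign is that of `J`. -/
lemma exp_J {p β h a : ℝ} (ha : a ∈ Set.Ioo (-1 : ℝ) 1) :
    (1 + a) * (Real.exp (J p β h a) - 1) =
      (1 - a) * Real.exp (2 * β * (p * a + h)) - (1 + a) := by
  have h1 : 0 < 1 - a := by linarith [ha.2]
  have h2 : 0 < 1 + a := by linarith [ha.1]
  rw [J, Real.exp_add, Real.exp_log (div_pos h1 h2)]
  field_simp

/-- The constants can be chosen: the well at the first zero of `J` is non-degenerate. -/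
lemma exists_wellConstants {p β h m b : ℝ} (hp : p ∈ Set.Ioo (0 : ℝ) 1) (hβ : 0 < β)
    (hm : -1 < m) (hmb : m < b) (hb : b < 0) (hJ : J p β h m = 0)
    (hanti : StrictAntiOn (J p β h) (Set.Ioc (-1) b)) (hcurv : β * p < 1 / (1 - m ^ 2)) :
    ∃ δ ε c lam θ₀ δ₂ κ : ℝ, WellConstants p β h m δ ε c lam θ₀ δ₂ ∧ 0 < δ ∧ δ ≤ 1 ∧
      0 < δ₂ ∧ 0 < κ ∧ p * m + h + (δ₂ + δ) ≤ 0 ∧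
      2 * β * Real.exp (2 * β * (p * m + h + (δ₂ + δ))) * ((1 - m) * (p + δ) + δ₂) -
        (1 + Real.exp (2 * β * (p * m + h - (δ₂ + δ)))) ≤ -κ := by
  have hp0 := hp.1
  have hm0 : m < 0 := hmb.trans hb
  have hfix : (1 - m) * Real.exp (2 * β * (p * m + h)) = 1 + m := by
    have := exp_J (p := p) (β := β) (h := h) (show m ∈ Set.Ioo (-1 : ℝ) 1 from ⟨hm, by linarith⟩)
    rw [hJ, Real.exp_zero] at this
    linarith
  have hneg : p * m + h < 0 := by
    have : Real.exp (2 * β * (p * m + h)) < 1 := by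
      by_contra! hle
      nlinarith
    rw [Real.exp_lt_one_iff] at this
    by_contra! hle
    have : 0 ≤ 2 * β * (p * m + h) := by positivity
    linarith
  -- Births minus healing when both errors equal `x`. It is negative at 0 by curvature, hence for a
  -- small `x = δ₂` by continuity; a later `δ ≤ δ₂` only helps. The order of choice is `δ₂`, `ε`,
  -- `c`, then `δ`, `lam`, `θ₀`.
  set F : ℝ → ℝ := fun x => 2 * β * Real.exp (2 * β * (p * m + h + (x + x))) *
    ((1 - m) * (p + x) + x) - (1 + Real.exp (2 * β * (p * m + h - (x + x)))) with hF
  have hF0 : F 0 < 0 := by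
    have h1 : F 0 = 2 * (β * p) * ((1 - m) * Real.exp (2 * β * (p * m + h))) -
        (1 + Real.exp (2 * β * (p * m + h))) := by
      simp only [hF, add_zero, sub_zero]; ring
    have h2 : 0 < 1 - m ^ 2 := by nlinarith
    rw [lt_div_iff₀ h2] at hcurv
    rw [h1, hfix]
    have h3 : 0 < (1 - m) * (1 + Real.exp (2 * β * (p * m + h)) - 2 * (β * p) * (1 + m)) := by
      nlinarith
    linarith [(mul_pos_iff_of_pos_left (by linarith : 0 < 1 - m)).1 h3]
  have hFc : Continuous F := by fun_prop
  obtain ⟨δ₂, ⟨hFδ, hnegδ⟩, hδ₂⟩ : ∃ x : ℝ, (F x < F 0 / 2 ∧ p * m + h + (x + x) < 0) ∧ 0 < x := by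
    have e1 : ∀ᶠ x in 𝓝[>] (0 : ℝ), F x < F 0 / 2 :=
      (hFc.tendsto 0).mono_left nhdsWithin_le_nhds |>.eventually_lt_const (by linarith)
    have e2 : ∀ᶠ x in 𝓝[>] (0 : ℝ), p * m + h + (x + x) < 0 :=
      ((by fun_prop : Continuous fun x : ℝ => p * m + h + (x + x)).tendsto 0).mono_left
        nhdsWithin_le_nhds |>.eventually_lt_const (by simpa using hneg)
    exact ((e1.and e2).and self_mem_nhdsWithin).exists
  set ε : ℝ := min (δ₂ / (32 * β)) (min (-(p * m + h)) (min (b - m) ((1 + m) / 2))) with hεdef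
  have hε : 0 < ε := lt_min (by positivity)
    (lt_min (by linarith) (lt_min (by linarith) (by linarith)))
  have hε1 : ε ≤ δ₂ / (32 * β) := min_le_left _ _
  have hε2 : ε ≤ -(p * m + h) := (min_le_right _ _).trans (min_le_left _ _)
  have hε3 : ε ≤ b - m := ((min_le_right _ _).trans (min_le_right _ _)).trans (min_le_left _ _)
  have hε4 : ε ≤ (1 + m) / 2 :=
    ((min_le_right _ _).trans (min_le_right _ _)).trans (min_le_right _ _)
  have hε1' : 4 * β * ε ≤ δ₂ / 8 := by
    rw [le_div_iff₀ (by positivity)] at hε1; linarith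
  set D : ℝ → ℝ := fun a => (1 - a) * Real.exp (2 * β * (p * a + h)) - (1 + a) with hD
  have hDc : Continuous D := by fun_prop
  -- The strict sign of `J` on either side of `m` becomes a uniform bound by compactness of `[ε/2,
  -- ε]`.
  have hdrift : ∀ e : ℝ, |e| = 1 → ∃ c > 0, ∀ y ∈ Set.Icc (ε / 2) ε, e * D (m + e * y) ≤ -c := by
    intro e he
    obtain ⟨y₀, hy₀, hmax⟩ := isCompact_Icc.exists_isMaxOn
      (Set.nonempty_Icc.2 (by linarith : ε / 2 ≤ ε))
      (by fun_prop : Continuous fun y => e * D (m + e * y)).continuousOn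
    refine ⟨-(e * D (m + e * y₀)), ?_, fun y hy => by simpa using hmax hy⟩
    have hy0 : 0 < y₀ := by linarith [hy₀.1]
    rcases eq_or_eq_neg_of_abs_eq he with rfl | rfl
    · have hlt := hanti ⟨hm, hmb.le⟩ ⟨by linarith, by linarith [hy₀.2]⟩
        (show m < m + 1 * y₀ by linarith)
      rw [hJ] at hlt
      have h1 := exp_J (p := p) (β := β) (h := h)
        (show m + 1 * y₀ ∈ Set.Ioo (-1 : ℝ) 1 from ⟨by linarith, by linarith [hy₀.2]⟩)
      have h2 : Real.exp (J p β h (m + 1 * y₀)) < 1 := Real.exp_lt_one_iff.2 hlt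
      have h3 : D (m + 1 * y₀) < 0 := by
        rw [hD]; simp only; rw [← h1]
        exact mul_neg_of_pos_of_neg (by linarith) (by linarith)
      linarith
    · have hlt := hanti ⟨by linarith [hy₀.2], by linarith⟩ ⟨hm, hmb.le⟩
        (show m + -1 * y₀ < m by linarith)
      rw [hJ] at hlt
      have h1 := exp_J (p := p) (β := β) (h := h)
        (show m + -1 * y₀ ∈ Set.Ioo (-1 : ℝ) 1 from ⟨by linarith [hy₀.2], by linarith⟩)
      have h2 : 1 < Real.exp (J p β h (m + -1 * y₀)) := Real.one_lt_exp_iff.2 hlt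
      have h3 : 0 < D (m + -1 * y₀) := by
        rw [hD]; simp only; rw [← h1]
        exact mul_pos (by linarith [hy₀.2]) (by linarith)
      linarith
  obtain ⟨c₁, hc₁, hd₁⟩ := hdrift 1 abs_one
  obtain ⟨c₂, hc₂, hd₂⟩ := hdrift (-1) (by simp)
  set c : ℝ := min c₁ c₂ with hc
  have hc0 : 0 < c := lt_min hc₁ hc₂
  set δ : ℝ := min 1 (min δ₂ (min (c / (8 * β)) (δ₂ / (32 * β)))) with hδdef
  have hδ : 0 < δ := lt_min one_pos (lt_min hδ₂ (lt_min (by positivity) (by positivity)))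
  have hδ1 : δ ≤ 1 := min_le_left _ _
  have hδ2 : δ ≤ δ₂ := (min_le_right _ _).trans (min_le_left _ _)
  have hδ3 : δ ≤ c / (8 * β) :=
    ((min_le_right _ _).trans (min_le_right _ _)).trans (min_le_left _ _)
  have hδ4 : δ ≤ δ₂ / (32 * β) :=
    ((min_le_right _ _).trans (min_le_right _ _)).trans (min_le_right _ _)
  have hδ3' : 4 * β * δ ≤ c / 2 := by
    rw [le_div_iff₀ (by positivity)] at hδ3; linarith
  have hδ4' : 4 * β * δ ≤ δ₂ / 8 := by
    rw [le_div_iff₀ (by positivity)] at hδ4; linarith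
  set lam : ℝ := min (1 / 2) (c / 8) with hlamdef
  have hlam : 0 < lam := lt_min (by norm_num) (by positivity)
  have hlam1 : lam ≤ 1 / 2 := min_le_left _ _
  have hlam2 : lam ≤ c / 8 := min_le_right _ _
  set θ₀ : ℝ := min (1 / 2) (min (lam * ε / 4) (δ₂ / 32)) with hθdef
  have hθ : 0 < θ₀ := lt_min (by norm_num) (lt_min (by positivity) (by positivity))
  have hθ1 : θ₀ ≤ 1 / 2 := min_le_left _ _
  have hθ2 : θ₀ ≤ lam * ε / 4 := (min_le_right _ _).trans (min_le_left _ _)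
  have hθ3 : θ₀ ≤ δ₂ / 32 := (min_le_right _ _).trans (min_le_right _ _)
  refine ⟨δ, ε, c, lam, θ₀, δ₂, -(F 0 / 2), ?_, hδ, hδ1, hδ₂, by linarith, by linarith, ?_⟩
  · exact
      { p_mem := ⟨hp.1.le, hp.2.le⟩
        β_nonneg := hβ.le
        abs_m := abs_le.2 ⟨hm.le, by linarith⟩
        field_nonpos := hneg.le
        fixed := by linarith
        δ_nonneg := hδ.le
        ε_pos := hε
        field_nonpos_near := fun x hx => by
          have h1 := (abs_le.1 hx).2
          have h2 : p * (x - m) ≤ ε :=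
            (mul_le_mul_of_nonneg_left h1 hp0.le).trans
              (mul_le_of_le_one_left hε.le hp.2.le)
          linarith
        drift := fun e he y hy => by
          rcases eq_or_eq_neg_of_abs_eq he with rfl | rfl
          · exact (hd₁ y hy).trans (neg_le_neg (min_le_left _ _))
          · exact (hd₂ y hy).trans (neg_le_neg (min_le_right _ _))
        drift_dominates := by linarith
        lam_pos := hlam
        lam_le := hlam1
        θ_pos := hθ
        θ_le := hθ1
        θ_le_lam := by linarith
        error_le := by linarith }
  · rw [neg_neg]
    refine le_trans ?_ hFδ.le
    rw [hF]
    have h1m : 0 ≤ 1 - m := by linarith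
    refine sub_le_sub ?_ ?_
    · gcongr
    · gcongr

lemma eventually_pow_mul_exp_le (A : ℝ) {a : ℝ} (ha : 0 < a) (k : ℕ) :
    ∀ᶠ n : ℕ in Filter.atTop,
      A * (n : ℝ) ^ k * Real.exp (-(a * n)) ≤ Real.exp (-(n : ℝ) ^ (2 / 3 : ℝ)) / 2 := by
  have h1 : Filter.Tendsto (fun x : ℝ => A * (x ^ (k : ℝ) * Real.exp (-(a / 2) * x)))
      Filter.atTop (𝓝 0) := by
    simpa using (tendsto_rpow_mul_exp_neg_mul_atTop_nhds_zero k (a / 2)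
      (by positivity)).const_mul A
  have h2 : Filter.Tendsto (fun x : ℝ => x ^ (-(1 / 3) : ℝ)) Filter.atTop (𝓝 0) :=
    tendsto_rpow_neg_atTop (by norm_num)
  have e1 := tendsto_natCast_atTop_atTop.eventually
    (h1.eventually_le_const (by norm_num : (0 : ℝ) < 1 / 2))
  have e2 := tendsto_natCast_atTop_atTop.eventually
    (h2.eventually_le_const (by positivity : 0 < a / 2))
  filter_upwards [e1, e2, Filter.eventually_gt_atTop 0] with n h1 h2 hn
  have hn' : (0 : ℝ) < n := Nat.cast_pos.2 hn
  have h3 : (n : ℝ) ^ (2 / 3 : ℝ) ≤ a / 2 * n := by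
    have : (n : ℝ) ^ (2 / 3 : ℝ) = (n : ℝ) ^ (-(1 / 3) : ℝ) * n := by
      rw [← Real.rpow_add_one hn'.ne']; norm_num
    rw [this]
    exact mul_le_mul_of_nonneg_right h2 hn'.le
  have h4 : Real.exp (-(a * n)) = Real.exp (-(a / 2) * n) * Real.exp (-(a / 2 * n)) := by
    rw [← Real.exp_add]; ring_nf
  rw [Real.rpow_natCast] at h1
  calc A * (n : ℝ) ^ k * Real.exp (-(a * n))
      = A * ((n : ℝ) ^ k * Real.exp (-(a / 2) * n)) * Real.exp (-(a / 2 * n)) := by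
        rw [h4]; ring
    _ ≤ 1 / 2 * Real.exp (-(a / 2 * n)) :=
        mul_le_mul_of_nonneg_right h1 (Real.exp_pos _).le
    _ ≤ 1 / 2 * Real.exp (-(n : ℝ) ^ (2 / 3 : ℝ)) := by
        gcongr
    _ = _ := by ring

lemma mag_eq_mn {p β h : ℝ} {n : ℕ} (hn : 0 < n) {σ : Config n}
    (hσ : σ ∈ metastableSet p β h n) : mag σ = mn p β h n := by
  have hn' : (n : ℝ) ≠ 0 := (Nat.cast_pos.2 hn).ne'
  have hs : ∀ v, spin σ v = 2 * (if σ v = 1 then 1 else 0) - 1 := by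
    intro v
    rcases Int.units_eq_one_or (σ v) with hv | hv <;> (simp [spin, hv]; try norm_num)
  have hv : (volume σ : ℝ) = ∑ v, if σ v = 1 then 1 else 0 := by
    simp [volume]
  have h1 : ∑ v, spin σ v = 2 * (volume σ : ℝ) - n := by
    rw [hv, Finset.mul_sum]
    simp [hs, Finset.sum_sub_distrib]
  have h2 : (volume σ : ℝ) = Mn p β h n := hσ
  rw [mag, h1, h2, Mn]
  field_simp
  ring

/-- Only subadditivity is used, in the form `1 ≤ μ(E) + μ(not quasirandom)`, so `E n` need not be
measurable. -/
lemma tendsto_prob_of_quasirandom {p δ : ℝ} (hp : p ∈ Set.Icc (0 : ℝ) 1) (hδ0 : 0 < δ)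
    (hδ : δ ≤ 1) {E : ∀ n : ℕ, Set (SimpleGraph (Fin n))}
    (hE : ∀ᶠ n in Filter.atTop, ∀ G, Quasirandom G p δ → G ∈ E n) :
    Filter.Tendsto (fun n : ℕ => SimpleGraph.binomialRandom (Fin n) ⟨p, hp.1, hp.2⟩ (E n))
      Filter.atTop (𝓝 1) := by
  have h1 := tendsto_not_quasirandom ⟨p, hp.1, hp.2⟩ hδ0 hδ
  have h2 := ENNReal.tendsto_ofReal h1
  have h3 := ENNReal.Tendsto.sub (tendsto_const_nhds (x := (1 : ENNReal))) h2
    (Or.inl ENNReal.one_ne_top)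
  rw [ENNReal.ofReal_zero, tsub_zero] at h3
  refine tendsto_of_tendsto_of_tendsto_of_le_of_le' h3 tendsto_const_nhds ?_
    (Filter.Eventually.of_forall fun n => MeasureTheory.prob_le_one)
  filter_upwards [hE] with n hn
  rw [MeasureTheory.ofReal_measureReal, tsub_le_iff_right]
  calc (1 : ENNReal) = SimpleGraph.binomialRandom (Fin n) ⟨p, hp.1, hp.2⟩ Set.univ :=
        MeasureTheory.measure_univ.symm
    _ ≤ SimpleGraph.binomialRandom (Fin n) ⟨p, hp.1, hp.2⟩ (E n ∪ {G | ¬ Quasirandom G p δ}) := by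
        refine MeasureTheory.measure_mono fun G _ => ?_
        by_cases hG : Quasirandom G p δ
        · exact Or.inl (hn G hG)
        · exact Or.inr hG
    _ ≤ _ := MeasureTheory.measure_union_le _ _

end ERGlauber

end

/-! ### Assembly. -/

theorem mainTheorem5 (p β h : ℝ) (hp : p ∈ Set.Ioo (0 : ℝ) 1)
    (hmeta : ERGlauber.Metastable p β h) :
    ∃ m : ℝ, m ∈ Set.Ioo (-1 : ℝ) 0 ∧ ERGlauber.J p β h m = 0 ∧
      (∀ a ∈ Set.Ioo (-1 : ℝ) m, 0 < ERGlauber.J p β h a) ∧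
      Filter.Tendsto (ERGlauber.mn p β h) Filter.atTop (nhds m) ∧
      β * p < 1 / (1 - m ^ 2) ∧
      ∃ κ C : ℝ, 0 < κ ∧ 0 < C ∧
        Filter.Tendsto
          (fun n : ℕ =>
            SimpleGraph.binomialRandom (Fin n) ⟨p, hp.1.le, hp.2.le⟩
              {G | ∀ σ ∈ ERGlauber.metastableSet p β h n,
                ∀ σ' ∈ ERGlauber.metastableSet p β h n,
                  ∃ c : ERGlauber.Coupling G β h σ σ',
                    c.probNe (2 * (n : NNReal)) ≤ Real.exp (-(n : ℝ) ^ (2 / 3 : ℝ)) ∧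
                    ∀ t : NNReal, t ≤ 2 * (n : NNReal) →
                      c.meanDisagreement t ≤
                        C * Real.exp (-κ * (t : ℝ)) *
                            ((ERGlauber.disagreement σ σ').card : ℝ) +
                          Real.exp (-(n : ℝ) ^ (2 / 3 : ℝ))})
          Filter.atTop (nhds 1) := by
  have hβ : 0 < β := lt_trans (by have := hp.1; positivity) hmeta.1
  obtain ⟨m, b, hm, hmb, hb, hJ, hanti, hcurv⟩ := ERGlauber.exists_first_zero hp hmeta
  have hmn := ERGlauber.tendsto_mn hp.1.le hβ.le hm hmb hb hJ hanti
  refine ⟨m, ⟨hm, hmb.trans hb⟩, hJ, fun a ha => ?_, hmn, hcurv, ?_⟩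
  · rw [← hJ]
    exact hanti ⟨ha.1, (ha.2.trans hmb).le⟩ ⟨hm, hmb.le⟩ ha.2
  obtain ⟨δ, ε, c, lam, θ₀, δ₂, κ, K, hδ0, hδ1, hδ₂, hκ, hneg, hκb⟩ :=
    ERGlauber.exists_wellConstants hp hβ hm hmb hb hJ hanti hcurv
  -- The burn-in time: long enough for the initial local deviations to fade, and independent of `n`.
  set T : ℝ := max 0 (-Real.log (δ₂ / 8)) with hTdef
  have hT0 : 0 ≤ T := le_max_left _ _
  have hT : Real.exp (-T) ≤ δ₂ / 8 := by
    rw [← Real.le_log_iff_exp_le (by positivity)]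
    linarith [le_max_right 0 (-Real.log (δ₂ / 8))]
  refine ⟨κ, Real.exp ((4 * β + κ) * T), hκ, Real.exp_pos _, ?_⟩
  refine ERGlauber.tendsto_prob_of_quasirandom ⟨hp.1.le, hp.2.le⟩ hδ0 hδ1 ?_
  have e1 : ∀ᶠ n in Filter.atTop, |ERGlauber.mn p β h n - m| ≤ ε / 2 :=
    (Metric.tendsto_atTop'.1 hmn (ε / 2) (by linarith [K.ε_pos])).elim fun N hN =>
      (Filter.eventually_gt_atTop N).mono fun n hn => (hN n hn).le
  have hθ : 0 < θ₀ * δ₂ / 4 := div_pos (mul_pos K.θ_pos hδ₂) (by norm_num)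
  filter_upwards [e1, Filter.eventually_gt_atTop 0,
    ERGlauber.eventually_pow_mul_exp_le ((4 * β + κ) * 680) hθ 7,
    ERGlauber.eventually_pow_mul_exp_le (Real.exp ((4 * β + κ) * T))
      (by linarith : 0 < 2 * κ) 1] with n hmn hn h7 h1 G hG σ hσ σ' hσ'
  have hd := fun t (ht : t ∈ Set.Icc (0 : ℝ) (2 * n)) =>
    K.discrepancy_decay hn hG hκ.le hneg hκb hT0 hT (z := (σ, σ'))
      (by rw [ERGlauber.mag_eq_mn hn hσ]; exact hmn)
      (by rw [ERGlauber.mag_eq_mn hn hσ']; exact hmn) ht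
  have h7' : (4 * β + κ) * 680 * (n : ℝ) ^ 7 * Real.exp (-(n * θ₀ * δ₂ / 4)) ≤
      Real.exp (-(n : ℝ) ^ (2 / 3 : ℝ)) / 2 := by
    rwa [show (n : ℝ) * θ₀ * δ₂ / 4 = θ₀ * δ₂ / 4 * n by ring]
  obtain ⟨C, hmean, hne⟩ := ERGlauber.exists_coupling G β h σ σ'
  refine ⟨C, ?_, fun t ht => ?_⟩
  · refine (hne _).trans ?_
    have hcast : ((2 * (n : NNReal) : NNReal) : ℝ) = 2 * n := by push_cast; rfl
    rw [hcast]
    refine (hd _ ⟨by positivity, le_rfl⟩).trans ?_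
    -- At `t = 2n` even the maximal discrepancy `n` is contracted below half of the allowed error;
    -- the other half covers the tail term.
    have h2 : Real.exp ((4 * β + κ) * T) * Real.exp (-κ * (2 * n)) *
        ERGlauber.discrepancy (σ, σ') ≤ Real.exp (-(n : ℝ) ^ (2 / 3 : ℝ)) / 2 := by
      refine le_trans ?_ h1
      rw [show -κ * (2 * (n : ℝ)) = -(2 * κ * n) by ring, pow_one, mul_right_comm]
      gcongr
      exact ERGlauber.discrepancy_le _
    linarith
  · rw [hmean]
    refine (hd t ⟨t.2, by exact_mod_cast ht⟩).trans ?_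
    have h0 := Real.exp_pos (-(n : ℝ) ^ (2 / 3 : ℝ))
    have h2 : ERGlauber.discrepancy (σ, σ') = ((ERGlauber.disagreement σ σ').card : ℝ) := rfl
    rw [h2]
    linarith
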